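/- **Theorem 4.1.** Let $K:\mathbf R^2\to\mathbf R$ be bounded and continuously differentiable with bounded first derivatives, and suppose that - (K-1) there is $k_m>0$ with $K(x)\ge k_m$ for all $x\in\mathbf R^2$; - (K-3) there are $r_0>0$ and $k_0$ with $K(x)=k_0$ for all $|x|>r_0$; - (K-4) there is $\gamma_0\in[0,1)$ with $x\cdot\nabla K(x)\le\gamma_0K(x)$ for all $x\in\mathbf R^2$. Let $u_0,u_1\in C_0^\infty(\mathbf R^2)$ be real-valued with $\operatorname{supp}u_j\subset\{|x|\le L\}$ $(j=0,1)$ for some $L>0$. Let $u\in C([0,\infty);H^1(\mathbf R^2))\cap C^1([0,\infty);L^2(\mathbf R^2))$ be the (real-valued) weak solution of $$u_{tt}-\nabla\cdot(K(x)\nabla u)=0\quad\text{in }(0,\infty)\times\mathbf R^2,\qquad u(0,\cdot)=u_0,\quad u_t(0,\cdot)=u_1,$$ that is, $\frac{d}{dt}\int_{\mathbf R^2}u_t(t,x)\varphi(x)\,dx=-\int_{\mathbf R^2}K(x)\nabla u(t,x)\cdot\nabla\varphi(x)\,dx$ for all $t>0$ and all $\varphi\in C_0^\infty(\mathbf R^2)$.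 Then, for every fixed $R>r_0$, $$E_{u,R}(t):=\frac12\int_{|x|\le R}\bigl(|u_t(t,x)|^2+K(x)|\nabla u(t,x)|^2\bigr)\,dx=O\bigl(t^{\gamma_0-1}\sqrt{\log t}\bigr)\qquad(t\to\infty).$$ -/

import Mathlib

open MeasureTheory Filter Topology Asymptotics
open scoped ContDiff

/-- The Euclidean plane. -/
abbrev Plane : Type := EuclideanSpace ℝ (Fin 2)

/-- The real Hilbert space of square integrable functions on the plane. -/
abbrev PlaneL2 : Type := Lp ℝ 2 (volume : Measure Plane)

/-- The real Hilbert space of square integrable vector fields on the plane. -/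
abbrev PlaneVecL2 : Type := Lp Plane 2 (volume : Measure Plane)

/-- `K` is bounded and continuous, with bounded and continuous first derivatives. -/
structure IsBC1 (K : Plane → ℝ) : Prop where
  contDiff : ContDiff ℝ 1 K
  bounded : ∃ C : ℝ, ∀ x, |K x| ≤ C
  bounded_deriv : ∃ C : ℝ, ∀ x, ‖gradient K x‖ ≤ C

/-- Test functions: smooth real functions of compact support on the plane. -/
def IsTestFunction (φ : Plane → ℝ) : Prop :=
  ContDiff ℝ ∞ φ ∧ HasCompactSupport φ

/-- `g` is the weak (distributional) gradient of `f`. As `f` and `g` are square integrable, this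
says that `f` belongs to the Sobolev space `H¹` and that `∇f = g`. -/
def HasWeakGradient (f : PlaneL2) (g : PlaneVecL2) : Prop :=
  ∀ φ : Plane → ℝ, IsTestFunction φ → ∀ v : Plane,
    ∫ x, f x * fderiv ℝ φ x v = - ∫ x, inner ℝ (g x) v * φ x

/-- `u`, with time derivative `ut` and spatial gradient `gradu`, is a weak solution of finite energy
of the Cauchy problem `u_tt - ∇ · (K ∇u) = 0` for `t > 0`, `u = u₀` and `u_t = u₁` at `t = 0`:
it lies in the class `C([0, ∞); H¹) ∩ C¹([0, ∞); L²)`, takes the initial data, and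
`d/dt (u_t, φ) + (K ∇u, ∇φ) = 0` for all `t > 0` and all test functions `φ` on the plane.
Values at negative times are irrelevant. -/
structure IsEnergySolution (K u₀ u₁ : Plane → ℝ)
    (u ut : ℝ → PlaneL2) (gradu : ℝ → PlaneVecL2) : Prop where
  hasWeakGradient : ∀ t : ℝ, 0 ≤ t → HasWeakGradient (u t) (gradu t)
  continuousOn : ContinuousOn u (Set.Ici 0)
  continuousOn_grad : ContinuousOn gradu (Set.Ici 0)
  hasDerivWithinAt : ∀ t : ℝ, 0 ≤ t → HasDerivWithinAt u (ut t) (Set.Ici 0) t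
  continuousOn_deriv : ContinuousOn ut (Set.Ici 0)
  initial_value : (u 0 : Plane → ℝ) =ᵐ[volume] u₀
  initial_velocity : (ut 0 : Plane → ℝ) =ᵐ[volume] u₁
  equation : ∀ φ : Plane → ℝ, IsTestFunction φ → ∀ t : ℝ, 0 < t →
    HasDerivAt (fun s : ℝ => ∫ x, ut s x * φ x)
      (- ∫ x, K x * inner ℝ (gradu t x) (gradient φ x)) t

/-- The energy in the closed ball of radius `R` about the origin, at time `t`. -/
noncomputable def localEnergy (K : Plane → ℝ) (ut : ℝ → PlaneL2) (gradu : ℝ → PlaneVecL2)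
    (R t : ℝ) : ℝ :=
  (1 / 2) * ∫ x in Metric.closedBall (0 : Plane) R, ((ut t x) ^ 2 + K x * ‖gradu t x‖ ^ 2)

/-! The proof is the multiplier method of Morawetz. Testing the equation with `x · ∇u + u` and with
`u`, subtracting half of the second identity from the first, and using that the energy `E` does not
increase, one finds `t E(t) + (u_t, x · ∇u) + ½ (u_t, u) ≤ const + ½ ∫₀ᵗ ∫ (x · ∇K) |∇u|²`
(`IsExtendedSolution.morawetz_le`). On the right, `∇K` vanishes for `|x| > r₀` and `x · ∇K ≤ γ₀ K`,
so the last term `Y` satisfies `Y' ≤ γ₀ E_R` (`inner_radial_le`). On the left, finite propagation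
speed confines the solution to `|x| ≤ √k₀ t + c`. Outside the ball of radius `R` the cross term
therefore costs at most `t + const` times the energy density, inside it costs only a constant times
the density, and `(t - C) E_R(t)` survives (`localEnergy_le_morawetz`). If `‖u(t)‖ = O(√(log t))`,
this leaves `(t - C) E_R ≤ M √(log t) + Y`, and a Gronwall argument
(`isBigO_of_integral_inequality`) gives the rate.

The `L²` bound is where dimension two matters. With `v(t) = ∫₀ᵗ u`, the quantity `‖u‖² + ∫ K |∇v|² -
2 (u₁, v)` is conserved. The pairing `(u₁, v)` is absorbed by `∫ K |∇v|²` through a Hardy inequality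
(`HasWeakGradient.hardy`) whose constant is the logarithm of the size of the support of `v`; that
support grows linearly in time, hence the factor `log t`.

The solution has only finite energy, so the formal multipliers are not admissible. Weighted energy
estimates are proved for averages over short time intervals and then passed to the limit
(`IsExtendedSolution.weightedEnergy_le`). The multiplier `x · ∇u + u` is the generator of the
unitary dilations `e^τ f(e^τ x)`; it is replaced by a symmetric difference of dilations, and `τ → 0`
is taken only after integration in time (`IsExtendedSolution.morawetz`). -/

open scoped Convolution

/-! ### Multiplication operators and dominated convergence in `L²`. -/

section L2Tools

variable {E F : Type*} [NormedAddCommGroup E] [InnerProductSpace ℝ E]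
  [NormedAddCommGroup F] [InnerProductSpace ℝ F]

/-- A bounded measurable field of continuous linear maps on the plane. -/
structure IsBoundedField (A : Plane → E →L[ℝ] F) : Prop where
  meas : AEStronglyMeasurable A volume
  bdd : ∃ C : ℝ, ∀ x, ‖A x‖ ≤ C

theorem IsBoundedField.aestronglyMeasurable_apply {A : Plane → E →L[ℝ] F} (hA : IsBoundedField A)
    {f : Plane → E} (hf : AEStronglyMeasurable f volume) :
    AEStronglyMeasurable (fun x => A x (f x)) volume :=
  (ContinuousLinearMap.id ℝ (E →L[ℝ] F)).aestronglyMeasurable_comp₂ hA.meas hf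

theorem IsBoundedField.memLp {A : Plane → E →L[ℝ] F} (hA : IsBoundedField A)
    {f : Plane → E} (hf : MemLp f 2 (volume : Measure Plane)) :
    MemLp (fun x => A x (f x)) 2 (volume : Measure Plane) := by
  obtain ⟨C, hC⟩ := hA.bdd
  exact hf.of_le_mul (c := C) (hA.aestronglyMeasurable_apply hf.1)
    (Eventually.of_forall fun x => ((A x).le_opNorm _).trans (by gcongr; exact hC x))

/-- The multiplication operator on square integrable functions given by a bounded field. -/
noncomputable def mulOp (A : Plane → E →L[ℝ] F) (hA : IsBoundedField A) :
    Lp E 2 (volume : Measure Plane) →L[ℝ] Lp F 2 (volume : Measure Plane) :=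
  LinearMap.mkContinuous
    { toFun := fun f => (hA.memLp (Lp.memLp f)).toLp
      map_add' := fun f g => by
        rw [← MemLp.toLp_add]
        refine MemLp.toLp_congr _ _ ?_
        filter_upwards [Lp.coeFn_add f g] with x hx
        simp only [AddMemClass.coe_add] at hx ⊢
        rw [Pi.add_apply, ← map_add]
        exact congrArg (A x) hx
      map_smul' := fun c f => by
        rw [RingHom.id_apply, ← MemLp.toLp_const_smul]
        refine MemLp.toLp_congr _ _ ?_
        filter_upwards [Lp.coeFn_smul c f] with x hx
        rw [Pi.smul_apply, ← map_smul]
        exact congrArg (A x) hx } hA.bdd.choose fun f => by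
    refine Lp.norm_le_mul_norm_of_ae_le_mul ?_
    filter_upwards [(hA.memLp (Lp.memLp f)).coeFn_toLp] with x hx
    simp only [LinearMap.coe_mk, AddHom.coe_mk, hx]
    exact ((A x).le_opNorm _).trans (by gcongr; exact hA.bdd.choose_spec x)

theorem coeFn_mulOp (A : Plane → E →L[ℝ] F) (hA : IsBoundedField A)
    (f : Lp E 2 (volume : Measure Plane)) :
    mulOp A hA f =ᵐ[volume] fun x => A x (f x) :=
  (hA.memLp (Lp.memLp f)).coeFn_toLp

/-- A bounded measurable scalar function on the plane. -/
structure IsBoundedMeas (a : Plane → ℝ) : Prop where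
  meas : AEStronglyMeasurable a volume
  bdd : ∃ C : ℝ, ∀ x, |a x| ≤ C

theorem IsBoundedMeas.isBoundedField {a : Plane → ℝ} (ha : IsBoundedMeas a) :
    IsBoundedField (fun x => a x • ContinuousLinearMap.id ℝ E) := by
  obtain ⟨C, hC⟩ := ha.bdd
  refine ⟨ha.meas.smul_const _, C, fun x => ?_⟩
  rw [norm_smul, Real.norm_eq_abs]
  calc |a x| * ‖ContinuousLinearMap.id ℝ E‖ ≤ |a x| * 1 := by
        gcongr; exact ContinuousLinearMap.norm_id_le
    _ ≤ C := by rw [mul_one]; exact hC x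

variable (E) in
/-- Multiplication by a bounded measurable scalar function. -/
noncomputable def scalarMul (a : Plane → ℝ) (ha : IsBoundedMeas a) :
    Lp E 2 (volume : Measure Plane) →L[ℝ] Lp E 2 (volume : Measure Plane) :=
  mulOp _ ha.isBoundedField

theorem coeFn_scalarMul (a : Plane → ℝ) (ha : IsBoundedMeas a)
    (f : Lp E 2 (volume : Measure Plane)) :
    scalarMul E a ha f =ᵐ[volume] fun x => a x • f x :=
  coeFn_mulOp _ _ f

theorem inner_scalarMul (a : Plane → ℝ) (ha : IsBoundedMeas a)
    (f g : Lp E 2 (volume : Measure Plane)) :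
    inner ℝ (scalarMul E a ha f) g = ∫ x, a x * inner ℝ (f x) (g x) := by
  rw [L2.inner_def]
  refine integral_congr_ae ?_
  filter_upwards [coeFn_scalarMul a ha f] with x hx
  rw [hx, inner_smul_left]; rfl

theorem integrable_mul_inner {a : Plane → ℝ} (ha : IsBoundedMeas a)
    (f g : Lp E 2 (volume : Measure Plane)) :
    Integrable (fun x => a x * inner ℝ (f x) (g x)) := by
  refine (L2.integrable_inner (𝕜 := ℝ) (scalarMul E a ha f) g).congr ?_
  filter_upwards [coeFn_scalarMul a ha f] with x hx
  rw [hx, inner_smul_left]; rfl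

theorem inner_scalarMul_comm (a : Plane → ℝ) (ha : IsBoundedMeas a)
    (f g : Lp E 2 (volume : Measure Plane)) :
    inner ℝ (scalarMul E a ha f) g = inner ℝ f (scalarMul E a ha g) := by
  rw [inner_scalarMul, real_inner_comm, inner_scalarMul]
  simp_rw [real_inner_comm]

theorem norm_sq_eq_integral (f : Lp E 2 (volume : Measure Plane)) :
    ‖f‖ ^ 2 = ∫ x, ‖f x‖ ^ 2 := by
  rw [← real_inner_self_eq_norm_sq, L2.inner_def]
  simp_rw [real_inner_self_eq_norm_sq]

theorem integrable_norm_sq (f : Lp E 2 (volume : Measure Plane)) :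
    Integrable (fun x => ‖f x‖ ^ 2) := by
  have := L2.integrable_inner (𝕜 := ℝ) f f
  simp_rw [real_inner_self_eq_norm_sq] at this
  exact this

/-- Dominated convergence in the space of square integrable functions. -/
theorem tendsto_Lp_of_dominated {ι : Type*} {l : Filter ι} [l.IsCountablyGenerated]
    {Φ : ι → Lp E 2 (volume : Measure Plane)} {f : Lp E 2 (volume : Measure Plane)}
    {φ : ι → Plane → E} {f' : Plane → E} {b : Plane → ℝ}
    (hΦ : ∀ᶠ i in l, Φ i =ᵐ[volume] φ i) (hf : f =ᵐ[volume] f')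
    (hb : MemLp b 2 (volume : Measure Plane))
    (hle : ∀ᶠ i in l, ∀ᵐ x, ‖φ i x‖ ≤ b x) (hle' : ∀ᵐ x, ‖f' x‖ ≤ b x)
    (hlim : ∀ᵐ x, Tendsto (fun i => φ i x) l (𝓝 (f' x))) :
    Tendsto Φ l (𝓝 f) := by
  have key : Tendsto (fun i => ∫ x, ‖φ i x - f' x‖ ^ 2) l (𝓝 (∫ _ : Plane, (0:ℝ))) := by
    refine tendsto_integral_filter_of_dominated_convergence (fun x => (2 * b x) ^ 2) ?_ ?_ ?_ ?_
    · filter_upwards [hΦ] with i hi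
      have h1 : AEStronglyMeasurable (φ i) (volume : Measure Plane) := (Lp.memLp (Φ i)).1.congr hi
      have h2 : AEStronglyMeasurable f' (volume : Measure Plane) := (Lp.memLp f).1.congr hf
      exact (h1.sub h2).norm.pow 2
    · filter_upwards [hle] with i hi
      filter_upwards [hi, hle'] with x hx hx'
      rw [Real.norm_of_nonneg (by positivity)]
      have : ‖φ i x - f' x‖ ≤ 2 * b x := (norm_sub_le _ _).trans (by linarith)
      gcongr
    · exact (hb.const_mul 2).integrable_sq
    · filter_upwards [hlim] with x hx
      have := ((hx.sub_const (f' x)).norm).pow 2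
      simpa using this
  rw [integral_zero] at key
  rw [tendsto_iff_norm_sub_tendsto_zero]
  have h2 : Tendsto (fun i => ‖Φ i - f‖ ^ 2) l (𝓝 0) := by
    refine key.congr' ?_
    filter_upwards [hΦ] with i hi
    rw [norm_sq_eq_integral]
    refine integral_congr_ae ?_
    filter_upwards [hi, hf, Lp.coeFn_sub (Φ i) f] with x h1 h2 h3
    rw [h3, Pi.sub_apply, h1, h2]
  have h3 := (Real.continuous_sqrt.tendsto 0).comp h2
  rw [Real.sqrt_zero] at h3
  refine h3.congr fun i => ?_
  simp [Real.sqrt_sq (norm_nonneg _)]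

end L2Tools

/-! ### Test functions and the calculus of weak gradients. -/

theorem Continuous.isBoundedMeas {a : Plane → ℝ} (ha : Continuous a) {C : ℝ}
    (hC : ∀ x, |a x| ≤ C) : IsBoundedMeas a := ⟨ha.aestronglyMeasurable, C, hC⟩

theorem IsTestFunction.memLp {φ : Plane → ℝ} (hφ : IsTestFunction φ) :
    MemLp φ 2 (volume : Measure Plane) :=
  hφ.1.continuous.memLp_of_hasCompactSupport hφ.2

theorem inner_gradient {φ : Plane → ℝ} (x v : Plane) :
    inner ℝ (gradient φ x) v = fderiv ℝ φ x v := by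
  simp [gradient]

theorem continuous_gradient {φ : Plane → ℝ} (hφ : ContDiff ℝ 1 φ) : Continuous (gradient φ) :=
  (InnerProductSpace.toDual ℝ Plane).symm.continuous.comp (hφ.continuous_fderiv one_ne_zero)

theorem HasCompactSupport.gradient {φ : Plane → ℝ} (hφ : HasCompactSupport φ) :
    HasCompactSupport (gradient φ) := by
  have := HasCompactSupport.fderiv (𝕜 := ℝ) hφ
  exact this.comp_left (g := (InnerProductSpace.toDual ℝ Plane).symm) (map_zero _)

theorem IsTestFunction.memLp_gradient {φ : Plane → ℝ} (hφ : IsTestFunction φ) :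
    MemLp (gradient φ) 2 (volume : Measure Plane) :=
  (continuous_gradient (hφ.1.of_le (by norm_cast))).memLp_of_hasCompactSupport hφ.2.gradient

theorem IsTestFunction.fderiv_apply {φ : Plane → ℝ} (hφ : IsTestFunction φ) (v : Plane) :
    IsTestFunction (fun x => fderiv ℝ φ x v) :=
  ⟨(hφ.1.fderiv_right (m := ∞) (by norm_cast)).clm_apply contDiff_const, hφ.2.fderiv_apply ℝ v⟩

theorem IsTestFunction.smooth_mul {φ ζ : Plane → ℝ} (hφ : IsTestFunction φ) (hζ : ContDiff ℝ ∞ ζ) :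
    IsTestFunction (fun x => ζ x * φ x) :=
  ⟨hζ.mul hφ.1, hφ.2.mul_left⟩

/-- A test function as an element of `L²`. -/
noncomputable def IsTestFunction.toL2 {φ : Plane → ℝ} (hφ : IsTestFunction φ) : PlaneL2 :=
  hφ.memLp.toLp

/-- The gradient of a test function as an element of `L²`. -/
noncomputable def IsTestFunction.gradL2 {φ : Plane → ℝ} (hφ : IsTestFunction φ) : PlaneVecL2 :=
  hφ.memLp_gradient.toLp

theorem IsTestFunction.coeFn_toL2 {φ : Plane → ℝ} (hφ : IsTestFunction φ) :
    hφ.toL2 =ᵐ[volume] φ := hφ.memLp.coeFn_toLp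

theorem IsTestFunction.coeFn_gradL2 {φ : Plane → ℝ} (hφ : IsTestFunction φ) :
    hφ.gradL2 =ᵐ[volume] gradient φ := hφ.memLp_gradient.coeFn_toLp

theorem IsTestFunction.inner_toL2 {φ : Plane → ℝ} (hφ : IsTestFunction φ) (f : PlaneL2) :
    inner ℝ f hφ.toL2 = ∫ x, f x * φ x := by
  rw [L2.inner_def]
  refine integral_congr_ae ?_
  filter_upwards [hφ.coeFn_toL2] with x hx
  rw [hx, real_inner_comm]; rfl

theorem IsTestFunction.memLp_smul_const {φ : Plane → ℝ} (hφ : IsTestFunction φ) (v : Plane) :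
    MemLp (fun x => φ x • v) 2 (volume : Measure Plane) :=
  (hφ.1.continuous.smul continuous_const).memLp_of_hasCompactSupport (hφ.2.smul_right)

theorem hasWeakGradient_iff (f : PlaneL2) (g : PlaneVecL2) :
    HasWeakGradient f g ↔ ∀ (φ : Plane → ℝ) (hφ : IsTestFunction φ) (v : Plane),
      inner ℝ f (hφ.fderiv_apply v).toL2 + inner ℝ g (hφ.memLp_smul_const v).toLp = (0:ℝ) := by
  refine forall_congr' fun φ => forall_congr' fun hφ => forall_congr' fun v => ?_
  have : inner ℝ g (hφ.memLp_smul_const v).toLp = ∫ x, inner ℝ (g x) v * φ x := by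
    rw [L2.inner_def]
    refine integral_congr_ae ?_
    filter_upwards [(hφ.memLp_smul_const v).coeFn_toLp] with x hx
    rw [hx, inner_smul_right, mul_comm]
  rw [IsTestFunction.inner_toL2, this, eq_neg_iff_add_eq_zero]

theorem HasWeakGradient.add {f f' : PlaneL2} {g g' : PlaneVecL2} (h : HasWeakGradient f g)
    (h' : HasWeakGradient f' g') : HasWeakGradient (f + f') (g + g') := by
  rw [hasWeakGradient_iff] at *
  intro φ hφ v
  rw [inner_add_left, inner_add_left]
  linarith [h φ hφ v, h' φ hφ v]

theorem HasWeakGradient.smul {f : PlaneL2} {g : PlaneVecL2} (h : HasWeakGradient f g) (c : ℝ) :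
    HasWeakGradient (c • f) (c • g) := by
  rw [hasWeakGradient_iff] at *
  intro φ hφ v
  rw [inner_smul_left, inner_smul_left, ← mul_add, h φ hφ v, mul_zero]

theorem HasWeakGradient.sub {f f' : PlaneL2} {g g' : PlaneVecL2} (h : HasWeakGradient f g)
    (h' : HasWeakGradient f' g') : HasWeakGradient (f - f') (g - g') := by
  have := h.add (h'.smul (-1))
  simpa [sub_eq_add_neg] using this

theorem HasWeakGradient.intervalIntegral {f : ℝ → PlaneL2} {g : ℝ → PlaneVecL2} {a b : ℝ}
    (hab : a ≤ b) (hf : ContinuousOn f (Set.Icc a b)) (hg : ContinuousOn g (Set.Icc a b))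
    (h : ∀ t ∈ Set.Icc a b, HasWeakGradient (f t) (g t)) :
    HasWeakGradient (∫ t in a..b, f t) (∫ t in a..b, g t) := by
  rw [hasWeakGradient_iff]
  intro φ hφ v
  rw [real_inner_comm, real_inner_comm _ (∫ t in a..b, g t)]
  have hf' := hf.intervalIntegrable_of_Icc (μ := volume) hab
  have hg' := hg.intervalIntegrable_of_Icc (μ := volume) hab
  have h1 := ContinuousLinearMap.intervalIntegral_comp_comm
    (innerSL ℝ (hφ.fderiv_apply v).toL2) hf'
  have h2 := ContinuousLinearMap.intervalIntegral_comp_comm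
    (innerSL ℝ ((hφ.memLp_smul_const v).toLp : PlaneVecL2)) hg'
  simp only [innerSL_apply_apply] at h1 h2
  rw [← h1, ← h2, ← intervalIntegral.integral_add]
  · rw [intervalIntegral.integral_congr (g := fun _ => (0:ℝ))]
    · simp
    · intro t ht
      rw [Set.uIcc_of_le hab] at ht
      have := (hasWeakGradient_iff _ _).1 (h t ht) φ hφ v
      simp only
      rw [real_inner_comm, real_inner_comm (g t)]
      exact this
  · exact (ContinuousOn.inner continuousOn_const hf).intervalIntegrable_of_Icc hab
  · exact (ContinuousOn.inner continuousOn_const hg).intervalIntegrable_of_Icc hab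

theorem isBoundedField_toSpanSingleton {Z : Plane → Plane} (hZ : Continuous Z) {C : ℝ}
    (hC : ∀ x, ‖Z x‖ ≤ C) :
    IsBoundedField (fun x => ContinuousLinearMap.toSpanSingleton ℝ (Z x)) := by
  refine ⟨Continuous.aestronglyMeasurable ?_, C, fun x => ?_⟩
  · exact (ContinuousLinearMap.toSpanSingletonCLE (𝕜 := ℝ) (E := Plane)).continuous.comp hZ
  · rw [ContinuousLinearMap.norm_toSpanSingleton]; exact hC x

/-- Product rule for the product of a Sobolev function with a bounded smooth function with bounded
derivatives. -/
theorem HasWeakGradient.smooth_mul {f : PlaneL2} {g : PlaneVecL2} (h : HasWeakGradient f g)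
    {ζ : Plane → ℝ} (hζ : ContDiff ℝ ∞ ζ) (hb : IsBoundedMeas ζ)
    (hd : IsBoundedField (fun x => ContinuousLinearMap.toSpanSingleton ℝ (gradient ζ x))) :
    HasWeakGradient (scalarMul ℝ ζ hb f) (scalarMul Plane ζ hb g + mulOp _ hd f) := by
  intro φ hφ v
  have key := h _ (hφ.smooth_mul hζ) v
  have hfd : ∀ x, fderiv ℝ (fun x => ζ x * φ x) x v = ζ x * fderiv ℝ φ x v + φ x * fderiv ℝ ζ x v := by
    intro x
    have h1 : DifferentiableAt ℝ ζ x := hζ.differentiable (by simp) x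
    have h2 : DifferentiableAt ℝ φ x := hφ.1.differentiable (by simp) x
    rw [fderiv_fun_mul h1 h2]; simp
  simp_rw [hfd] at key
  have i1 : Integrable (fun x => f x * (ζ x * fderiv ℝ φ x v)) := by
    have := (Lp.memLp f).integrable_mul ((hφ.fderiv_apply v).smooth_mul hζ).memLp
    exact this
  have i2 : Integrable (fun x => f x * (φ x * fderiv ℝ ζ x v)) := by
    have ht : IsTestFunction (fun x => fderiv ℝ ζ x v * φ x) :=
      hφ.smooth_mul ((hζ.fderiv_right (m := ∞) (by norm_cast)).clm_apply contDiff_const)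
    have := (Lp.memLp f).integrable_mul ht.memLp
    refine this.congr (Eventually.of_forall fun x => ?_)
    simp only [Pi.mul_apply]; ring
  have i3 : Integrable (fun x => inner ℝ (g x) v * (ζ x * φ x)) := by
    have := (L2.integrable_inner (𝕜 := ℝ) g ((hφ.smooth_mul hζ).memLp_smul_const v).toLp)
    refine this.congr ?_
    filter_upwards [((hφ.smooth_mul hζ).memLp_smul_const v).coeFn_toLp] with x hx
    rw [hx, inner_smul_right, mul_comm]
  have e1 : ∫ x, scalarMul ℝ ζ hb f x * fderiv ℝ φ x v = ∫ x, f x * (ζ x * fderiv ℝ φ x v) := by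
    refine integral_congr_ae ?_
    filter_upwards [coeFn_scalarMul ζ hb f] with x hx
    rw [hx, smul_eq_mul]; ring
  have e2 : ∫ x, inner ℝ ((scalarMul Plane ζ hb g + mulOp _ hd f : PlaneVecL2) x) v * φ x =
      ∫ x, (inner ℝ (g x) v * (ζ x * φ x) + f x * (φ x * fderiv ℝ ζ x v)) := by
    refine integral_congr_ae ?_
    filter_upwards [coeFn_scalarMul ζ hb g, coeFn_mulOp _ hd f,
      Lp.coeFn_add (scalarMul Plane ζ hb g) (mulOp _ hd f)] with x h1 h2 h3
    rw [h3, Pi.add_apply, h1, h2, inner_add_left, inner_smul_left,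
      ContinuousLinearMap.toSpanSingleton_apply, inner_smul_left, inner_gradient]
    simp only [conj_trivial]; ring
  rw [e1, e2, integral_add i3 i2]
  have : ∫ x, f x * (ζ x * fderiv ℝ φ x v + φ x * fderiv ℝ ζ x v) =
    (∫ x, f x * (ζ x * fderiv ℝ φ x v)) + ∫ x, f x * (φ x * fderiv ℝ ζ x v) := by
    rw [← integral_add i1 i2]; simp_rw [mul_add]
  linarith

/-- The weak gradient vanishes where the function vanishes. -/
theorem HasWeakGradient.ae_eq_zero {f : PlaneL2} {g : PlaneVecL2} (h : HasWeakGradient f g)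
    {U : Set Plane} (hU : IsOpen U) (hf : ∀ᵐ x, x ∈ U → f x = 0) : ∀ᵐ x, x ∈ U → g x = 0 := by
  have hloc : LocallyIntegrable (g : Plane → Plane) volume :=
    (Lp.memLp g).locallyIntegrable (by norm_num)
  refine hU.ae_eq_zero_of_integral_contDiff_smul_eq_zero (hloc.locallyIntegrableOn U) ?_
  intro φ hφ hφc hφU
  have ht : IsTestFunction φ := ⟨hφ, hφc⟩
  have hint : Integrable (fun x => φ x • g x) :=
    hloc.integrable_smul_left_of_hasCompactSupport hφ.continuous hφc
  refine ext_inner_left ℝ fun v => ?_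
  rw [inner_zero_right, ← integral_inner hint v]
  have h0 : ∫ x, f x * fderiv ℝ φ x v = 0 := by
    rw [← integral_zero Plane ℝ (μ := volume)]
    refine integral_congr_ae ?_
    filter_upwards [hf] with x hx
    by_cases hxU : x ∈ U
    · rw [hx hxU, zero_mul]
    · have : fderiv ℝ φ x = 0 := by
        by_contra hne
        exact hxU (hφU (support_fderiv_subset ℝ hne))
      rw [this]; simp
  have := h φ ht v
  rw [h0] at this
  have e : ∀ x, inner ℝ v (φ x • g x) = inner ℝ (g x) v * φ x := fun x => by
    rw [inner_smul_right, real_inner_comm, mul_comm]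
  simp_rw [e]
  linarith

/-! ### Mollification and density of test functions in the Sobolev space. -/

section Mollification

variable {E : Type*} [NormedAddCommGroup E] [InnerProductSpace ℝ E]

/-- Translation of square integrable functions. -/
noncomputable def translateL2 (y : Plane) (f : Lp E 2 (volume : Measure Plane)) :
    Lp E 2 (volume : Measure Plane) :=
  Lp.compMeasurePreserving (fun x => x - y) (measurePreserving_sub_right volume y) f

theorem coeFn_translateL2 (y : Plane) (f : Lp E 2 (volume : Measure Plane)) :
    translateL2 y f =ᵐ[volume] fun x => f (x - y) :=
  Lp.coeFn_compMeasurePreserving f (measurePreserving_sub_right volume y)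

theorem tendsto_translateL2 (f : Lp E 2 (volume : Measure Plane)) :
    Tendsto (fun y => translateL2 y f) (𝓝 0) (𝓝 f) := by
  let G : C(Plane, C(Plane, Plane)) :=
    (ContinuousMap.mk (fun p : Plane × Plane => p.2 - p.1) (by fun_prop)).curry
  have h := (tendsto_const_nhds (x := f) (f := 𝓝 (0 : Plane))).compMeasurePreservingLp
    (G.continuous.tendsto 0) (fun y => measurePreserving_sub_right volume y)
    (measurePreserving_sub_right volume 0) (by norm_num)
  have h0 : translateL2 0 f = f := by
    refine Lp.ext ?_
    filter_upwards [coeFn_translateL2 0 f] with x hx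
    rw [hx, sub_zero]
  have h' : Tendsto (fun y => translateL2 y f) (𝓝 0) (𝓝 (translateL2 0 f)) := h
  rwa [h0] at h'

variable [CompleteSpace E]

/-- Justifies Fubini in the pairing of a function with a mollification. The inner integral is
bounded uniformly in the shift by `|⟨a, b⟩| ≤ |a|² + |b|²` and translation invariance. -/
theorem integrable_prod_convolution_inner (ρ : Plane → ℝ) (hρ : Integrable ρ)
    (a f : Lp E 2 (volume : Measure Plane)) :
    Integrable (fun p : Plane × Plane => ρ p.2 * inner ℝ (a p.1) (f (p.1 - p.2)))
      (volume.prod volume) := by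
  have hfm : AEStronglyMeasurable (fun p : Plane × Plane => f (p.1 - p.2)) (volume.prod volume) :=
    (Lp.aestronglyMeasurable f).comp_quasiMeasurePreserving
      (quasiMeasurePreserving_sub_of_right_invariant volume volume)
  have ham : AEStronglyMeasurable (fun p : Plane × Plane => a p.1) (volume.prod volume) :=
    (Lp.aestronglyMeasurable a).comp_fst
  have hm : AEStronglyMeasurable
      (fun p : Plane × Plane => ρ p.2 * inner ℝ (a p.1) (f (p.1 - p.2))) (volume.prod volume) :=
    hρ.1.comp_snd.mul (ham.inner hfm)
  have hfi : ∀ y : Plane, Integrable (fun x => ‖f (x - y)‖ ^ 2) := fun y =>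
    (integrable_norm_sq f).comp_sub_right y
  have hint : ∀ y : Plane, Integrable (fun x => inner ℝ (a x) (f (x - y))) := fun y => by
    refine (L2.integrable_inner (𝕜 := ℝ) a (translateL2 y f)).congr ?_
    filter_upwards [coeFn_translateL2 y f] with x hx
    rw [hx]
  rw [integrable_prod_iff' hm]
  refine ⟨Eventually.of_forall fun y => (hint y).const_mul (ρ y), ?_⟩
  refine Integrable.mono' (hρ.norm.mul_const ((∫ x, ‖a x‖ ^ 2) + ∫ x, ‖f x‖ ^ 2))
    hm.norm.prod_swap.integral_prod_right' (Eventually.of_forall fun y => ?_)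
  rw [Real.norm_of_nonneg (integral_nonneg fun _ => norm_nonneg _)]
  simp only [norm_mul]
  rw [integral_const_mul]
  refine mul_le_mul_of_nonneg_left ?_ (norm_nonneg _)
  calc ∫ x, ‖(inner ℝ (a x) (f (x - y)) : ℝ)‖ ≤ ∫ x, (‖a x‖ ^ 2 + ‖f (x - y)‖ ^ 2) := by
        refine integral_mono (hint y).norm ((integrable_norm_sq a).add (hfi y)) fun x => ?_
        have := norm_inner_le_norm (𝕜 := ℝ) (a x) (f (x - y))
        nlinarith [sq_nonneg (‖a x‖ - ‖f (x - y)‖), norm_nonneg (a x), norm_nonneg (f (x - y))]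
    _ = _ := by
        rw [integral_add (integrable_norm_sq a) (hfi y)]
        rw [integral_sub_right_eq_self (fun x => ‖f x‖ ^ 2) y]

/-- Fubini turns the pairing with a mollification into a `ρ`-average of pairings with translates, so
that mollification can be estimated by duality. -/
theorem integral_inner_convolution (ρ : Plane → ℝ) (hρ : Continuous ρ) (hρc : HasCompactSupport ρ)
    (a f : Lp E 2 (volume : Measure Plane)) :
    ∫ x, inner ℝ (a x) ((ρ ⋆[ContinuousLinearMap.lsmul ℝ ℝ, volume] (f : Plane → E)) x) =
      ∫ y, ρ y * inner ℝ a (translateL2 y f) := by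
  have hloc : LocallyIntegrable (f : Plane → E) volume :=
    (Lp.memLp f).locallyIntegrable (by norm_num)
  have hex := hρc.convolutionExists_left (ContinuousLinearMap.lsmul ℝ ℝ) hρ hloc (μ := volume)
  have hρi : Integrable ρ := hρ.integrable_of_hasCompactSupport hρc
  calc _ = ∫ x, ∫ y, ρ y * inner ℝ (a x) (f (x - y)) := by
        refine integral_congr_ae (Eventually.of_forall fun x => ?_)
        simp only [convolution]
        rw [← integral_inner (hex x)]
        simp [inner_smul_right]
    _ = ∫ y, ∫ x, ρ y * inner ℝ (a x) (f (x - y)) :=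
        integral_integral_swap (integrable_prod_convolution_inner ρ hρi a f)
    _ = _ := by
        refine integral_congr_ae (Eventually.of_forall fun y => ?_)
        simp only
        rw [integral_const_mul, L2.inner_def]
        congr 1
        refine integral_congr_ae ?_
        filter_upwards [coeFn_translateL2 y f] with x hx
        rw [hx]

/-- With `a = m - f` and a kernel of integral one, `‖a‖²` is the average of `⟨a, translateL2 y f -
f⟩` over the support of the kernel, hence at most `‖a‖ δ`. -/
theorem norm_convolution_sub_le (ρ : ContDiffBump (0 : Plane))
    (f m : Lp E 2 (volume : Measure Plane))
    (hm : m =ᵐ[volume] ρ.normed volume ⋆[ContinuousLinearMap.lsmul ℝ ℝ, volume] (f : Plane → E))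
    {δ : ℝ} (hδ : ∀ y ∈ Metric.ball (0 : Plane) ρ.rOut, ‖translateL2 y f - f‖ ≤ δ) :
    ‖m - f‖ ≤ δ := by
  have hδ0 : 0 ≤ δ := (norm_nonneg _).trans (hδ 0 (Metric.mem_ball_self ρ.rOut_pos))
  set a := m - f with ha
  have h1 : inner ℝ a m = ∫ y, ρ.normed volume y * inner ℝ a (translateL2 y f) := by
    rw [← integral_inner_convolution _ ρ.continuous_normed ρ.hasCompactSupport_normed, L2.inner_def]
    refine integral_congr_ae ?_
    filter_upwards [hm] with x hx
    rw [hx]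
  have hρi : Integrable (ρ.normed volume) := ρ.integrable_normed
  have hi : Integrable (fun y => ρ.normed volume y * inner ℝ a (translateL2 y f)) := by
    have := (integrable_prod_convolution_inner _ hρi a f).swap.integral_prod_left
    refine this.congr (Eventually.of_forall fun y => ?_)
    simp only [Function.comp, Prod.swap]
    rw [integral_const_mul, L2.inner_def]
    congr 1
    refine integral_congr_ae ?_
    filter_upwards [coeFn_translateL2 y f] with x hx
    rw [hx]
  have h2 : inner ℝ a f = ∫ y, ρ.normed volume y * inner ℝ a f := by
    rw [integral_mul_const, ρ.integral_normed, one_mul]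
  have h3 : ‖a‖ ^ 2 ≤ ‖a‖ * δ := by
    have h0 : inner ℝ a a = inner ℝ a m - inner ℝ a f := by rw [← inner_sub_right]
    rw [← real_inner_self_eq_norm_sq, h0, h1, h2, ← integral_sub hi (hρi.mul_const _)]
    calc _ ≤ ∫ y, ρ.normed volume y * (‖a‖ * δ) := by
          refine integral_mono (hi.sub (hρi.mul_const _)) (hρi.mul_const _) fun y => ?_
          simp only
          rw [← mul_sub, ← inner_sub_right]
          by_cases hy : y ∈ Metric.ball (0 : Plane) ρ.rOut
          · refine mul_le_mul_of_nonneg_left ?_ (ρ.nonneg_normed y)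
            exact (real_inner_le_norm _ _).trans (by gcongr; exact hδ y hy)
          · have : ρ.normed volume y = 0 := by
              rw [← ρ.support_normed_eq (μ := volume)] at hy
              exact Function.notMem_support.1 hy
            simp [this]
      _ = ‖a‖ * δ := by rw [integral_mul_const, ρ.integral_normed, one_mul]
  by_contra! hlt
  have : 0 < ‖a‖ := hδ0.trans_lt hlt
  nlinarith

end Mollification

/-- The derivative falls on `ρ`, and `y ↦ ρ (x - y)` is an admissible test function. The sign from
the reflection cancels the sign in the definition of the weak gradient. -/
theorem gradient_convolution (ρ : Plane → ℝ) (hρ : IsTestFunction ρ) {f : PlaneL2} {g : PlaneVecL2}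
    (h : HasWeakGradient f g) (x : Plane) :
    gradient (ρ ⋆[ContinuousLinearMap.lsmul ℝ ℝ, volume] (f : Plane → ℝ)) x =
      (ρ ⋆[ContinuousLinearMap.lsmul ℝ ℝ, volume] (g : Plane → Plane)) x := by
  have hloc : LocallyIntegrable (f : Plane → ℝ) volume :=
    (Lp.memLp f).locallyIntegrable (by norm_num)
  have hlocg : LocallyIntegrable (g : Plane → Plane) volume :=
    (Lp.memLp g).locallyIntegrable (by norm_num)
  refine ext_inner_right ℝ fun v => ?_
  rw [inner_gradient]
  have hρ1 : ContDiff ℝ 1 ρ := hρ.1.of_le (by norm_cast)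
  have hd := hρ.2.hasFDerivAt_convolution_left (ContinuousLinearMap.lsmul ℝ ℝ) hρ1 hloc x
  rw [hd.fderiv]
  have hex := (HasCompactSupport.fderiv (𝕜 := ℝ) hρ.2).convolutionExists_left
    ((ContinuousLinearMap.lsmul ℝ ℝ).precompL Plane) (hρ1.continuous_fderiv one_ne_zero) hloc
    (μ := volume) x
  have e1 : (((fderiv ℝ ρ) ⋆[(ContinuousLinearMap.lsmul ℝ ℝ).precompL Plane, volume]
      (f : Plane → ℝ)) x) v = ∫ y, f y * fderiv ℝ ρ (x - y) v := by
    rw [convolution, ContinuousLinearMap.integral_apply hex, ← integral_sub_left_eq_self _ volume x]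
    simp [ContinuousLinearMap.precompL_apply, mul_comm]
  have hexg := hρ.2.convolutionExists_left (ContinuousLinearMap.lsmul ℝ ℝ) hρ.1.continuous hlocg
    (μ := volume) x
  have e2 : inner ℝ ((ρ ⋆[ContinuousLinearMap.lsmul ℝ ℝ, volume] (g : Plane → Plane)) x) v =
      ∫ y, inner ℝ (g y) v * ρ (x - y) := by
    rw [real_inner_comm, convolution, ← integral_inner hexg,
      ← integral_sub_left_eq_self _ volume x]
    refine integral_congr_ae (Eventually.of_forall fun y => ?_)
    simp only [ContinuousLinearMap.lsmul_apply, sub_sub_cancel]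
    rw [inner_smul_right, real_inner_comm, mul_comm]
  have ht : IsTestFunction (fun y => ρ (x - y)) := by
    refine ⟨hρ.1.comp (contDiff_const.sub contDiff_id), ?_⟩
    exact hρ.2.comp_homeomorph (Homeomorph.subLeft x)
  have hfd : ∀ y, fderiv ℝ (fun y => ρ (x - y)) y v = - fderiv ℝ ρ (x - y) v := by
    intro y
    have h1 : HasFDerivAt ρ (fderiv ℝ ρ (x - y)) (x - y) :=
      (hρ.1.differentiable (by simp) _).hasFDerivAt
    have h2 : HasFDerivAt (fun y : Plane => x - y) (-(ContinuousLinearMap.id ℝ Plane)) y :=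
      (hasFDerivAt_id y).const_sub x
    have h3 := h1.comp y h2
    have h4 : fderiv ℝ (fun y => ρ (x - y)) y = _ := h3.fderiv
    rw [h4]; simp
  have key := h _ ht v
  simp_rw [hfd, mul_neg, integral_neg] at key
  rw [e1, e2]
  linarith

/-- A compactly supported Sobolev function is a limit of test functions. -/
theorem HasWeakGradient.mem_closure_of_compact {f : PlaneL2} {g : PlaneVecL2}
    (h : HasWeakGradient f g) {R : ℝ} (hf : ∀ᵐ x, R < ‖x‖ → f x = 0) :
    (f, g) ∈ closure {p : PlaneL2 × PlaneVecL2 | ∃ φ, ∃ hφ : IsTestFunction φ,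
      p = (hφ.toL2, hφ.gradL2)} := by
  rw [Metric.mem_closure_iff]
  intro ε hε
  have hev : ∀ᶠ y in 𝓝 (0 : Plane), ‖translateL2 y f - f‖ ≤ ε / 2 ∧ ‖translateL2 y g - g‖ ≤ ε / 2 := by
    have h1 := (tendsto_iff_norm_sub_tendsto_zero.1 (tendsto_translateL2 f)).eventually
      (eventually_le_nhds (half_pos hε))
    have h2 := (tendsto_iff_norm_sub_tendsto_zero.1 (tendsto_translateL2 g)).eventually
      (eventually_le_nhds (half_pos hε))
    exact h1.and h2
  obtain ⟨r, hr, hball⟩ := Metric.eventually_nhds_iff_ball.1 hev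
  let ρ : ContDiffBump (0 : Plane) := ⟨r / 2, r, half_pos hr, half_lt_self hr⟩
  have hρt : IsTestFunction (ρ.normed volume) := ⟨ρ.contDiff_normed, ρ.hasCompactSupport_normed⟩
  have hloc : LocallyIntegrable (f : Plane → ℝ) volume :=
    (Lp.memLp f).locallyIntegrable (by norm_num)
  let φ : Plane → ℝ := ρ.normed volume ⋆[ContinuousLinearMap.lsmul ℝ ℝ, volume] (f : Plane → ℝ)
  have hφ : IsTestFunction φ := by
    refine ⟨hρt.2.contDiff_convolution_left _ hρt.1 hloc, ?_⟩
    let f' : Plane → ℝ := (Metric.closedBall 0 R).indicator f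
    have hff' : (f : Plane → ℝ) =ᵐ[volume] f' := by
      filter_upwards [hf] with x hx
      by_cases hxR : x ∈ Metric.closedBall (0 : Plane) R
      · simp [f', hxR]
      · simp only [f', Set.indicator_of_notMem hxR]
        exact hx (by simpa using hxR)
    have e : φ = ρ.normed volume ⋆[ContinuousLinearMap.lsmul ℝ ℝ, volume] f' :=
      convolution_congr _ (Eventually.of_forall fun _ => rfl) hff'
    rw [e]
    refine hρt.2.convolution _ ?_
    exact HasCompactSupport.intro (isCompact_closedBall (0 : Plane) R) fun x hx =>
      Set.indicator_of_notMem hx _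
  refine ⟨_, ⟨φ, hφ, rfl⟩, ?_⟩
  have h1 : ‖hφ.toL2 - f‖ ≤ ε / 2 := norm_convolution_sub_le ρ f _ hφ.coeFn_toL2
    fun y hy => (hball y hy).1
  have h2 : ‖hφ.gradL2 - g‖ ≤ ε / 2 := by
    refine norm_convolution_sub_le ρ g _ ?_ fun y hy => (hball y hy).2
    filter_upwards [hφ.coeFn_gradL2] with x hx
    rw [hx]
    exact gradient_convolution _ hρt h x
  rw [Prod.dist_eq, dist_comm, dist_eq_norm, dist_comm g, dist_eq_norm]
  exact (max_le h1 h2).trans_lt (half_lt_self hε)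

theorem gradient_comp_smul {χ : Plane → ℝ} (hχ : Differentiable ℝ χ) (c : ℝ) (x : Plane) :
    gradient (fun x => χ (c • x)) x = c • gradient χ (c • x) := by
  refine ext_inner_right ℝ fun v => ?_
  rw [inner_gradient, inner_smul_left, inner_gradient]
  have h1 : HasFDerivAt χ (fderiv ℝ χ (c • x)) (c • x) := (hχ _).hasFDerivAt
  have h2 : HasFDerivAt (fun y : Plane => c • y) (c • ContinuousLinearMap.id ℝ Plane) x :=
    (hasFDerivAt_id x).const_smul c
  have h3 : fderiv ℝ (fun x => χ (c • x)) x = _ := (h1.comp x h2).fderiv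
  rw [h3]; simp

/-- Test functions are dense in the Sobolev space. -/
theorem HasWeakGradient.mem_closure {f : PlaneL2} {g : PlaneVecL2} (h : HasWeakGradient f g) :
    (f, g) ∈ closure {p : PlaneL2 × PlaneVecL2 | ∃ φ, ∃ hφ : IsTestFunction φ,
      p = (hφ.toL2, hφ.gradL2)} := by
  let χ : ContDiffBump (0 : Plane) := ⟨1, 2, one_pos, one_lt_two⟩
  have hχs : ContDiff ℝ ∞ χ := χ.contDiff
  have hχd : Differentiable ℝ χ := hχs.differentiable (by simp)
  have hcg : Continuous (gradient χ) := continuous_gradient (hχs.of_le (by norm_cast))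
  obtain ⟨C, hC⟩ := hcg.bounded_above_of_compact_support (χ.hasCompactSupport.gradient)
  let c : ℕ → ℝ := fun n => 1 / ((n : ℝ) + 1)
  have hc0 : ∀ n, 0 < c n := fun n => by positivity
  have hc1 : ∀ n, c n ≤ 1 := fun n => by
    simp only [c]; rw [div_le_one (by positivity)]; linarith [(Nat.cast_nonneg n : (0:ℝ) ≤ n)]
  have hclim : Tendsto c atTop (𝓝 0) := tendsto_one_div_add_atTop_nhds_zero_nat
  let ζ : ℕ → Plane → ℝ := fun n x => χ (c n • x)
  have hζ : ∀ n, ContDiff ℝ ∞ (ζ n) := fun n => hχs.comp (contDiff_const_smul _)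
  have hζ1 : ∀ n x, |ζ n x| ≤ 1 := fun n x => by
    rw [abs_of_nonneg χ.nonneg]; exact χ.le_one
  have hζb : ∀ n, IsBoundedMeas (ζ n) := fun n => (hζ n).continuous.isBoundedMeas (hζ1 n)
  have hgζ : ∀ n x, gradient (ζ n) x = c n • gradient χ (c n • x) := fun n x =>
    gradient_comp_smul hχd _ _
  have hgζC : ∀ n x, ‖gradient (ζ n) x‖ ≤ C := fun n x => by
    rw [hgζ, norm_smul, Real.norm_of_nonneg (hc0 n).le]
    exact (mul_le_of_le_one_left (norm_nonneg _) (hc1 n)).trans (hC _)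
  have hgf : ∀ n, IsBoundedField
      (fun x => ContinuousLinearMap.toSpanSingleton ℝ (gradient (ζ n) x)) := fun n =>
    isBoundedField_toSpanSingleton (continuous_gradient ((hζ n).of_le (by norm_cast))) (hgζC n)
  have hw := fun n => h.smooth_mul (hζ n) (hζb n) (hgf n)
  have hlim1 : ∀ x : Plane, Tendsto (fun n => c n • x) atTop (𝓝 0) := fun x => by
    simpa using hclim.smul_const x
  have hone : ∀ x : Plane, Tendsto (fun n => ζ n x) atTop (𝓝 1) := fun x => by
    have h1 := (χ.continuous.tendsto 0).comp (hlim1 x)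
    have h2 : χ (0 : Plane) = 1 := χ.one_of_mem_closedBall (Metric.mem_closedBall_self zero_le_one)
    rw [h2] at h1; exact h1
  have hzero : ∀ x : Plane, Tendsto (fun n => gradient (ζ n) x) atTop (𝓝 0) := fun x => by
    simp_rw [hgζ]
    have := hclim.smul ((hcg.tendsto 0).comp (hlim1 x))
    simpa using this
  have t1 : Tendsto (fun n => scalarMul ℝ (ζ n) (hζb n) f) atTop (𝓝 f) := by
    refine tendsto_Lp_of_dominated (b := fun x => ‖f x‖)
      (Eventually.of_forall fun n => coeFn_scalarMul _ _ f) (ae_eq_refl _) (Lp.memLp f).norm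
      (Eventually.of_forall fun n => Eventually.of_forall fun x => ?_)
      (Eventually.of_forall fun x => le_rfl) (Eventually.of_forall fun x => ?_)
    · rw [norm_smul]; exact mul_le_of_le_one_left (norm_nonneg _) (hζ1 n x)
    · simpa using (hone x).smul_const (f x)
  have t2 : Tendsto (fun n => scalarMul Plane (ζ n) (hζb n) g) atTop (𝓝 g) := by
    refine tendsto_Lp_of_dominated (b := fun x => ‖g x‖)
      (Eventually.of_forall fun n => coeFn_scalarMul _ _ g) (ae_eq_refl _) (Lp.memLp g).norm
      (Eventually.of_forall fun n => Eventually.of_forall fun x => ?_)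
      (Eventually.of_forall fun x => le_rfl) (Eventually.of_forall fun x => ?_)
    · rw [norm_smul]; exact mul_le_of_le_one_left (norm_nonneg _) (hζ1 n x)
    · simpa using (hone x).smul_const (g x)
  have t3 : Tendsto (fun n => mulOp _ (hgf n) f) atTop (𝓝 0) := by
    refine tendsto_Lp_of_dominated (b := fun x => C * ‖f x‖)
      (Eventually.of_forall fun n => coeFn_mulOp _ _ f) (Lp.coeFn_zero _ _ _)
      ((Lp.memLp f).norm.const_mul C)
      (Eventually.of_forall fun n => Eventually.of_forall fun x => ?_)
      (Eventually.of_forall fun x => ?_) (Eventually.of_forall fun x => ?_)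
    · rw [ContinuousLinearMap.toSpanSingleton_apply, norm_smul, mul_comm]
      gcongr; exact hgζC n x
    · have : 0 ≤ C := (norm_nonneg _).trans (hC 0)
      simp only [Pi.zero_apply, norm_zero]; positivity
    · simpa using (hzero x).const_smul (f x)
  have t4 := t1.prodMk_nhds (t2.add t3)
  rw [add_zero] at t4
  refine isClosed_closure.mem_of_tendsto t4 (Eventually.of_forall fun n => ?_)
  -- The bump has outer radius `2`, so the `n`-th cutoff vanishes once `c n * ‖x‖ ≥ 2`.
  refine (hw n).mem_closure_of_compact (R := 2 / c n) ?_
  filter_upwards [coeFn_scalarMul (ζ n) (hζb n) f] with x hx hxR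
  rw [hx]
  have : ζ n x = 0 := by
    refine χ.zero_of_le_dist ?_
    rw [dist_zero_right, norm_smul, Real.norm_of_nonneg (hc0 n).le]
    rw [div_lt_iff₀ (hc0 n)] at hxR
    change 2 ≤ _
    linarith
  rw [this, zero_smul]

/-! ### The unitary dilation group and its generator `f + x · ∇f`. -/

section Dilation

variable {E : Type*} [NormedAddCommGroup E] [InnerProductSpace ℝ E]

theorem quasiMeasurePreserving_const_smul {c : ℝ} (hc : c ≠ 0) :
    Measure.QuasiMeasurePreserving (fun x : Plane => c • x) volume volume := by
  refine ⟨measurable_const_smul c, ?_⟩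
  rw [Measure.map_addHaar_smul _ hc]
  exact Measure.smul_absolutelyContinuous

theorem memLp_comp_const_smul {f : Plane → E} (hf : MemLp f 2 (volume : Measure Plane)) {c : ℝ}
    (hc : c ≠ 0) : MemLp (fun x => f (c • x)) 2 (volume : Measure Plane) := by
  have h1 : MemLp f 2 (Measure.map (fun x : Plane => c • x) volume) := by
    rw [Measure.map_addHaar_smul _ hc]
    exact hf.smul_measure ENNReal.ofReal_ne_top
  exact h1.comp_of_map (measurable_const_smul c).aemeasurable

/-- The Jacobian of `x ↦ e^τ x` in the plane is `e^(2τ)`, which is why the single factor `e^τ` makes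
dilations unitary on `L²`. -/
theorem integral_comp_exp_smul {G : Type*} [NormedAddCommGroup G] [NormedSpace ℝ G]
    (F : Plane → G) (τ : ℝ) :
    ∫ x, Real.exp (2 * τ) • F (Real.exp τ • x) = ∫ x, F x := by
  have : Module.finrank ℝ Plane = 2 := finrank_euclideanSpace_fin
  rw [integral_smul, Measure.integral_comp_smul, this, smul_smul, ← Real.exp_nat_mul,
    abs_of_pos (by positivity)]
  push_cast
  rw [mul_inv_cancel₀ (Real.exp_ne_zero _), one_smul]

theorem memLp_dilation (τ : ℝ) {f : Plane → E} (hf : MemLp f 2 (volume : Measure Plane)) :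
    MemLp (fun x => Real.exp τ • f (Real.exp τ • x)) 2 (volume : Measure Plane) :=
  (memLp_comp_const_smul hf (Real.exp_ne_zero τ)).const_smul (Real.exp τ)

theorem norm_dilation_aux (τ : ℝ) (f : Lp E 2 (volume : Measure Plane)) :
    ‖(memLp_dilation τ (Lp.memLp f)).toLp‖ = ‖f‖ := by
  rw [← sq_eq_sq₀ (norm_nonneg _) (norm_nonneg _), norm_sq_eq_integral, norm_sq_eq_integral,
    ← integral_comp_exp_smul (fun x => ‖f x‖ ^ 2) τ]
  refine integral_congr_ae ?_
  filter_upwards [(memLp_dilation τ (Lp.memLp f)).coeFn_toLp] with x hx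
  rw [hx, norm_smul, mul_pow, Real.norm_of_nonneg (Real.exp_pos _).le, ← Real.exp_nat_mul]
  push_cast; rfl

theorem ae_comp_exp_smul (τ : ℝ) {p : Plane → Prop} (h : ∀ᵐ x, p x) :
    ∀ᵐ x, p (Real.exp τ • x) :=
  (quasiMeasurePreserving_const_smul (Real.exp_ne_zero τ)).ae h

/-- The unitary dilation `f ↦ e^τ f(e^τ ·)` as a linear map. -/
noncomputable def dilationLinear (τ : ℝ) :
    Lp E 2 (volume : Measure Plane) →ₗ[ℝ] Lp E 2 (volume : Measure Plane) where
  toFun := fun f => (memLp_dilation τ (Lp.memLp f)).toLp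
  map_add' := fun f g => by
    refine Lp.ext ?_
    filter_upwards [ae_comp_exp_smul τ (Lp.coeFn_add f g),
      (memLp_dilation τ (Lp.memLp (f + g))).coeFn_toLp,
      (memLp_dilation τ (Lp.memLp f)).coeFn_toLp, (memLp_dilation τ (Lp.memLp g)).coeFn_toLp,
      Lp.coeFn_add (memLp_dilation τ (Lp.memLp f)).toLp (memLp_dilation τ (Lp.memLp g)).toLp]
      with x h1 h2 h3 h4 h5
    rw [h5, Pi.add_apply, h2, h3, h4, h1, Pi.add_apply, smul_add]
  map_smul' := fun c f => by
    refine Lp.ext ?_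
    filter_upwards [ae_comp_exp_smul τ (Lp.coeFn_smul c f),
      (memLp_dilation τ (Lp.memLp (c • f))).coeFn_toLp,
      (memLp_dilation τ (Lp.memLp f)).coeFn_toLp,
      Lp.coeFn_smul c (memLp_dilation τ (Lp.memLp f)).toLp] with x h1 h2 h3 h4
    rw [RingHom.id_apply, h4, Pi.smul_apply, h2, h3, h1, Pi.smul_apply, smul_comm]

/-- The unitary dilation `f ↦ e^τ f(e^τ ·)` of square integrable functions on the plane. -/
noncomputable def dilation (τ : ℝ) :
    Lp E 2 (volume : Measure Plane) →L[ℝ] Lp E 2 (volume : Measure Plane) :=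
  (dilationLinear τ).mkContinuous 1 fun f => by
    rw [one_mul]; exact (norm_dilation_aux τ f).le

theorem coeFn_dilation (τ : ℝ) (f : Lp E 2 (volume : Measure Plane)) :
    dilation τ f =ᵐ[volume] fun x => Real.exp τ • f (Real.exp τ • x) :=
  (memLp_dilation τ (Lp.memLp f)).coeFn_toLp

theorem norm_dilation (τ : ℝ) (f : Lp E 2 (volume : Measure Plane)) : ‖dilation τ f‖ = ‖f‖ :=
  norm_dilation_aux τ f

theorem coeFn_dilation_of_ae_eq (τ : ℝ) {f : Lp E 2 (volume : Measure Plane)} {g : Plane → E}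
    (h : f =ᵐ[volume] g) : dilation τ f =ᵐ[volume] fun x => Real.exp τ • g (Real.exp τ • x) := by
  filter_upwards [coeFn_dilation τ f,
    ae_comp_exp_smul τ h] with x hx hx'
  rw [hx, hx']

theorem dilation_zero (f : Lp E 2 (volume : Measure Plane)) : dilation 0 f = f := by
  refine Lp.ext ?_
  filter_upwards [coeFn_dilation 0 f] with x hx
  rw [hx]; simp

theorem inner_dilation_left (τ : ℝ) (f g : Lp E 2 (volume : Measure Plane)) :
    inner ℝ (dilation τ f) g = inner ℝ f (dilation (-τ) g) := by
  rw [L2.inner_def, L2.inner_def,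
    ← integral_comp_exp_smul (fun x => inner ℝ (f x) (dilation (-τ) g x) : Plane → ℝ) τ]
  refine integral_congr_ae ?_
  filter_upwards [coeFn_dilation τ f,
    ae_comp_exp_smul τ (coeFn_dilation (-τ) g)]
    with x hx hx'
  rw [hx, hx', smul_smul, ← Real.exp_add, neg_add_cancel, Real.exp_zero, one_smul,
    inner_smul_left, inner_smul_right, smul_eq_mul, ← mul_assoc, ← Real.exp_add]
  simp only [conj_trivial]
  congr 2; ring

theorem inner_dilation_right (τ : ℝ) (f g : Lp E 2 (volume : Measure Plane)) :
    inner ℝ f (dilation τ g) = inner ℝ (dilation (-τ) f) g := by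
  rw [inner_dilation_left, neg_neg]

/-- A dominating function that serves all `τ` within distance one of `τ₀` at once: the largest
amplitude on the largest support. -/
theorem norm_dilated_le {ψ : Plane → E} {C R : ℝ} (hC : ∀ x, ‖ψ x‖ ≤ C)
    (hR : ∀ x, R < ‖x‖ → ψ x = 0) {τ₀ τ : ℝ} (hτ : |τ - τ₀| < 1) (x : Plane) :
    ‖Real.exp τ • ψ (Real.exp τ • x)‖ ≤
      (Metric.closedBall (0 : Plane) (Real.exp (1 - τ₀) * R)).indicator
        (fun _ => Real.exp (τ₀ + 1) * C) x := by
  obtain ⟨h1, h2⟩ := abs_lt.1 hτ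
  have hC0 : 0 ≤ C := (norm_nonneg _).trans (hC 0)
  by_cases hx : x ∈ Metric.closedBall (0 : Plane) (Real.exp (1 - τ₀) * R)
  · rw [Set.indicator_of_mem hx, norm_smul, Real.norm_of_nonneg (Real.exp_pos _).le]
    gcongr
    · linarith
    · exact hC _
  · rw [Set.indicator_of_notMem hx]
    have hx' : Real.exp (1 - τ₀) * R < ‖x‖ := by simpa using hx
    have : R < ‖Real.exp τ • x‖ := by
      rw [norm_smul, Real.norm_of_nonneg (Real.exp_pos _).le]
      have h3 : R < Real.exp (-(1 - τ₀)) * ‖x‖ := by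
        rw [Real.exp_neg, ← div_eq_inv_mul, lt_div_iff₀ (Real.exp_pos _), mul_comm]
        exact hx'
      refine h3.trans_le ?_
      gcongr; linarith
    rw [hR _ this, smul_zero, norm_zero]

theorem exists_bound_of_compact {ψ : Plane → E} (hψ : Continuous ψ) (hc : HasCompactSupport ψ) :
    ∃ C R : ℝ, (∀ x, ‖ψ x‖ ≤ C) ∧ ∀ x, R < ‖x‖ → ψ x = 0 := by
  obtain ⟨C, hC⟩ := hψ.bounded_above_of_compact_support hc
  obtain ⟨R, hR⟩ := hc.isCompact.isBounded.subset_closedBall 0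
  refine ⟨C, R, hC, fun x hx => ?_⟩
  by_contra hne
  have := hR (subset_tsupport _ hne)
  rw [mem_closedBall_zero_iff] at this
  linarith

theorem memLp_indicator_closedBall (R c : ℝ) :
    MemLp ((Metric.closedBall (0 : Plane) R).indicator (fun _ => c)) 2 volume :=
  memLp_indicator_const 2 measurableSet_closedBall c (Or.inr measure_closedBall_lt_top.ne)

/-- Dilations are isometries, hence equicontinuous, so strong continuity need only be checked on the
dense set of smooth compactly supported functions, where dominated convergence applies. -/
theorem continuous_dilation (f : Lp E 2 (volume : Measure Plane)) :
    Continuous (fun τ => dilation τ f) := by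
  have h := continuous_prod_of_dense_continuous_lipschitzWith
    (fun p : Lp E 2 (volume : Measure Plane) × ℝ => dilation p.2 p.1) 1
    (Lp.dense_hasCompactSupport_contDiff (F := E) (μ := (volume : Measure Plane))
      (p := 2) (by norm_num)) ?_ ?_
  · exact h.comp (by fun_prop : Continuous fun τ : ℝ => (f, τ))
  · rintro f ⟨ψ, hfψ, hψc, hψs⟩
    obtain ⟨C, R, hC, hR⟩ := exists_bound_of_compact hψs.continuous hψc
    rw [continuous_iff_continuousAt]
    intro τ₀
    have hev : ∀ᶠ τ in 𝓝 τ₀, |τ - τ₀| < 1 := by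
      have := Metric.ball_mem_nhds τ₀ one_pos
      filter_upwards [this] with τ hτ
      rwa [Metric.mem_ball, Real.dist_eq] at hτ
    refine tendsto_Lp_of_dominated
      (Eventually.of_forall fun τ => coeFn_dilation_of_ae_eq τ hfψ)
      (coeFn_dilation_of_ae_eq τ₀ hfψ) (memLp_indicator_closedBall (Real.exp (1 - τ₀) * R)
        (Real.exp (τ₀ + 1) * C)) ?_ ?_ ?_
    · filter_upwards [hev] with τ hτ
      exact Eventually.of_forall fun x => norm_dilated_le hC hR hτ x
    · exact Eventually.of_forall fun x => norm_dilated_le hC hR (by simp) x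
    · refine Eventually.of_forall fun x => ?_
      have : Continuous fun τ : ℝ => Real.exp τ • ψ (Real.exp τ • x) := by
        have := hψs.continuous
        fun_prop
      exact this.tendsto τ₀
  · intro τ
    refine LipschitzWith.of_dist_le_mul fun f g => ?_
    simp only [NNReal.coe_one, one_mul, dist_eq_norm, ← map_sub, norm_dilation, le_refl]

end Dilation

theorem IsTestFunction.dilated {φ : Plane → ℝ} (hφ : IsTestFunction φ) (τ : ℝ) :
    IsTestFunction (fun x => Real.exp τ * φ (Real.exp τ • x)) := by
  refine ⟨contDiff_const.mul (hφ.1.comp (contDiff_const_smul _)), ?_⟩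
  have := hφ.2.comp_homeomorph (Homeomorph.smulOfNeZero (Real.exp τ) (Real.exp_ne_zero τ))
  exact HasCompactSupport.mul_left (f := fun _ => Real.exp τ) this

theorem fderiv_dilated {φ : Plane → ℝ} (hφ : IsTestFunction φ) (τ : ℝ) (x v : Plane) :
    fderiv ℝ (fun x => Real.exp τ * φ (Real.exp τ • x)) x v =
      Real.exp τ * (Real.exp τ * fderiv ℝ φ (Real.exp τ • x) v) := by
  have h1 : HasFDerivAt φ (fderiv ℝ φ (Real.exp τ • x)) (Real.exp τ • x) :=
    (hφ.1.differentiable (by simp) _).hasFDerivAt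
  have h2 : HasFDerivAt (fun y : Plane => Real.exp τ • y)
    (Real.exp τ • ContinuousLinearMap.id ℝ Plane) x := (hasFDerivAt_id x).const_smul (Real.exp τ)
  have h3 : fderiv ℝ (fun x => Real.exp τ * φ (Real.exp τ • x)) x = _ :=
    (HasFDerivAt.const_mul (h1.comp x h2) (Real.exp τ)).fderiv
  rw [h3]; simp

/-- The chain rule produces the extra factor `e^τ`; it is obtained by moving the dilation onto the
test function. This factor makes the commutator in `inner_commutator` nonzero even for constant `K`.
-/
theorem HasWeakGradient.dilate {f : PlaneL2} {g : PlaneVecL2} (h : HasWeakGradient f g) (τ : ℝ) :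
    HasWeakGradient (dilation τ f) (Real.exp τ • dilation τ g) := by
  rw [hasWeakGradient_iff] at h ⊢
  intro φ hφ v
  have key := h _ (hφ.dilated (-τ)) v
  rw [inner_smul_left, inner_dilation_left, inner_dilation_left]
  have e1 : dilation (-τ) (hφ.fderiv_apply v).toL2 =
      Real.exp τ • ((hφ.dilated (-τ)).fderiv_apply v).toL2 := by
    refine Lp.ext ?_
    filter_upwards [coeFn_dilation_of_ae_eq (-τ) (hφ.fderiv_apply v).coeFn_toL2,
      ((hφ.dilated (-τ)).fderiv_apply v).coeFn_toL2,
      Lp.coeFn_smul (Real.exp τ) ((hφ.dilated (-τ)).fderiv_apply v).toL2] with x h1 h2 h3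
    rw [h1, h3, Pi.smul_apply, h2, fderiv_dilated hφ, smul_eq_mul, smul_eq_mul, ← mul_assoc,
      ← Real.exp_add, add_neg_cancel, Real.exp_zero, one_mul]
  have e2 : dilation (-τ) (hφ.memLp_smul_const v).toLp =
      ((hφ.dilated (-τ)).memLp_smul_const v).toLp := by
    refine Lp.ext ?_
    filter_upwards [coeFn_dilation_of_ae_eq (-τ) (hφ.memLp_smul_const v).coeFn_toLp,
      ((hφ.dilated (-τ)).memLp_smul_const v).coeFn_toLp] with x h1 h2
    rw [h1, h2, smul_smul]
  rw [e1, e2, inner_smul_right]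
  simp only [conj_trivial]
  rw [← mul_add, key, mul_zero]

theorem IsTestFunction.coord_mul {φ : Plane → ℝ} (hφ : IsTestFunction φ) (v : Plane) :
    IsTestFunction (fun x => inner ℝ x v * φ x) :=
  hφ.smooth_mul (contDiff_id.inner ℝ contDiff_const)

/-- The weak form of the identity `div (x f) = 2 f + x · ∇ f`. -/
theorem HasWeakGradient.integral_euler {f : PlaneL2} {g : PlaneVecL2} (h : HasWeakGradient f g)
    {φ : Plane → ℝ} (hφ : IsTestFunction φ) :
    ∫ x, f x * (2 * φ x + fderiv ℝ φ x x) = - ∫ x, inner ℝ (g x) x * φ x := by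
  let e := EuclideanSpace.basisFun (Fin 2) ℝ
  have hi1 : ∀ i : Fin 2, Integrable (fun x => f x * fderiv ℝ (fun x => inner ℝ x (e i) * φ x) x (e i)) :=
    fun i => (Lp.memLp f).integrable_mul ((hφ.coord_mul (e i)).fderiv_apply (e i)).memLp
  have hi2 : ∀ i : Fin 2, Integrable (fun x => inner ℝ (g x) (e i) * (inner ℝ x (e i) * φ x)) := by
    intro i
    have := L2.integrable_inner (𝕜 := ℝ) g ((hφ.coord_mul (e i)).memLp_smul_const (e i)).toLp
    refine this.congr ?_
    filter_upwards [((hφ.coord_mul (e i)).memLp_smul_const (e i)).coeFn_toLp] with x hx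
    rw [hx, inner_smul_right, mul_comm]
  -- Test with `x_i φ` in the direction `e_i` and sum: the derivatives `∂_i (x_i φ)` add up to `2 φ
  -- + x · ∇φ`.
  have key : ∑ i : Fin 2, ∫ x, f x * fderiv ℝ (fun x => inner ℝ x (e i) * φ x) x (e i) =
      ∑ i : Fin 2, - ∫ x, inner ℝ (g x) (e i) * (inner ℝ x (e i) * φ x) :=
    Finset.sum_congr rfl fun i _ => h _ (hφ.coord_mul (e i)) (e i)
  rw [Finset.sum_neg_distrib, ← integral_finsetSum _ fun i _ => hi1 i,
    ← integral_finsetSum _ fun i _ => hi2 i] at key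
  have hfd : ∀ (i : Fin 2) (x : Plane), fderiv ℝ (fun x => inner ℝ x (e i) * φ x) x (e i) =
      inner ℝ x (e i) * fderiv ℝ φ x (e i) + φ x := by
    intro i x
    have h1 : HasFDerivAt φ (fderiv ℝ φ x) x := (hφ.1.differentiable (by simp) _).hasFDerivAt
    have h2 : HasFDerivAt (fun x : Plane => (inner ℝ x (e i) : ℝ)) (innerSL ℝ (e i)) x := by
      have := (innerSL ℝ (e i)).hasFDerivAt (x := x)
      refine this.congr_of_eventuallyEq (Eventually.of_forall fun y => ?_)
      simp [real_inner_comm]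
    have h3 : fderiv ℝ (fun x => inner ℝ x (e i) * φ x) x = _ := (h2.mul h1).fderiv
    rw [h3]
    simp
  have hx1 : ∀ x : Plane, ∑ i : Fin 2, f x * fderiv ℝ (fun x => inner ℝ x (e i) * φ x) x (e i) =
      f x * (2 * φ x + fderiv ℝ φ x x) := by
    intro x
    rw [← Finset.mul_sum]
    congr 1
    simp_rw [hfd]
    rw [Finset.sum_add_distrib, Finset.sum_const, Finset.card_univ, Fintype.card_fin]
    have : fderiv ℝ φ x x = ∑ i : Fin 2, inner ℝ x (e i) * fderiv ℝ φ x (e i) := by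
      conv_lhs => rw [← e.sum_repr' x, map_sum]
      refine Finset.sum_congr rfl fun i _ => ?_
      rw [map_smul, smul_eq_mul, e.sum_repr' x, real_inner_comm]
    rw [this]; simp; ring
  have hx2 : ∀ x : Plane, ∑ i : Fin 2, inner ℝ (g x) (e i) * (inner ℝ x (e i) * φ x) =
      inner ℝ (g x) x * φ x := by
    intro x
    simp_rw [← mul_assoc]
    rw [← Finset.sum_mul]
    congr 1
    rw [← e.sum_inner_mul_inner (g x) x]
    refine Finset.sum_congr rfl fun i _ => ?_
    rw [real_inner_comm x]
  simp_rw [hx1, hx2] at key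
  exact key

theorem hasDerivAt_dilated {φ : Plane → ℝ} (hφ : IsTestFunction φ) (x : Plane) (τ : ℝ) :
    HasDerivAt (fun τ => Real.exp (-τ) * φ (Real.exp (-τ) • x))
      (-(Real.exp (-τ) * (φ (Real.exp (-τ) • x) +
        fderiv ℝ φ (Real.exp (-τ) • x) (Real.exp (-τ) • x)))) τ := by
  have h1 : HasFDerivAt φ (fderiv ℝ φ (Real.exp (-τ) • x)) (Real.exp (-τ) • x) :=
    (hφ.1.differentiable (by simp) _).hasFDerivAt
  have h2 : HasDerivAt (fun τ : ℝ => Real.exp (-τ)) (-Real.exp (-τ)) τ := by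
    simpa using (hasDerivAt_neg τ).exp
  have h3 := h1.comp_hasDerivAt τ (h2.smul_const x)
  refine (h2.mul h3).congr_deriv ?_
  simp only [Function.comp, neg_smul, map_neg]
  ring

theorem IsTestFunction.add_euler {φ : Plane → ℝ} (hφ : IsTestFunction φ) :
    IsTestFunction (fun x => φ x + fderiv ℝ φ x x) := by
  refine ⟨hφ.1.add ((hφ.1.fderiv_right (m := ∞) (by norm_cast)).clm_apply contDiff_id), ?_⟩
  refine hφ.2.add ((HasCompactSupport.fderiv (𝕜 := ℝ) hφ.2).mono fun x hx => ?_)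
  intro h0
  apply hx
  simp [h0]

/-- Derivative of the pairing of a Sobolev function with a dilated test function. -/
theorem HasWeakGradient.hasDerivAt_inner_dilation {f : PlaneL2} {g : PlaneVecL2}
    (h : HasWeakGradient f g) {k : PlaneL2} (hk : k =ᵐ[volume] fun x => f x + inner ℝ (g x) x)
    {φ : Plane → ℝ} (hφ : IsTestFunction φ) (τ : ℝ) :
    HasDerivAt (fun τ => inner ℝ hφ.toL2 (dilation τ f)) (inner ℝ hφ.toL2 (dilation τ k)) τ := by
  have e : ∀ (σ : ℝ) (ψ : Plane → ℝ) (hψ : IsTestFunction ψ) (w : PlaneL2),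
      inner ℝ hψ.toL2 (dilation σ w) =
      ∫ x, w x * (Real.exp (-σ) * ψ (Real.exp (-σ) • x)) := by
    intro σ ψ hψ w
    rw [inner_dilation_right, L2.inner_def]
    refine integral_congr_ae ?_
    filter_upwards [coeFn_dilation_of_ae_eq (-σ) hψ.coeFn_toL2] with x hx
    rw [hx]; rfl
  have hF : (fun τ => inner ℝ hφ.toL2 (dilation τ f)) =
      fun τ => ∫ x, f x * (Real.exp (-τ) * φ (Real.exp (-τ) • x)) := by
    ext σ; exact e σ φ hφ f
  have hd := hφ.add_euler
  obtain ⟨C, R, hC, hR⟩ := exists_bound_of_compact hd.1.continuous hd.2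
  have hloc : LocallyIntegrable (f : Plane → ℝ) volume :=
    (Lp.memLp f).locallyIntegrable (by norm_num)
  have hbound : Integrable (fun x => ‖f x‖ *
      (Metric.closedBall (0 : Plane) (Real.exp (1 - -τ) * R)).indicator
        (fun _ => Real.exp (-τ + 1) * C) x) :=
    (Lp.memLp f).norm.integrable_mul (memLp_indicator_closedBall _ _)
  have main := (hasDerivAt_integral_of_dominated_loc_of_deriv_le (μ := (volume : Measure Plane))
    (F := fun τ x => f x * (Real.exp (-τ) * φ (Real.exp (-τ) • x)))
    (F' := fun τ x => f x * (-(Real.exp (-τ) * (φ (Real.exp (-τ) • x) +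
        fderiv ℝ φ (Real.exp (-τ) • x) (Real.exp (-τ) • x)))))
    (x₀ := τ) (Metric.ball_mem_nhds τ one_pos) ?_ ?_ ?_ ?_ hbound ?_).2
  · rw [hF]
    refine main.congr_deriv ?_
    have e2 := (hφ.dilated (-τ))
    have key := h.integral_euler e2
    rw [e τ φ hφ k]
    have hx : ∀ x, fderiv ℝ (fun x => Real.exp (-τ) * φ (Real.exp (-τ) • x)) x x =
        Real.exp (-τ) * fderiv ℝ φ (Real.exp (-τ) • x) (Real.exp (-τ) • x) := by
      intro x
      rw [fderiv_dilated hφ, map_smul]; rfl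
    simp_rw [hx] at key
    have i1 : Integrable (fun x => f x * (Real.exp (-τ) * φ (Real.exp (-τ) • x))) :=
      (Lp.memLp f).integrable_mul e2.memLp
    have i2 : Integrable (fun x => inner ℝ (g x) x * (Real.exp (-τ) * φ (Real.exp (-τ) • x))) := by
      have hm : MemLp (fun x : Plane => (Real.exp (-τ) * φ (Real.exp (-τ) • x)) • x) 2 volume :=
        (e2.1.continuous.smul continuous_id).memLp_of_hasCompactSupport e2.2.smul_right
      have := L2.integrable_inner (𝕜 := ℝ) g hm.toLp
      refine this.congr ?_
      filter_upwards [hm.coeFn_toLp] with x hx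
      rw [hx, inner_smul_right, mul_comm]
    have i3 : Integrable (fun x => f x * (-(Real.exp (-τ) * (φ (Real.exp (-τ) • x) +
        fderiv ℝ φ (Real.exp (-τ) • x) (Real.exp (-τ) • x))))) := by
      have := ((Lp.memLp f).integrable_mul (hd.dilated (-τ)).memLp).neg
      refine this.congr (Eventually.of_forall fun x => ?_)
      simp only [Pi.neg_apply, Pi.mul_apply]; ring
    have e3 : ∫ x, k x * (Real.exp (-τ) * φ (Real.exp (-τ) • x)) =
        (∫ x, f x * (Real.exp (-τ) * φ (Real.exp (-τ) • x))) +
        ∫ x, inner ℝ (g x) x * (Real.exp (-τ) * φ (Real.exp (-τ) • x)) := by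
      rw [← integral_add i1 i2]
      refine integral_congr_ae ?_
      filter_upwards [hk] with x hx
      rw [hx]; ring
    have e4 : ∫ x, f x * (2 * (Real.exp (-τ) * φ (Real.exp (-τ) • x)) +
        Real.exp (-τ) * fderiv ℝ φ (Real.exp (-τ) • x) (Real.exp (-τ) • x)) =
        (∫ x, f x * (Real.exp (-τ) * φ (Real.exp (-τ) • x))) -
        ∫ x, f x * (-(Real.exp (-τ) * (φ (Real.exp (-τ) • x) +
        fderiv ℝ φ (Real.exp (-τ) • x) (Real.exp (-τ) • x)))) := by
      rw [← integral_sub i1 i3]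
      refine integral_congr_ae (Eventually.of_forall fun x => ?_)
      ring
    rw [e3]
    linarith
  · exact Eventually.of_forall fun σ => ((Lp.memLp f).integrable_mul (hφ.dilated (-σ)).memLp).1
  · exact (Lp.memLp f).integrable_mul (hφ.dilated (-τ)).memLp
  · have := ((Lp.memLp f).integrable_mul (hd.dilated (-τ)).memLp).1.neg
    refine this.congr (Eventually.of_forall fun x => ?_)
    simp only [Pi.neg_apply, Pi.mul_apply]; ring
  · refine Eventually.of_forall fun x σ hσ => ?_
    rw [norm_mul, norm_neg]
    refine mul_le_mul_of_nonneg_left ?_ (norm_nonneg _)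
    rw [Metric.mem_ball, Real.dist_eq] at hσ
    refine norm_dilated_le (τ := -σ) (τ₀ := -τ) hC hR ?_ x
    rw [← abs_neg]; convert hσ using 2; ring
  · exact Eventually.of_forall fun x σ _ => (hasDerivAt_dilated hφ x σ).const_mul (f x)

theorem eq_zero_of_inner_testFunction {w : PlaneL2}
    (h : ∀ (φ : Plane → ℝ) (hφ : IsTestFunction φ), inner ℝ hφ.toL2 w = 0) : w = 0 := by
  have hd := Lp.dense_hasCompactSupport_contDiff (F := ℝ) (μ := (volume : Measure Plane))
    (p := 2) (by norm_num)
  refine hd.eq_zero_of_inner_right ℝ fun v hv => ?_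
  obtain ⟨ψ, hψ, hc, hs⟩ := hv
  have ht : IsTestFunction ψ := ⟨hs, hc⟩
  have : v = ht.toL2 := Lp.ext (hψ.trans ht.coeFn_toL2.symm)
  rw [this]
  exact h ψ ht

/-- The dilation group is differentiable at Sobolev functions `f` for which `x · ∇f` is square
integrable, with derivative `f + x · ∇f`. -/
theorem HasWeakGradient.hasDerivAt_dilation_zero {f : PlaneL2} {g : PlaneVecL2}
    (h : HasWeakGradient f g) {k : PlaneL2} (hk : k =ᵐ[volume] fun x => f x + inner ℝ (g x) x) :
    HasDerivAt (fun τ => dilation τ f) k 0 := by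
  have hci : ∀ a b, IntervalIntegrable (fun τ => dilation τ k) volume a b := fun a b =>
    (continuous_dilation k).intervalIntegrable a b
  -- The derivative is known only after pairing with test functions. Integrating it gives an
  -- identity in `L²`, and continuity of `τ ↦ dilation τ k` then upgrades weak to strong
  -- differentiability.
  have key : ∀ τ, dilation τ f = f + ∫ σ in (0:ℝ)..τ, dilation σ k := by
    intro τ
    rw [← sub_eq_zero]
    refine eq_zero_of_inner_testFunction fun φ hφ => ?_
    have h1 := ContinuousLinearMap.intervalIntegral_comp_comm (innerSL ℝ hφ.toL2) (hci 0 τ)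
    simp only [innerSL_apply_apply] at h1
    have h2 := intervalIntegral.integral_eq_sub_of_hasDerivAt
      (fun σ _ => h.hasDerivAt_inner_dilation hk hφ σ) (a := 0) (b := τ)
      ((continuous_const.inner (continuous_dilation k)).intervalIntegrable 0 τ)
    rw [dilation_zero] at h2
    rw [inner_sub_right, inner_add_right, ← h1, h2]
    ring
  have h3 : HasDerivAt (fun τ => ∫ σ in (0:ℝ)..τ, dilation σ k) (dilation 0 k) 0 :=
    intervalIntegral.integral_hasDerivAt_right (hci 0 0)
      ((continuous_dilation k).stronglyMeasurableAtFilter _ _) (continuous_dilation k).continuousAt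
  rw [dilation_zero] at h3
  have h4 := h3.const_add f
  exact h4.congr_of_eventuallyEq (Eventually.of_forall key)

/-- The symmetric difference is preferred to a one-sided quotient because it is exactly skew-adjoint
before the limit. -/
theorem HasWeakGradient.tendsto_dilation_symm {f : PlaneL2} {g : PlaneVecL2}
    (h : HasWeakGradient f g) {k : PlaneL2} (hk : k =ᵐ[volume] fun x => f x + inner ℝ (g x) x) :
    Tendsto (fun τ : ℝ => τ⁻¹ • (dilation τ f - dilation (-τ) f)) (𝓝[>] 0)
      (𝓝 ((2:ℝ) • k)) := by
  have h1 := h.hasDerivAt_dilation_zero hk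
  have h2 : HasDerivAt (fun τ => dilation (-τ) f) (-k) 0 := by
    have h1' : HasDerivAt (fun τ => dilation τ f) k (-0) := by rwa [neg_zero]
    have := h1'.scomp 0 (hasDerivAt_neg 0)
    simpa [Function.comp_def] using this
  have h3 := (h1.sub h2).tendsto_slope_zero_right
  rw [sub_neg_eq_add, ← two_smul ℝ k] at h3
  refine h3.congr fun τ => ?_
  simp

/-! ### The equation tested against Sobolev functions and against moving curves. -/

/-- A finite energy solution extended to all real times as a `C¹` curve in `L²`, with the equation
in time-integrated form against arbitrary Sobolev functions. -/
structure IsExtendedSolution (K : Plane → ℝ) (hK : IsBoundedMeas K)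
    (u ut : ℝ → PlaneL2) (g : ℝ → PlaneVecL2) : Prop where
  continuous_deriv : Continuous ut
  continuous_grad : Continuous g
  hasDerivAt : ∀ t, HasDerivAt u (ut t) t
  hasWeakGradient : ∀ t, 0 ≤ t → HasWeakGradient (u t) (g t)
  weak : ∀ a b, 0 ≤ a → a ≤ b → ∀ f f', HasWeakGradient f f' →
    inner ℝ (ut b - ut a) f = - inner ℝ (scalarMul Plane K hK (∫ s in a..b, g s)) f'

/-- Once integrated in time, the equation is continuous in the pair formed by `f` and its gradient,
so it passes from test functions to their closure. -/
theorem IsEnergySolution.weak_integrated {K u₀ u₁ : Plane → ℝ} (hK : IsBoundedMeas K)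
    {u ut : ℝ → PlaneL2} {g : ℝ → PlaneVecL2} (hu : IsEnergySolution K u₀ u₁ u ut g)
    {a b : ℝ} (ha : 0 ≤ a) (hab : a ≤ b) {f : PlaneL2} {f' : PlaneVecL2}
    (hf : HasWeakGradient f f') :
    inner ℝ (ut b - ut a) f = - inner ℝ (scalarMul Plane K hK (∫ s in a..b, g s)) f' := by
  have hsub : Set.Icc a b ⊆ Set.Ici 0 := fun x hx => ha.trans hx.1
  have hgi : IntervalIntegrable g volume a b :=
    (hu.continuousOn_grad.mono hsub).intervalIntegrable_of_Icc hab
  have hcl : IsClosed {p : PlaneL2 × PlaneVecL2 |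
      inner ℝ (ut b - ut a) p.1 = - inner ℝ (scalarMul Plane K hK (∫ s in a..b, g s)) p.2} :=
    isClosed_eq (by fun_prop) (by fun_prop)
  refine (closure_minimal ?_ hcl) hf.mem_closure
  rintro _ ⟨φ, hφ, rfl⟩
  simp only [Set.mem_ofPred_eq]
  have hK' : ∀ t, ∫ x, K x * inner ℝ (g t x) (gradient φ x) =
      inner ℝ (scalarMul Plane K hK (g t)) hφ.gradL2 := by
    intro t
    rw [inner_scalarMul]
    refine integral_congr_ae ?_
    filter_upwards [hφ.coeFn_gradL2] with x hx
    rw [hx]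
  have hcont : ContinuousOn (fun t => - inner ℝ (scalarMul Plane K hK (g t)) hφ.gradL2)
      (Set.Icc a b) := by
    have h1 : ContinuousOn (fun t => scalarMul Plane K hK (g t)) (Set.Icc a b) :=
      (scalarMul Plane K hK).continuous.comp_continuousOn (hu.continuousOn_grad.mono hsub)
    exact (h1.inner continuousOn_const).neg
  have h1 := intervalIntegral.integral_eq_sub_of_hasDerivAt_of_le hab
    (f := fun t => inner ℝ (ut t) hφ.toL2)
    (f' := fun t => - inner ℝ (scalarMul Plane K hK (g t)) hφ.gradL2)
    ((hu.continuousOn_deriv.mono hsub).inner continuousOn_const) ?_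
    (hcont.intervalIntegrable_of_Icc hab)
  · have h2 := ContinuousLinearMap.intervalIntegral_comp_comm
      ((innerSL ℝ hφ.gradL2).comp (scalarMul Plane K hK)) hgi
    simp only [ContinuousLinearMap.comp_apply, innerSL_apply_apply] at h2
    rw [inner_sub_left, ← h1, intervalIntegral.integral_neg, real_inner_comm, ← h2]
    simp_rw [real_inner_comm]
  · intro t ht
    have := hu.equation φ hφ t (ha.trans_lt ht.1)
    rw [hK'] at this
    refine this.congr_of_eventuallyEq (Eventually.of_forall fun s => ?_)
    exact hφ.inner_toL2 (ut s)

/-- Velocity and gradient are frozen at their initial values for negative times, and the position is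
recovered by integrating the velocity. The curve then has a two-sided derivative at every time,
including `0`. -/
theorem IsEnergySolution.exists_extended {K u₀ u₁ : Plane → ℝ} (hK : IsBoundedMeas K)
    {u ut : ℝ → PlaneL2} {g : ℝ → PlaneVecL2} (hu : IsEnergySolution K u₀ u₁ u ut g) :
    ∃ (v vt : ℝ → PlaneL2) (w : ℝ → PlaneVecL2), IsExtendedSolution K hK v vt w ∧
      ∀ t, 0 ≤ t → v t = u t ∧ vt t = ut t ∧ w t = g t := by
  have hm : ∀ t : ℝ, 0 ≤ t → max t 0 = t := fun t ht => max_eq_left ht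
  have hmc : Continuous fun t : ℝ => max t 0 := by fun_prop
  have hvt : Continuous (fun t => ut (max t 0)) :=
    hu.continuousOn_deriv.comp_continuous hmc fun t => Set.mem_Ici.2 (le_max_right _ _)
  have hw : Continuous (fun t => g (max t 0)) :=
    hu.continuousOn_grad.comp_continuous hmc fun t => Set.mem_Ici.2 (le_max_right _ _)
  have hv : ∀ t, 0 ≤ t → u 0 + ∫ s in (0:ℝ)..t, ut (max s 0) = u t := by
    intro t ht
    rw [intervalIntegral.integral_eq_sub_of_hasDerivAt_of_le ht (f := u)
      (hu.continuousOn.mono fun x hx => hx.1) ?_ (hvt.intervalIntegrable 0 t)]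
    · abel
    · intro s hs
      rw [hm s hs.1.le]
      exact (hu.hasDerivWithinAt s hs.1.le).hasDerivAt (Ici_mem_nhds hs.1)
  refine ⟨fun t => u 0 + ∫ s in (0:ℝ)..t, ut (max s 0), fun t => ut (max t 0),
    fun t => g (max t 0), ⟨hvt, hw, ?_, ?_, ?_⟩, ?_⟩
  · intro t
    exact (intervalIntegral.integral_hasDerivAt_right (hvt.intervalIntegrable 0 t)
      (hvt.stronglyMeasurableAtFilter _ _) hvt.continuousAt).const_add _
  · intro t ht
    simp only [hv t ht, hm t ht]
    exact hu.hasWeakGradient t ht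
  · intro a b ha hab f f' hf
    have : ∫ s in a..b, g (max s 0) = ∫ s in a..b, g s := by
      refine intervalIntegral.integral_congr fun s hs => ?_
      rw [Set.uIcc_of_le hab] at hs
      simp only [hm s (ha.trans hs.1)]
    simp only [hm a ha, hm b (ha.trans hab), this]
    exact hu.weak_integrated hK ha hab hf
  · intro t ht
    exact ⟨hv t ht, by simp only [hm t ht], by simp only [hm t ht]⟩

/-- The term of the product rule containing the derivative of `A` is multiplied by `B t = 0`, so
continuity of `A` suffices. This is needed because `ut` need not be differentiable in `L²`. -/
theorem hasDerivAt_inner_of_eq_zero {H : Type*} [NormedAddCommGroup H] [InnerProductSpace ℝ H]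
    {A B : ℝ → H} {B' : H} {t : ℝ} (hA : ContinuousAt A t) (hB : HasDerivAt B B' t)
    (h0 : B t = 0) : HasDerivAt (fun s => (inner ℝ (A s) (B s) : ℝ)) (inner ℝ (A t) B') t := by
  rw [hasDerivAt_iff_tendsto_slope] at hB ⊢
  have h1 : Tendsto A (𝓝[≠] t) (𝓝 (A t)) := hA.mono_left nhdsWithin_le_nhds
  refine (h1.inner hB).congr fun s => ?_
  simp [slope, h0, inner_smul_right]

namespace IsExtendedSolution

variable {K : Plane → ℝ} {hK : IsBoundedMeas K} {u ut : ℝ → PlaneL2} {g : ℝ → PlaneVecL2}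

theorem continuous (hu : IsExtendedSolution K hK u ut g) : Continuous u :=
  continuous_iff_continuousAt.2 fun t => (hu.hasDerivAt t).continuousAt

theorem hasDerivAt_integral_grad (hu : IsExtendedSolution K hK u ut g) (a t : ℝ) :
    HasDerivAt (fun s => ∫ r in a..s, g r) (g t) t :=
  intervalIntegral.integral_hasDerivAt_right (hu.continuous_grad.intervalIntegrable a t)
    (hu.continuous_grad.stronglyMeasurableAtFilter _ _) hu.continuous_grad.continuousAt

theorem hasDerivAt_inner_const (hu : IsExtendedSolution K hK u ut g) {f : PlaneL2}
    {f' : PlaneVecL2} (hf : HasWeakGradient f f') {t : ℝ} (ht : 0 < t) :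
    HasDerivAt (fun s => inner ℝ (ut s) f) (- inner ℝ (scalarMul Plane K hK (g t)) f') t := by
  have h1 : HasDerivAt (fun s => inner ℝ (ut 0) f +
      - inner ℝ (scalarMul Plane K hK (∫ r in (0:ℝ)..s, g r)) f')
      (- inner ℝ (scalarMul Plane K hK (g t)) f') t := by
    have h2 := (scalarMul Plane K hK).hasFDerivAt.comp_hasDerivAt t
      (hu.hasDerivAt_integral_grad 0 t)
    have h3 := (h2.inner ℝ (hasDerivAt_const t f')).neg.const_add (inner ℝ (ut 0) f)
    simpa using h3
  refine h1.congr_of_eventuallyEq ?_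
  filter_upwards [lt_mem_nhds ht] with s hs
  rw [← hu.weak 0 s le_rfl hs.le f f' hf, inner_sub_left]; ring

/-- The equation tested against a differentiable curve whose values are Sobolev functions. -/
theorem hasDerivAt_inner (hu : IsExtendedSolution K hK u ut g) {φ : ℝ → PlaneL2} {φ' : PlaneL2}
    {ψ : PlaneVecL2} {t : ℝ} (ht : 0 < t) (hφ : HasDerivAt φ φ' t) (hw : HasWeakGradient (φ t) ψ) :
    HasDerivAt (fun s => inner ℝ (ut s) (φ s))
      (inner ℝ (ut t) φ' - inner ℝ (scalarMul Plane K hK (g t)) ψ) t := by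
  -- Split `φ s = φ t + (φ s - φ t)`: the fixed Sobolev function is handled by the equation, and the
  -- remainder vanishes at `s = t`.
  have h1 := hu.hasDerivAt_inner_const hw ht
  have h2 := hasDerivAt_inner_of_eq_zero (A := ut) (B := fun s => φ s - φ t)
    hu.continuous_deriv.continuousAt (hφ.sub_const _) (sub_self _)
  have h3 := h1.add h2
  have e : (fun s => inner ℝ (ut s) (φ s) : ℝ → ℝ) =
      (fun s => inner ℝ (ut s) (φ t)) + fun s => inner ℝ (ut s) (φ s - φ t) := by
    ext s
    simp only [Pi.add_apply]
    rw [inner_sub_right]; ring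
  rw [e]
  exact h3.congr_deriv (by ring)

end IsExtendedSolution

/-! ### Weighted energies and their growth. -/

/-- The energy of a pair `(p, q)` with a weight. -/
noncomputable def weightedEnergy (K ζ : Plane → ℝ) (p : PlaneL2) (q : PlaneVecL2) : ℝ :=
  (1 / 2) * ∫ x, ζ x * (p x ^ 2 + K x * ‖q x‖ ^ 2)

theorem IsBoundedMeas.mul {a b : Plane → ℝ} (ha : IsBoundedMeas a) (hb : IsBoundedMeas b) :
    IsBoundedMeas (fun x => a x * b x) := by
  obtain ⟨C, hC⟩ := ha.bdd
  obtain ⟨D, hD⟩ := hb.bdd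
  refine ⟨ha.meas.mul hb.meas, C * D, fun x => ?_⟩
  rw [abs_mul]
  exact mul_le_mul (hC x) (hD x) (abs_nonneg _) ((abs_nonneg _).trans (hC x))

theorem integrable_weighted {K ζ : Plane → ℝ} (hK : IsBoundedMeas K) (hζ : IsBoundedMeas ζ)
    (p : PlaneL2) (q : PlaneVecL2) :
    Integrable (fun x => ζ x * (p x ^ 2 + K x * ‖q x‖ ^ 2)) := by
  have h1 := integrable_mul_inner hζ p p
  have h2 := integrable_mul_inner (hζ.mul hK) q q
  refine (h1.add h2).congr (Eventually.of_forall fun x => ?_)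
  simp only [Pi.add_apply, real_inner_self_eq_norm_sq, Real.norm_eq_abs, sq_abs]
  ring

theorem weightedEnergy_eq {K ζ : Plane → ℝ} (hK : IsBoundedMeas K) (hζ : IsBoundedMeas ζ)
    (p : PlaneL2) (q : PlaneVecL2) :
    weightedEnergy K ζ p q = (1 / 2) * (inner ℝ (scalarMul ℝ ζ hζ p) p +
      inner ℝ (scalarMul Plane _ (hζ.mul hK) q) q) := by
  rw [weightedEnergy, inner_scalarMul, inner_scalarMul,
    ← integral_add (integrable_mul_inner hζ p p) (integrable_mul_inner (hζ.mul hK) q q)]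
  congr 1
  refine integral_congr_ae (Eventually.of_forall fun x => ?_)
  simp only [real_inner_self_eq_norm_sq, Real.norm_eq_abs, sq_abs]
  ring

theorem tendsto_weightedEnergy {K ζ : Plane → ℝ} (hK : IsBoundedMeas K) (hζ : IsBoundedMeas ζ)
    {ι : Type*} {l : Filter ι} {p : ι → PlaneL2} {q : ι → PlaneVecL2} {p₀ : PlaneL2}
    {q₀ : PlaneVecL2} (hp : Tendsto p l (𝓝 p₀)) (hq : Tendsto q l (𝓝 q₀)) :
    Tendsto (fun i => weightedEnergy K ζ (p i) (q i)) l (𝓝 (weightedEnergy K ζ p₀ q₀)) := by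
  simp_rw [weightedEnergy_eq hK hζ]
  have h1 : Tendsto (fun i => scalarMul ℝ ζ hζ (p i)) l (𝓝 (scalarMul ℝ ζ hζ p₀)) :=
    ((scalarMul ℝ ζ hζ).continuous.tendsto p₀).comp hp
  have h2 : Tendsto (fun i => scalarMul Plane _ (hζ.mul hK) (q i)) l
      (𝓝 (scalarMul Plane _ (hζ.mul hK) q₀)) :=
    ((scalarMul Plane _ (hζ.mul hK)).continuous.tendsto q₀).comp hq
  exact ((h1.inner hp).add (h2.inner hq)).const_mul _

theorem hasDerivAt_inner_scalarMul_self {E : Type*} [NormedAddCommGroup E] [InnerProductSpace ℝ E]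
    {a : Plane → ℝ} (ha : IsBoundedMeas a) {p : ℝ → Lp E 2 (volume : Measure Plane)}
    {p' : Lp E 2 (volume : Measure Plane)} {t : ℝ} (hp : HasDerivAt p p' t) :
    HasDerivAt (fun s => (inner ℝ (scalarMul E a ha (p s)) (p s) : ℝ))
      (2 * inner ℝ (scalarMul E a ha (p t)) p') t := by
  have h1 := ((scalarMul E a ha).hasFDerivAt.comp_hasDerivAt t hp).inner ℝ hp
  refine h1.congr_deriv ?_
  simp only [Function.comp]
  rw [inner_scalarMul_comm a ha p', real_inner_comm _ p']
  ring

/-- Pointwise, `K |p| |q| |Z| = (√K |q| |p|) (√K |Z|)`. The first factor is at most the energy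
density by the arithmetic-geometric mean inequality, the second at most `c ζ`. -/
theorem weightedEnergy_flux_le {K ζ : Plane → ℝ} (hK : IsBoundedMeas K) (hζ : IsBoundedMeas ζ)
    (hK0 : ∀ x, 0 ≤ K x) {c : ℝ} {Z : Plane → Plane}
    (hZ : IsBoundedField (fun x => ContinuousLinearMap.toSpanSingleton ℝ (Z x)))
    (hc : ∀ x, √(K x) * ‖Z x‖ ≤ c * ζ x) (p : PlaneL2) (q : PlaneVecL2) :
    - inner ℝ (scalarMul Plane K hK q) (mulOp _ hZ p) ≤ c * weightedEnergy K ζ p q := by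
  rw [weightedEnergy, L2.inner_def, ← integral_neg, ← mul_assoc, ← integral_const_mul]
  refine integral_mono_ae (L2.integrable_inner (𝕜 := ℝ) _ _).neg
    ((integrable_weighted hK hζ p q).const_mul _) ?_
  filter_upwards [coeFn_scalarMul K hK q, coeFn_mulOp _ hZ p] with x h1 h2
  rw [h1, h2, ContinuousLinearMap.toSpanSingleton_apply, inner_smul_left, inner_smul_right]
  simp only [conj_trivial]
  have hin := abs_real_inner_le_norm (q x) (Z x)
  have hs := Real.mul_self_sqrt (hK0 x)
  have hs0 := Real.sqrt_nonneg (K x)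
  set s := √(K x) with hsdef
  rw [← hs]
  have h3 : -(s * s * (p x * inner ℝ (q x) (Z x))) ≤ (s * ‖q x‖) * |p x| * (s * ‖Z x‖) := by
    calc -(s * s * (p x * inner ℝ (q x) (Z x))) ≤ |s * s * (p x * inner ℝ (q x) (Z x))| :=
          neg_le_abs _
      _ = s * s * (|p x| * |inner ℝ (q x) (Z x)|) := by
          rw [abs_mul, abs_mul (p x), abs_of_nonneg (by positivity : 0 ≤ s * s)]
      _ ≤ s * s * (|p x| * (‖q x‖ * ‖Z x‖)) := by gcongr
      _ = _ := by ring
  have h4 : (s * ‖q x‖) * |p x| * (s * ‖Z x‖) ≤ (s * ‖q x‖) * |p x| * (c * ζ x) := by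
    exact mul_le_mul_of_nonneg_left (hc x) (by positivity)
  have h0 : 0 ≤ c * ζ x := (by positivity : 0 ≤ s * ‖Z x‖).trans (hc x)
  have h5 : (s * ‖q x‖) * |p x| ≤ 1 / 2 * (p x ^ 2 + s * s * ‖q x‖ ^ 2) := by
    nlinarith [sq_nonneg (s * ‖q x‖ - |p x|), sq_abs (p x)]
  calc _ ≤ _ := h3.trans h4
    _ ≤ 1 / 2 * (p x ^ 2 + s * s * ‖q x‖ ^ 2) * (c * ζ x) := by gcongr
    _ = _ := by ring

/-- The product with `exp (-c t)` is nonincreasing; no sign of `f` is needed. With `c = 0` it serves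
as plain monotonicity. -/
theorem le_exp_mul_of_hasDerivAt_le {f : ℝ → ℝ} {c : ℝ}
    (hf : ∀ r, 0 ≤ r → ∃ D, HasDerivAt f D r ∧ D ≤ c * f r) {s t : ℝ} (hs : 0 ≤ s) (hst : s ≤ t) :
    f t ≤ Real.exp (c * (t - s)) * f s := by
  have hder : ∀ r, 0 ≤ r → ∃ D, HasDerivAt (fun t => Real.exp (-c * t) * f t) D r ∧ D ≤ 0 := by
    intro r hr
    obtain ⟨E', h1, h2⟩ := hf r hr
    have h3 : HasDerivAt (fun t => Real.exp (-c * t)) (Real.exp (-c * r) * (-c)) r := by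
      have := ((hasDerivAt_id r).const_mul (-c)).exp
      simpa using this
    refine ⟨_, h3.mul h1, ?_⟩
    have := mul_le_mul_of_nonneg_left h2 (Real.exp_pos (-c * r)).le
    linarith
  have hanti : AntitoneOn (fun t => Real.exp (-c * t) * f t) (Set.Ici 0) := by
    refine antitoneOn_of_deriv_nonpos (convex_Ici 0) ?_ ?_ ?_
    · intro r hr
      obtain ⟨D, h1, -⟩ := hder r hr
      exact h1.continuousAt.continuousWithinAt
    · intro r hr
      rw [interior_Ici] at hr
      obtain ⟨D, h1, -⟩ := hder r (le_of_lt hr)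
      exact h1.differentiableAt.differentiableWithinAt
    · intro r hr
      rw [interior_Ici] at hr
      obtain ⟨D, h1, h2⟩ := hder r (le_of_lt hr)
      rw [h1.deriv]; exact h2
  have h5 := hanti (Set.mem_Ici.2 hs) (Set.mem_Ici.2 (hs.trans hst)) hst
  simp only at h5
  have h6 := mul_le_mul_of_nonneg_left h5 (Real.exp_pos (c * t)).le
  rw [← mul_assoc, ← mul_assoc, ← Real.exp_add, ← Real.exp_add] at h6
  have e1 : c * t + -c * t = 0 := by ring
  have e2 : c * t + -c * s = c * (t - s) := by ring
  rwa [e1, e2, Real.exp_zero, one_mul] at h6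

/-- The difference quotient of a curve. -/
noncomputable def diffQuot {H : Type*} [NormedAddCommGroup H] [NormedSpace ℝ H] (u : ℝ → H)
    (h t : ℝ) : H := h⁻¹ • (u (t + h) - u t)

/-- The Steklov average of a curve. -/
noncomputable def steklov {H : Type*} [NormedAddCommGroup H] [NormedSpace ℝ H] (g : ℝ → H)
    (h t : ℝ) : H := h⁻¹ • ∫ r in t..(t + h), g r

theorem hasDerivAt_diffQuot {H : Type*} [NormedAddCommGroup H] [NormedSpace ℝ H] {u u' : ℝ → H}
    (hu : ∀ t, HasDerivAt u (u' t) t) (h t : ℝ) :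
    HasDerivAt (diffQuot u h) (diffQuot u' h t) t :=
  (((hu (t + h)).comp_add_const t h).sub (hu t)).const_smul h⁻¹

theorem hasDerivAt_steklov {H : Type*} [NormedAddCommGroup H] [NormedSpace ℝ H] [CompleteSpace H]
    {g : ℝ → H} (hg : Continuous g) (h t : ℝ) : HasDerivAt (steklov g h) (diffQuot g h t) t := by
  have e : steklov g h = diffQuot (fun t => ∫ r in (0:ℝ)..t, g r) h := by
    ext1 t
    simp only [steklov, diffQuot]
    rw [intervalIntegral.integral_interval_sub_left] <;> exact hg.intervalIntegrable _ _
  rw [e]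
  exact hasDerivAt_diffQuot (fun t => intervalIntegral.integral_hasDerivAt_right
    (hg.intervalIntegrable 0 t) (hg.stronglyMeasurableAtFilter _ _) hg.continuousAt) h t

theorem tendsto_steklov {H : Type*} [NormedAddCommGroup H] [NormedSpace ℝ H] [CompleteSpace H]
    {g : ℝ → H} (hg : Continuous g) (t : ℝ) :
    Tendsto (fun h => steklov g h t) (𝓝[>] 0) (𝓝 (g t)) := by
  have := (intervalIntegral.integral_hasDerivAt_right (hg.intervalIntegrable t t)
    (hg.stronglyMeasurableAtFilter _ _) hg.continuousAt).tendsto_slope_zero_right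
  simpa [steklov] using this

/-- The pair consists of the time derivative and the gradient of `h⁻¹ ∫ u` over `[t, t + h]`. This
average is once more differentiable in time than `u`, and its velocity, times `ζ`, is a Sobolev
function that may be put into the equation. The interior terms cancel and only the flux along `∇ζ`
remains. -/
theorem IsExtendedSolution.hasDerivAt_weightedEnergy {K : Plane → ℝ} {hK : IsBoundedMeas K}
    {u ut : ℝ → PlaneL2} {g : ℝ → PlaneVecL2} (hu : IsExtendedSolution K hK u ut g)
    {ζ : Plane → ℝ} (hζs : ContDiff ℝ ∞ ζ) (hζ : IsBoundedMeas ζ)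
    (hd : IsBoundedField (fun x => ContinuousLinearMap.toSpanSingleton ℝ (gradient ζ x)))
    {h t : ℝ} (hh : 0 < h) (ht : 0 ≤ t) :
    HasDerivAt (fun t => weightedEnergy K ζ (diffQuot u h t) (steklov g h t))
      (- inner ℝ (scalarMul Plane K hK (steklov g h t)) (mulOp _ hd (diffQuot u h t))) t := by
  have hp := hasDerivAt_diffQuot hu.hasDerivAt h t
  have hq := hasDerivAt_steklov hu.continuous_grad h t
  have h1 := ((hasDerivAt_inner_scalarMul_self hζ hp).add
    (hasDerivAt_inner_scalarMul_self (hζ.mul hK) hq)).const_mul (1 / 2)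
  have e : (fun t => weightedEnergy K ζ (diffQuot u h t) (steklov g h t)) = fun t => (1 / 2) *
      (inner ℝ (scalarMul ℝ ζ hζ (diffQuot u h t)) (diffQuot u h t) +
        inner ℝ (scalarMul Plane _ (hζ.mul hK) (steklov g h t)) (steklov g h t)) := by
    ext t; exact weightedEnergy_eq hK hζ _ _
  rw [e]
  refine h1.congr_deriv ?_
  have hw : HasWeakGradient (diffQuot u h t) (diffQuot g h t) :=
    ((hu.hasWeakGradient (t + h) (by linarith)).sub (hu.hasWeakGradient t ht)).smul _
  have h2 := hu.weak t (t + h) ht (by linarith) _ _ (hw.smooth_mul hζs hζ hd)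
  have h3 : inner ℝ (diffQuot ut h t) (scalarMul ℝ ζ hζ (diffQuot u h t)) =
      - inner ℝ (scalarMul Plane K hK (steklov g h t)) (scalarMul Plane ζ hζ (diffQuot g h t) +
        mulOp _ hd (diffQuot u h t)) := by
    have e : scalarMul Plane K hK (steklov g h t) =
      h⁻¹ • scalarMul Plane K hK (∫ r in t..(t + h), g r) := map_smul _ _ _
    have e' : inner ℝ (diffQuot ut h t) (scalarMul ℝ ζ hζ (diffQuot u h t)) =
      h⁻¹ * inner ℝ (ut (t + h) - ut t) (scalarMul ℝ ζ hζ (diffQuot u h t)) := by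
      conv_lhs => rw [diffQuot]
      rw [inner_smul_left]; rfl
    rw [e', e, inner_smul_left, h2]
    simp only [conj_trivial]; ring
  have h4 : inner ℝ (scalarMul Plane _ (hζ.mul hK) (steklov g h t)) (diffQuot g h t) =
      inner ℝ (scalarMul Plane K hK (steklov g h t)) (scalarMul Plane ζ hζ (diffQuot g h t)) := by
    rw [← inner_scalarMul_comm, inner_scalarMul, inner_scalarMul]
    refine integral_congr_ae ?_
    filter_upwards [coeFn_scalarMul K hK (steklov g h t)] with x hx
    rw [hx, inner_smul_left]
    simp only [conj_trivial]; ring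
  rw [inner_add_right] at h3
  rw [h4, real_inner_comm (diffQuot ut h t), h3]
  ring

/-- Weighted energy estimate: if `√K |∇ζ| ≤ c ζ`, the energy with weight `ζ` grows at most
like `exp (c t)`. -/
theorem IsExtendedSolution.weightedEnergy_le {K : Plane → ℝ} {hK : IsBoundedMeas K}
    {u ut : ℝ → PlaneL2} {g : ℝ → PlaneVecL2} (hu : IsExtendedSolution K hK u ut g)
    (hK0 : ∀ x, 0 ≤ K x) {ζ : Plane → ℝ} (hζs : ContDiff ℝ ∞ ζ) (hζ : IsBoundedMeas ζ)
    (hd : IsBoundedField (fun x => ContinuousLinearMap.toSpanSingleton ℝ (gradient ζ x)))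
    {c : ℝ} (hc : ∀ x, √(K x) * ‖gradient ζ x‖ ≤ c * ζ x) {s t : ℝ} (hs : 0 ≤ s) (hst : s ≤ t) :
    weightedEnergy K ζ (ut t) (g t) ≤ Real.exp (c * (t - s)) * weightedEnergy K ζ (ut s) (g s) := by
  have hlim : ∀ t, Tendsto (fun h => weightedEnergy K ζ (diffQuot u h t) (steklov g h t)) (𝓝[>] 0)
      (𝓝 (weightedEnergy K ζ (ut t) (g t))) := by
    intro t
    have h1 : Tendsto (fun h => diffQuot u h t) (𝓝[>] 0) (𝓝 (ut t)) :=
      (hu.hasDerivAt t).tendsto_slope_zero_right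
    exact tendsto_weightedEnergy hK hζ h1 (tendsto_steklov hu.continuous_grad t)
  refine le_of_tendsto_of_tendsto (hlim t) ((hlim s).const_mul _) ?_
  filter_upwards [self_mem_nhdsWithin] with h hh
  refine le_exp_mul_of_hasDerivAt_le
    (f := fun t => weightedEnergy K ζ (diffQuot u h t) (steklov g h t)) (fun r hr => ?_) hs hst
  exact ⟨_, hu.hasDerivAt_weightedEnergy hζs hζ hd hh hr,
    weightedEnergy_flux_le hK hζ hK0 hd hc _ _⟩

/-! ### Finite speed of propagation and monotonicity of the energy. -/

/-- Lipschitz functions have smooth Lipschitz approximations that agree with them at centres of unit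
balls of constancy. -/
theorem LipschitzWith.exists_contDiff_approx {f₀ : Plane → ℝ} (hf : LipschitzWith 1 f₀) :
    ∃ f : Plane → ℝ, ContDiff ℝ ∞ f ∧ LipschitzWith 1 f ∧ (∀ x, |f x - f₀ x| ≤ 1) ∧
      ∀ x, (∀ y ∈ Metric.ball x 1, f₀ y = f₀ x) → f x = f₀ x := by
  let φ : ContDiffBump (0 : Plane) := ⟨1 / 2, 1, by norm_num, by norm_num⟩
  have hloc : LocallyIntegrable f₀ (volume : Measure Plane) := hf.continuous.locallyIntegrable
  have hex : ConvolutionExists (φ.normed volume) f₀ (ContinuousLinearMap.lsmul ℝ ℝ) volume :=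
    φ.hasCompactSupport_normed.convolutionExists_left _ φ.continuous_normed hloc
  have hdist : ∀ x y, |f₀ x - f₀ y| ≤ ‖x - y‖ := fun x y => by
    have := hf.dist_le_mul x y
    rwa [NNReal.coe_one, one_mul, Real.dist_eq, dist_eq_norm] at this
  refine ⟨φ.normed volume ⋆[ContinuousLinearMap.lsmul ℝ ℝ, volume] f₀,
    φ.hasCompactSupport_normed.contDiff_convolution_left _ φ.contDiff_normed hloc, ?_, ?_, ?_⟩
  · refine LipschitzWith.of_dist_le_mul fun x y => ?_
    rw [NNReal.coe_one, one_mul, dist_eq_norm, convolution, convolution, ← integral_sub (hex x) (hex y)]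
    calc _ ≤ ∫ z, φ.normed volume z * dist x y := by
          refine norm_integral_le_of_norm_le (φ.integrable_normed.mul_const _)
            (Eventually.of_forall fun z => ?_)
          simp only [ContinuousLinearMap.lsmul_apply, smul_eq_mul]
          rw [← mul_sub, norm_mul, Real.norm_of_nonneg (φ.nonneg_normed z), dist_eq_norm]
          refine mul_le_mul_of_nonneg_left ?_ (φ.nonneg_normed z)
          have := hdist (x - z) (y - z)
          rwa [sub_sub_sub_cancel_right] at this
      _ = _ := by rw [integral_mul_const, φ.integral_normed, one_mul]
  · intro x
    refine φ.dist_normed_convolution_le hf.continuous.aestronglyMeasurable fun y hy => ?_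
    have h1 := hdist y x
    rw [mem_ball_iff_norm] at hy
    exact h1.trans hy.le
  · intro x hx
    exact φ.normed_convolution_eq_right hx

theorem gradient_exp_mul {f : Plane → ℝ} (hf : Differentiable ℝ f) (l : ℝ) (x : Plane) :
    gradient (fun x => Real.exp (l * f x)) x = (l * Real.exp (l * f x)) • gradient f x := by
  refine ext_inner_right ℝ fun v => ?_
  rw [inner_gradient, inner_smul_left, inner_gradient]
  have h3 : fderiv ℝ (fun x => Real.exp (l * f x)) x = _ := (((hf x).hasFDerivAt).const_mul l).exp.fderiv
  rw [h3]; simp; ring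

theorem norm_gradient_le_of_lipschitz {f : Plane → ℝ} (hf : LipschitzWith 1 f) (x : Plane) :
    ‖gradient f x‖ ≤ 1 := by
  rw [gradient, LinearIsometryEquiv.norm_map]
  exact_mod_cast norm_fderiv_le_of_lipschitz ℝ hf (x₀ := x)

/-- Finite speed of propagation: if `K = k₀` outside the ball of radius `r₀`, waves propagate with
speed at most `√k₀` outside a fixed ball. -/
theorem IsExtendedSolution.finite_speed {K : Plane → ℝ} {hK : IsBoundedMeas K}
    {u ut : ℝ → PlaneL2} {g : ℝ → PlaneVecL2} (hu : IsExtendedSolution K hK u ut g)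
    (hK0 : ∀ x, 0 < K x) {k₀ r₀ L : ℝ} (hr₀ : 0 < r₀) (hK3 : ∀ x, r₀ < ‖x‖ → K x = k₀)
    (hut : ∀ᵐ x, L < ‖x‖ → ut 0 x = 0) (hg : ∀ᵐ x, L < ‖x‖ → g 0 x = 0) {t : ℝ} (ht : 0 ≤ t) :
    ∀ᵐ x, √k₀ * t + (max L r₀ + 4) < ‖x‖ → ut t x = 0 ∧ g t x = 0 := by
  -- The exponent of the weight is a smoothing of `|x|` truncated below at `r` and above at `N`. It
  -- is constant for `|x| < r - 1`, a ball containing the data and all points where `K` may differ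
  -- from `k₀`, so the size of `K` there plays no role. The cap `N` keeps the weight bounded.
  set r := max L r₀ + 2 with hr
  set N := √k₀ * t + (max L r₀ + 4) with hN
  have hrN : r ≤ N := by have := mul_nonneg (Real.sqrt_nonneg k₀) ht; linarith
  have hrpos : 0 < r := by have := le_max_right L r₀; linarith
  have hlip : LipschitzWith 1 (fun x : Plane => min (max ‖x‖ r) N) :=
    (lipschitzWith_one_norm.max_const r).min_const N
  obtain ⟨f, hfs, hfl, hfa, hfe⟩ := hlip.exists_contDiff_approx
  have hconst : ∀ x : Plane, ‖x‖ < r - 1 → f x = r := by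
    intro x hx
    have hval : ∀ y ∈ Metric.ball x 1, min (max ‖y‖ r) N = r := by
      intro y hy
      rw [mem_ball_iff_norm] at hy
      have : ‖y‖ ≤ r := by
        have := norm_sub_norm_le y x; linarith
      rw [max_eq_right this, min_eq_left hrN]
    have hx' := hval x (Metric.mem_ball_self one_pos)
    rw [hfe x fun y hy => by rw [hval y hy, hx'], hx']
  have hgrad : ∀ x : Plane, ‖x‖ < r - 1 → gradient f x = 0 := by
    intro x hx
    have : f =ᶠ[𝓝 x] fun _ => r := by
      have := (isOpen_lt continuous_norm continuous_const).mem_nhds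
        (show x ∈ {y : Plane | ‖y‖ < r - 1} from hx)
      filter_upwards [this] with y hy using hconst y hy
    rw [gradient, this.fderiv_eq]; simp
  have hfN : ∀ x, f x ≤ N + 1 := fun x => by
    have h1 := (abs_le.1 (hfa x)).2
    have h2 : min (max ‖x‖ r) N ≤ N := min_le_right _ _
    linarith
  have hfd : Differentiable ℝ f := hfs.differentiable (by simp)
  set E₀ := weightedEnergy K (fun _ => 1) (ut 0) (g 0) with hE₀
  have hone : IsBoundedMeas (fun _ : Plane => (1:ℝ)) :=
    continuous_const.isBoundedMeas (C := 1) (by simp)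
  have hind : IsBoundedMeas ({x : Plane | N < ‖x‖}.indicator fun _ => (1:ℝ)) := by
    refine ⟨(aestronglyMeasurable_const.indicator
      (isOpen_lt continuous_const continuous_norm).measurableSet), 1, fun x => ?_⟩
    by_cases hx : x ∈ {x : Plane | N < ‖x‖} <;> simp [hx]
  have hnn : ∀ (p : PlaneL2) (q : PlaneVecL2) x, 0 ≤ p x ^ 2 + K x * ‖q x‖ ^ 2 := fun p q x => by
    have := (hK0 x).le; positivity
  -- The weight `exp (l f)` gives initial energy `exp (l r) E₀` and growth at most `exp (l √k₀ t)`,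
  -- while it is at least `exp (l (N - 1))` beyond `N`, smoothing having moved the profile by at
  -- most `1`. Since `N = √k₀ t + r + 2`, exactly `exp (-l)` is left, and `l → ∞` finishes.
  have key : ∀ l : ℝ, 0 < l → weightedEnergy K ({x : Plane | N < ‖x‖}.indicator fun _ => (1:ℝ))
      (ut t) (g t) ≤ Real.exp (-l) * E₀ := by
    intro l hl
    have hζs : ContDiff ℝ ∞ (fun x => Real.exp (l * f x)) := (contDiff_const.mul hfs).exp
    have hζ : IsBoundedMeas (fun x => Real.exp (l * f x)) := by
      refine hζs.continuous.isBoundedMeas (C := Real.exp (l * (N + 1))) fun x => ?_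
      rw [abs_of_pos (Real.exp_pos _)]
      gcongr; exact hfN x
    have hgn : ∀ x, ‖gradient (fun x => Real.exp (l * f x)) x‖ ≤ l * Real.exp (l * f x) := by
      intro x
      rw [gradient_exp_mul hfd, norm_smul, Real.norm_of_nonneg (by positivity)]
      exact mul_le_of_le_one_right (by positivity) (norm_gradient_le_of_lipschitz hfl x)
    have hd := isBoundedField_toSpanSingleton (Z := gradient (fun x => Real.exp (l * f x)))
      (C := l * Real.exp (l * (N + 1))) (continuous_gradient (hζs.of_le (by norm_cast)))
      fun x => (hgn x).trans (by gcongr; exact hfN x)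
    have hc : ∀ x, √(K x) * ‖gradient (fun x => Real.exp (l * f x)) x‖ ≤
        (l * √k₀) * Real.exp (l * f x) := by
      intro x
      by_cases hx : ‖x‖ < r - 1
      · rw [gradient_exp_mul hfd, hgrad x hx]
        simp only [smul_zero, norm_zero, mul_zero]; positivity
      · have : r₀ < ‖x‖ := by have := le_max_right L r₀; linarith
        rw [hK3 x this]
        calc _ ≤ √k₀ * (l * Real.exp (l * f x)) := by gcongr; exact hgn x
          _ = _ := by ring
    have h1 := hu.weightedEnergy_le (fun x => (hK0 x).le) hζs hζ hd hc le_rfl ht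
    have h2 : weightedEnergy K (fun x => Real.exp (l * f x)) (ut 0) (g 0) = Real.exp (l * r) * E₀ := by
      rw [hE₀, weightedEnergy, weightedEnergy, mul_left_comm,
        ← integral_const_mul (Real.exp (l * r))]
      congr 1
      refine integral_congr_ae ?_
      filter_upwards [hut, hg] with x h1 h2
      by_cases hx : L < ‖x‖
      · rw [h1 hx, h2 hx]; simp
      · rw [hconst x (by have := le_max_left L r₀; linarith)]; ring
    have h3 : Real.exp (l * (N - 1)) * weightedEnergy K
        ({x : Plane | N < ‖x‖}.indicator fun _ => (1:ℝ)) (ut t) (g t) ≤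
        weightedEnergy K (fun x => Real.exp (l * f x)) (ut t) (g t) := by
      rw [weightedEnergy, weightedEnergy, mul_left_comm,
        ← integral_const_mul (Real.exp (l * (N - 1)))]
      refine mul_le_mul_of_nonneg_left ?_ (by norm_num)
      refine integral_mono ((integrable_weighted hK hind _ _).const_mul _)
        (integrable_weighted hK hζ _ _) fun x => ?_
      simp only
      rw [← mul_assoc]
      refine mul_le_mul_of_nonneg_right ?_ (hnn _ _ x)
      by_cases hx : N < ‖x‖
      · have hx' : x ∈ {x : Plane | N < ‖x‖} := hx
        rw [Set.indicator_of_mem hx', mul_one]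
        gcongr
        have h1 := (abs_le.1 (hfa x)).1
        have h2 : min (max ‖x‖ r) N = N := min_eq_right (hx.le.trans (le_max_left _ _))
        linarith
      · have hx' : x ∉ {x : Plane | N < ‖x‖} := hx
        rw [Set.indicator_of_notMem hx', mul_zero]
        positivity
    rw [h2, ← mul_assoc, ← Real.exp_add] at h1
    have h4 := mul_le_mul_of_nonneg_left (h3.trans h1) (Real.exp_pos (-(l * (N - 1)))).le
    rw [← mul_assoc, ← mul_assoc, ← Real.exp_add, ← Real.exp_add, neg_add_cancel, Real.exp_zero,
      one_mul] at h4
    refine h4.trans (le_of_eq ?_)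
    congr 2
    rw [hN, hr]; ring
  have hle : weightedEnergy K ({x : Plane | N < ‖x‖}.indicator fun _ => (1:ℝ)) (ut t) (g t) ≤ 0 := by
    have hlim : Tendsto (fun l : ℝ => Real.exp (-l) * E₀) atTop (𝓝 (0 * E₀)) :=
      Real.tendsto_exp_neg_atTop_nhds_zero.mul_const _
    rw [zero_mul] at hlim
    refine ge_of_tendsto hlim ?_
    filter_upwards [eventually_gt_atTop 0] with l hl using key l hl
  have hinn : 0 ≤ fun x => ({x : Plane | N < ‖x‖}.indicator fun _ => (1:ℝ)) x *
      (ut t x ^ 2 + K x * ‖g t x‖ ^ 2) := fun x =>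
    mul_nonneg (Set.indicator_nonneg (fun _ _ => zero_le_one) x) (hnn _ _ x)
  have hzero : ∫ x, ({x : Plane | N < ‖x‖}.indicator fun _ => (1:ℝ)) x *
      (ut t x ^ 2 + K x * ‖g t x‖ ^ 2) = 0 := by
    have h1 := integral_nonneg (μ := (volume : Measure Plane)) hinn
    rw [weightedEnergy] at hle
    linarith
  rw [integral_eq_zero_iff_of_nonneg hinn (integrable_weighted hK hind _ _)] at hzero
  filter_upwards [hzero] with x hx hxN
  have hx' : x ∈ {x : Plane | N < ‖x‖} := hxN
  rw [Set.indicator_of_mem hx', one_mul, Pi.zero_apply] at hx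
  have h1 : 0 ≤ ut t x ^ 2 := sq_nonneg _
  have h2 : 0 ≤ K x * ‖g t x‖ ^ 2 := by have := (hK0 x).le; positivity
  have h3 : ut t x ^ 2 = 0 := by linarith
  have h4 : K x * ‖g t x‖ ^ 2 = 0 := by linarith
  refine ⟨by simpa using h3, ?_⟩
  have := (mul_eq_zero.1 h4).resolve_left (hK0 x).ne'
  simpa using this

/-- The energy does not increase. -/
theorem IsExtendedSolution.energy_antitone {K : Plane → ℝ} {hK : IsBoundedMeas K}
    {u ut : ℝ → PlaneL2} {g : ℝ → PlaneVecL2} (hu : IsExtendedSolution K hK u ut g)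
    (hK0 : ∀ x, 0 ≤ K x) {s t : ℝ} (hs : 0 ≤ s) (hst : s ≤ t) :
    weightedEnergy K (fun _ => 1) (ut t) (g t) ≤ weightedEnergy K (fun _ => 1) (ut s) (g s) := by
  have hg : gradient (fun _ : Plane => (1:ℝ)) = fun _ => 0 := by
    ext1 x; simp [gradient]
  have hd := isBoundedField_toSpanSingleton (Z := gradient (fun _ : Plane => (1:ℝ))) (C := 0)
    (by rw [hg]; exact continuous_const) (by simp [hg])
  have := hu.weightedEnergy_le hK0 contDiff_const
    (continuous_const.isBoundedMeas (C := 1) (by simp)) hd (c := 0) (by simp [hg]) hs hst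
  simpa using this

/-- Vanishing on a set is expressed as the kernel of a bounded operator, so that it passes through
integrals of `L²`-valued curves. -/
theorem exists_clm_eq_zero_iff {E : Type*} [NormedAddCommGroup E] [InnerProductSpace ℝ E]
    {s : Set Plane} (hs : MeasurableSet s) :
    ∃ P : Lp E 2 (volume : Measure Plane) →L[ℝ] Lp E 2 (volume : Measure Plane),
      ∀ f, P f = 0 ↔ ∀ᵐ x, x ∈ s → f x = 0 := by
  have hind : IsBoundedMeas (s.indicator fun _ => (1:ℝ)) := by
    refine ⟨aestronglyMeasurable_const.indicator hs, 1, fun x => ?_⟩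
    by_cases hx : x ∈ s <;> simp [hx]
  refine ⟨scalarMul E _ hind, fun f => ?_⟩
  rw [Lp.eq_zero_iff_ae_eq_zero]
  constructor
  · intro h
    filter_upwards [h, coeFn_scalarMul _ hind f] with x h1 h2 hx
    rw [h2, Set.indicator_of_mem hx, one_smul] at h1
    exact h1
  · intro h
    filter_upwards [h, coeFn_scalarMul _ hind f] with x h1 h2
    rw [h2]
    by_cases hx : x ∈ s
    · rw [h1 hx, smul_zero]; rfl
    · rw [Set.indicator_of_notMem hx, zero_smul]; rfl

theorem ae_zero_intervalIntegral {E : Type*} [NormedAddCommGroup E] [InnerProductSpace ℝ E]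
    [CompleteSpace E] {s : Set Plane} (hs : MeasurableSet s)
    {F : ℝ → Lp E 2 (volume : Measure Plane)} (hF : Continuous F) {a b : ℝ} (hab : a ≤ b)
    (h : ∀ t ∈ Set.Icc a b, ∀ᵐ x, x ∈ s → F t x = 0) :
    ∀ᵐ x, x ∈ s → (∫ t in a..b, F t) x = 0 := by
  obtain ⟨P, hP⟩ := exists_clm_eq_zero_iff (E := E) hs
  rw [← hP, ← ContinuousLinearMap.intervalIntegral_comp_comm P (hF.intervalIntegrable a b)]
  rw [intervalIntegral.integral_congr (g := fun _ => 0)]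
  · simp
  · intro t ht
    rw [Set.uIcc_of_le hab] at ht
    exact (hP _).2 (h t ht)

/-- Support of the solution itself. -/
theorem IsExtendedSolution.support {K : Plane → ℝ} {hK : IsBoundedMeas K}
    {u ut : ℝ → PlaneL2} {g : ℝ → PlaneVecL2} (hu : IsExtendedSolution K hK u ut g)
    (hK0 : ∀ x, 0 < K x) {k₀ r₀ L : ℝ} (hr₀ : 0 < r₀) (hK3 : ∀ x, r₀ < ‖x‖ → K x = k₀)
    (hu0 : ∀ᵐ x, L < ‖x‖ → u 0 x = 0)
    (hut : ∀ᵐ x, L < ‖x‖ → ut 0 x = 0) (hg : ∀ᵐ x, L < ‖x‖ → g 0 x = 0) {t : ℝ} (ht : 0 ≤ t) :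
    ∀ᵐ x, √k₀ * t + (max L r₀ + 4) < ‖x‖ → u t x = 0 := by
  have hms : MeasurableSet {x : Plane | √k₀ * t + (max L r₀ + 4) < ‖x‖} :=
    (isOpen_lt continuous_const continuous_norm).measurableSet
  have h1 : u t = u 0 + ∫ s in (0:ℝ)..t, ut s := by
    rw [intervalIntegral.integral_eq_sub_of_hasDerivAt (fun s _ => hu.hasDerivAt s)
      (hu.continuous_deriv.intervalIntegrable 0 t)]
    abel
  have h2 : ∀ᵐ x, x ∈ {x : Plane | √k₀ * t + (max L r₀ + 4) < ‖x‖} →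
      (∫ s in (0:ℝ)..t, ut s) x = 0 := by
    refine ae_zero_intervalIntegral hms hu.continuous_deriv ht fun s hs => ?_
    filter_upwards [hu.finite_speed hK0 hr₀ hK3 hut hg hs.1] with x hx hxs
    refine (hx (lt_of_le_of_lt ?_ hxs)).1
    gcongr; exact hs.2
  filter_upwards [hu0, h2, Lp.coeFn_add (u 0) (∫ s in (0:ℝ)..t, ut s)] with x h3 h4 h5 hx
  rw [h1, h5, Pi.add_apply, h4 hx, h3, add_zero]
  have := mul_nonneg (Real.sqrt_nonneg k₀) ht
  have := le_max_left L r₀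
  linarith

/-! ### The logarithmic Hardy inequality and the `L²` norm of the solution. -/

/-- Pohozaev type identity for the radial field `Z = a x` and a Sobolev function:
`∫ f² div Z = - 2 ∫ f ∇f · Z`. -/
theorem HasWeakGradient.inner_div_eq {f : PlaneL2} {g : PlaneVecL2} (h : HasWeakGradient f g)
    {a : Plane → ℝ} (ha : ContDiff ℝ ∞ a)
    (hb : IsBoundedMeas (fun x => 2 * a x + fderiv ℝ a x x))
    (hZ : IsBoundedField (fun x => ContinuousLinearMap.toSpanSingleton ℝ (a x • x))) :
    inner ℝ (scalarMul ℝ _ hb f) f = - 2 * inner ℝ (mulOp _ hZ f) g := by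
  -- The quadratic identity is polarised: one copy of the function and gradient stays fixed, the
  -- other ranges over the closure of test functions. The condition is then closed and linear, and
  -- evaluating it at the pair itself yields the factor `2`.
  have hcl : IsClosed {p : PlaneL2 × PlaneVecL2 | inner ℝ (scalarMul ℝ _ hb f) p.1 +
      inner ℝ (mulOp _ hZ f) p.2 + inner ℝ g (mulOp _ hZ p.1) = 0} :=
    isClosed_eq (by fun_prop) (by fun_prop)
  have key : (f, g) ∈ {p : PlaneL2 × PlaneVecL2 | inner ℝ (scalarMul ℝ _ hb f) p.1 +
      inner ℝ (mulOp _ hZ f) p.2 + inner ℝ g (mulOp _ hZ p.1) = 0} := by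
    refine (closure_minimal ?_ hcl) h.mem_closure
    rintro _ ⟨φ, hφ, rfl⟩
    simp only [Set.mem_ofPred_eq]
    have e := h.integral_euler (hφ.smooth_mul ha)
    have hfd : ∀ x, fderiv ℝ (fun x => a x * φ x) x x = a x * fderiv ℝ φ x x + φ x * fderiv ℝ a x x := by
      intro x
      have h1 : DifferentiableAt ℝ a x := ha.differentiable (by simp) x
      have h2 : DifferentiableAt ℝ φ x := hφ.1.differentiable (by simp) x
      rw [fderiv_fun_mul h1 h2]; simp
    have e1 : inner ℝ (scalarMul ℝ _ hb f) hφ.toL2 + inner ℝ (mulOp _ hZ f) hφ.gradL2 =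
        ∫ x, f x * (2 * (a x * φ x) + fderiv ℝ (fun x => a x * φ x) x x) := by
      rw [L2.inner_def, L2.inner_def, ← integral_add (L2.integrable_inner _ _)
        (L2.integrable_inner _ _)]
      refine integral_congr_ae ?_
      filter_upwards [coeFn_scalarMul _ hb f, coeFn_mulOp _ hZ f, hφ.coeFn_toL2, hφ.coeFn_gradL2]
        with x h1 h2 h3 h4
      have h5 : inner ℝ x (gradient φ x) = fderiv ℝ φ x x := by
        rw [real_inner_comm, inner_gradient]
      rw [h1, h2, h3, h4, hfd, ContinuousLinearMap.toSpanSingleton_apply, inner_smul_left,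
        inner_smul_left, inner_smul_left, h5]
      simp only [conj_trivial, RCLike.inner_apply]
      ring
    have e2 : inner ℝ g (mulOp _ hZ hφ.toL2) = ∫ x, inner ℝ (g x) x * (a x * φ x) := by
      rw [L2.inner_def]
      refine integral_congr_ae ?_
      filter_upwards [coeFn_mulOp _ hZ hφ.toL2, hφ.coeFn_toL2] with x h1 h2
      rw [h1, h2, ContinuousLinearMap.toSpanSingleton_apply, inner_smul_right, inner_smul_right]
      ring
    rw [e1, e2, e]; ring
  simp only [Set.mem_ofPred_eq] at key
  rw [real_inner_comm (mulOp _ hZ f) g] at key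
  linarith

/-- A two-dimensional Hardy inequality with logarithmic constant for functions supported in
`1 + |x|² ≤ exp Λ`. -/
theorem HasWeakGradient.hardy {v : PlaneL2} {G : PlaneVecL2} (h : HasWeakGradient v G)
    {Λ : ℝ} (hΛ : 2 ≤ Λ) (hv : ∀ᵐ x, Real.exp Λ < 1 + ‖x‖ ^ 2 → v x = 0) :
    ∫ x, ((1 + ‖x‖ ^ 2) ^ 2)⁻¹ * v x ^ 2 ≤ Real.exp 1 * Λ * ‖G‖ ^ 2 := by
  -- The field is `Z = α s^(α - 1) x` with `s = 1 + |x|²`, and `b` below is its divergence. The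
  -- exponent `1 / Λ` balances two demands: `s^α ≤ e` on the support of `v`, and `s⁻² ≤ (Λ / 2) b`,
  -- which produces the factor `Λ`.
  set α := Λ⁻¹ with hα
  have hΛ0 : 0 < Λ := by linarith
  have hα0 : 0 < α := inv_pos.2 hΛ0
  have hα2 : α ≤ 1 / 2 := by rw [hα, inv_le_comm₀ hΛ0 (by norm_num)]; linarith
  let s : Plane → ℝ := fun x => 1 + ‖x‖ ^ 2
  have hs1 : ∀ x, 1 ≤ s x := fun x => by simp only [s]; nlinarith [sq_nonneg ‖x‖]
  have hs0 : ∀ x, 0 < s x := fun x => one_pos.trans_le (hs1 x)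
  have hsd : ContDiff ℝ ∞ s := contDiff_const.add (contDiff_norm_sq ℝ)
  let a : Plane → ℝ := fun x => α * s x ^ (α - 1)
  have ha : ContDiff ℝ ∞ a :=
    contDiff_const.mul (hsd.rpow_const_of_ne fun x => (hs0 x).ne')
  let b : Plane → ℝ := fun x => 2 * α * s x ^ (α - 2) * (1 + α * ‖x‖ ^ 2)
  have hpow : ∀ x, s x ^ (α - 1) = s x ^ (α - 2) * s x := fun x => by
    rw [← Real.rpow_add_one (hs0 x).ne']; congr 1; ring
  have hba : ∀ x, 2 * a x + fderiv ℝ a x x = b x := by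
    intro x
    have h1 : HasFDerivAt s (2 • innerSL ℝ x) x :=
      (hasStrictFDerivAt_norm_sq x).hasFDerivAt.const_add 1
    have h2 := (h1.rpow_const (p := α - 1) (Or.inl (hs0 x).ne')).const_mul α
    have h3 : fderiv ℝ a x = _ := h2.fderiv
    rw [h3]
    have e : α - 1 - 1 = α - 2 := by ring
    simp only [a, b, hpow, e, smul_apply, smul_eq_mul, innerSL_apply_apply,
      real_inner_self_eq_norm_sq, nsmul_eq_mul, s]
    push_cast
    ring
  have hcb : Continuous b := by
    have : (fun x => 2 * a x + fderiv ℝ a x x) = b := funext hba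
    rw [← this]
    exact (continuous_const.mul ha.continuous).add
      ((ha.continuous_fderiv (by simp)).clm_apply continuous_id)
  have hb0 : ∀ x, 0 ≤ b x := fun x => by
    have := (hs0 x).le; simp only [b]; positivity
  have hle1 : ∀ x, s x ^ (α - 1) ≤ 1 := fun x =>
    Real.rpow_le_one_of_one_le_of_nonpos (hs1 x) (by linarith)
  have hb1 : ∀ x, |b x| ≤ 1 := by
    intro x
    rw [abs_of_nonneg (hb0 x)]
    have h1 : 1 + α * ‖x‖ ^ 2 ≤ s x := by simp only [s]; nlinarith [sq_nonneg ‖x‖]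
    have h2 : 0 ≤ s x ^ (α - 2) := Real.rpow_nonneg (hs0 x).le _
    calc b x ≤ 2 * α * s x ^ (α - 2) * s x := by simp only [b]; gcongr
      _ = 2 * α * s x ^ (α - 1) := by rw [hpow]; ring
      _ ≤ 2 * α * 1 := by gcongr; exact hle1 x
      _ ≤ 1 := by linarith
  have hb : IsBoundedMeas b := hcb.isBoundedMeas hb1
  have hb' : IsBoundedMeas (fun x => 2 * a x + fderiv ℝ a x x) := by
    have : (fun x => 2 * a x + fderiv ℝ a x x) = b := funext hba
    rw [this]; exact hb
  have hZsq : ∀ x, ‖a x • x‖ ^ 2 ≤ s x ^ α * (b x / 2) := by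
    intro x
    rw [norm_smul, mul_pow, Real.norm_eq_abs, sq_abs]
    have h1 : s x ^ α * s x ^ (α - 2) = (s x ^ (α - 1)) ^ 2 := by
      rw [← Real.rpow_add (hs0 x), ← Real.rpow_natCast, ← Real.rpow_mul (hs0 x).le]
      congr 1; push_cast; ring
    calc a x ^ 2 * ‖x‖ ^ 2 = (s x ^ (α - 1)) ^ 2 * (α * (α * ‖x‖ ^ 2)) := by simp only [a]; ring
      _ ≤ (s x ^ (α - 1)) ^ 2 * (α * (1 + α * ‖x‖ ^ 2)) := by gcongr; linarith
      _ = s x ^ α * (b x / 2) := by rw [← h1]; simp only [b]; ring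
  have hZb : ∀ x, ‖a x • x‖ ≤ 1 := by
    intro x
    rw [norm_smul, Real.norm_of_nonneg (by have := (hs0 x).le; simp only [a]; positivity)]
    have h1 : ‖x‖ ≤ s x ^ (1 / 2 : ℝ) := by
      rw [← Real.sqrt_eq_rpow]
      exact Real.le_sqrt_of_sq_le (by simp only [s]; linarith)
    calc a x * ‖x‖ ≤ a x * s x ^ (1 / 2 : ℝ) := by
          have : 0 ≤ a x := by have := (hs0 x).le; simp only [a]; positivity
          gcongr
      _ = α * s x ^ (α - 1 / 2) := by
          simp only [a]; rw [mul_assoc, ← Real.rpow_add (hs0 x)]; congr 2; ring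
      _ ≤ α * 1 := by
          gcongr
          exact Real.rpow_le_one_of_one_le_of_nonpos (hs1 x) (by linarith)
      _ ≤ 1 := by linarith
  have hZ : IsBoundedField (fun x => ContinuousLinearMap.toSpanSingleton ℝ (a x • x)) :=
    isBoundedField_toSpanSingleton (ha.continuous.smul continuous_id) hZb
  have key := h.inner_div_eq ha hb' hZ
  set I := ∫ x, b x * v x ^ 2 with hI
  have hIeq : inner ℝ (scalarMul ℝ _ hb' v) v = I := by
    rw [inner_scalarMul]
    refine integral_congr_ae (Eventually.of_forall fun x => ?_)
    simp only
    rw [hba, real_inner_self_eq_norm_sq, Real.norm_eq_abs, sq_abs]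
  have hint : Integrable (fun x => b x * v x ^ 2) := by
    refine (integrable_mul_inner hb v v).congr (Eventually.of_forall fun x => ?_)
    simp only [real_inner_self_eq_norm_sq, Real.norm_eq_abs, sq_abs]
  -- Young's inequality with weight `e`, together with `|Z|² ≤ e b / 2` on the support of `v`,
  -- leaves only half of `I` on the right, to be absorbed.
  have hbound : -2 * inner ℝ (mulOp _ hZ v) G ≤ I / 2 + Real.exp 1 * ‖G‖ ^ 2 := by
    rw [norm_sq_eq_integral, L2.inner_def, ← integral_const_mul, ← integral_const_mul, hI,
      ← integral_div, ← integral_add (hint.div_const _) ((integrable_norm_sq G).const_mul _)]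
    refine integral_mono_ae ((L2.integrable_inner _ _).const_mul _)
      ((hint.div_const _).add ((integrable_norm_sq G).const_mul _)) ?_
    filter_upwards [coeFn_mulOp _ hZ v, hv] with x h1 h2
    rw [h1, ContinuousLinearMap.toSpanSingleton_apply, inner_smul_left]
    simp only [conj_trivial]
    by_cases hx : Real.exp Λ < 1 + ‖x‖ ^ 2
    · rw [h2 hx]; simp only [zero_mul, mul_zero]
      have := Real.exp_pos 1
      norm_num; positivity
    · have h3 : s x ^ α ≤ Real.exp 1 := by
        have : s x ^ α ≤ (Real.exp Λ) ^ α := Real.rpow_le_rpow (hs0 x).le (not_lt.1 hx) hα0.le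
        rwa [← Real.exp_mul, hα, mul_inv_cancel₀ hΛ0.ne'] at this
      have h4 : ‖a x • x‖ ^ 2 ≤ Real.exp 1 * (b x / 2) :=
        (hZsq x).trans (by have := hb0 x; gcongr)
      have h5 := abs_real_inner_le_norm (a x • x) (G x)
      have h6 : -2 * (v x * inner ℝ (a x • x) (G x)) ≤ 2 * (|v x| * (‖a x • x‖ * ‖G x‖)) := by
        have : -(v x * inner ℝ (a x • x) (G x)) ≤ |v x| * (‖a x • x‖ * ‖G x‖) := by
          refine (neg_le_abs _).trans ?_
          rw [abs_mul]; gcongr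
        linarith
      have he := Real.exp_pos 1
      set ee := Real.exp 1
      set z := ‖a x • x‖
      have h7 : 2 * (|v x| * (z * ‖G x‖)) ≤ v x ^ 2 * z ^ 2 / ee + ee * ‖G x‖ ^ 2 := by
        have h8 : 0 ≤ (|v x| * z - ee * ‖G x‖) ^ 2 / ee := by positivity
        have h9 : (|v x| * z - ee * ‖G x‖) ^ 2 / ee =
          v x ^ 2 * z ^ 2 / ee + ee * ‖G x‖ ^ 2 - 2 * (|v x| * (z * ‖G x‖)) := by
          field_simp
          rw [sub_sq, mul_pow, sq_abs]; ring
        linarith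
      have h10 : v x ^ 2 * z ^ 2 / ee ≤ b x * v x ^ 2 / 2 := by
        rw [div_le_iff₀ he]
        calc v x ^ 2 * z ^ 2 ≤ v x ^ 2 * (ee * (b x / 2)) := by gcongr
          _ = _ := by ring
      linarith
  rw [hIeq] at key
  have hI2 : I ≤ 2 * Real.exp 1 * ‖G‖ ^ 2 := by linarith
  have hlow : ∫ x, ((1 + ‖x‖ ^ 2) ^ 2)⁻¹ * v x ^ 2 ≤ Λ / 2 * I := by
    rw [hI, ← integral_const_mul]
    refine integral_mono_of_nonneg (Eventually.of_forall fun x => by positivity)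
      (hint.const_mul _) (Eventually.of_forall fun x => ?_)
    simp only
    rw [← mul_assoc]
    refine mul_le_mul_of_nonneg_right ?_ (sq_nonneg _)
    have h1 : ((1 + ‖x‖ ^ 2) ^ 2)⁻¹ ≤ s x ^ (α - 2) := by
      have : ((1 + ‖x‖ ^ 2) ^ 2)⁻¹ = s x ^ (-2 : ℝ) := by
        rw [Real.rpow_neg (hs0 x).le]; norm_cast
      rw [this]
      exact Real.rpow_le_rpow_of_exponent_le (hs1 x) (by linarith)
    have h2 : 0 ≤ s x ^ (α - 2) := Real.rpow_nonneg (hs0 x).le _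
    calc ((1 + ‖x‖ ^ 2) ^ 2)⁻¹ ≤ s x ^ (α - 2) * 1 := by rw [mul_one]; exact h1
      _ ≤ s x ^ (α - 2) * (1 + α * ‖x‖ ^ 2) := by
          gcongr
          have : 0 ≤ α * ‖x‖ ^ 2 := by positivity
          linarith
      _ = Λ / 2 * b x := by
          have : Λ * α = 1 := mul_inv_cancel₀ hΛ0.ne'
          simp only [b]
          linear_combination (-(s x ^ (α - 2) * (1 + α * ‖x‖ ^ 2))) * this
  calc _ ≤ _ := hlow
    _ ≤ Λ / 2 * (2 * Real.exp 1 * ‖G‖ ^ 2) := by gcongr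
    _ = _ := by ring

/-- Young's inequality with the weight `(1 + |x|²)²`, which is at most `(1 + L²)²` where `w` can be
nonzero; the second term is the left side of the Hardy inequality. -/
theorem inner_le_of_support {w v : PlaneL2} {L η : ℝ} (hη : 0 < η)
    (hw : ∀ᵐ x, L < ‖x‖ → w x = 0) :
    inner ℝ w v ≤ (1 + L ^ 2) ^ 2 / (2 * η) * ‖w‖ ^ 2 +
      η / 2 * ∫ x, ((1 + ‖x‖ ^ 2) ^ 2)⁻¹ * v x ^ 2 := by
  have hbm : IsBoundedMeas (fun x : Plane => ((1 + ‖x‖ ^ 2) ^ 2)⁻¹) := by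
    refine Continuous.isBoundedMeas (C := 1) ?_ fun x => ?_
    · exact Continuous.inv₀ (by fun_prop) fun x => by positivity
    · rw [abs_of_nonneg (by positivity)]
      exact inv_le_one_of_one_le₀ (by nlinarith [sq_nonneg ‖x‖, sq_nonneg (‖x‖ ^ 2)])
  have hint : Integrable (fun x => ((1 + ‖x‖ ^ 2) ^ 2)⁻¹ * v x ^ 2) := by
    refine (integrable_mul_inner hbm v v).congr (Eventually.of_forall fun x => ?_)
    simp only [real_inner_self_eq_norm_sq, Real.norm_eq_abs, sq_abs]
  rw [norm_sq_eq_integral, L2.inner_def, ← integral_const_mul, ← integral_const_mul,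
    ← integral_add ((integrable_norm_sq w).const_mul _) (hint.const_mul _)]
  refine integral_mono_ae (L2.integrable_inner _ _)
    (((integrable_norm_sq w).const_mul _).add (hint.const_mul _)) ?_
  filter_upwards [hw] with x hx
  simp only [RCLike.inner_apply, conj_trivial, Real.norm_eq_abs, sq_abs]
  by_cases hxL : L < ‖x‖
  · rw [hx hxL]; simp only [mul_zero, ne_eq, OfNat.ofNat_ne_zero, not_false_eq_true, zero_pow,
      zero_add]
    positivity
  · have h1 : 1 + ‖x‖ ^ 2 ≤ 1 + L ^ 2 := by
      have := not_lt.1 hxL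
      gcongr
    have h3 : v x * w x ≤ (1 + ‖x‖ ^ 2) ^ 2 / (2 * η) * w x ^ 2 +
        η / 2 * (((1 + ‖x‖ ^ 2) ^ 2)⁻¹ * v x ^ 2) := by
      set σ := 1 + ‖x‖ ^ 2 with hσ
      have hσ0 : 0 < σ := by positivity
      have h4 : 0 ≤ (σ ^ 2 * w x - η * v x) ^ 2 / (2 * η * σ ^ 2) := by positivity
      have h5 : (σ ^ 2 * w x - η * v x) ^ 2 / (2 * η * σ ^ 2) =
        σ ^ 2 / (2 * η) * w x ^ 2 + η / 2 * ((σ ^ 2)⁻¹ * v x ^ 2) - v x * w x := by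
        field_simp; ring
      linarith
    refine h3.trans ?_
    gcongr

/-- Bound of the `L²` norm of a finite energy solution, in terms of the logarithm of its support
radius. -/
theorem IsExtendedSolution.norm_sq_le {K : Plane → ℝ} {hK : IsBoundedMeas K}
    {u ut : ℝ → PlaneL2} {g : ℝ → PlaneVecL2} (hu : IsExtendedSolution K hK u ut g)
    {km : ℝ} (hkm : 0 < km) (hK1 : ∀ x, km ≤ K x) {L : ℝ}
    (hut : ∀ᵐ x, L < ‖x‖ → ut 0 x = 0) {t Λ : ℝ} (ht : 0 ≤ t) (hΛ : 2 ≤ Λ)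
    (hsupp : ∀ s ∈ Set.Icc 0 t, ∀ᵐ x, Real.exp Λ < 1 + ‖x‖ ^ 2 → u s x = 0) :
    ‖u t‖ ^ 2 ≤ ‖u 0‖ ^ 2 + (1 + L ^ 2) ^ 2 * Real.exp 1 / km * ‖ut 0‖ ^ 2 * Λ := by
  let v : ℝ → PlaneL2 := fun t => ∫ s in (0:ℝ)..t, u s
  let G : ℝ → PlaneVecL2 := fun t => ∫ s in (0:ℝ)..t, g s
  have hvd : ∀ t, HasDerivAt v (u t) t := fun t =>
    intervalIntegral.integral_hasDerivAt_right (hu.continuous.intervalIntegrable 0 t)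
      (hu.continuous.stronglyMeasurableAtFilter _ _) hu.continuous.continuousAt
  have hGd : ∀ t, HasDerivAt G (g t) t := fun t => hu.hasDerivAt_integral_grad 0 t
  -- This quantity is conserved: the equation integrated from `0` to `t` and tested with `u t` reads
  -- `(ut t - ut 0, u t) = -(K G, G')`, since the derivative of `G` is the gradient of `u`.
  let D : ℝ → ℝ := fun t => ‖u t‖ ^ 2 + inner ℝ (scalarMul Plane K hK (G t)) (G t) -
    2 * inner ℝ (ut 0) (v t)
  have hD : ∀ r, 0 ≤ r → ∃ D', HasDerivAt D D' r ∧ D' ≤ 0 * D r := by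
    intro r hr
    have h1 := ((hu.hasDerivAt r).norm_sq.add (hasDerivAt_inner_scalarMul_self hK (hGd r))).sub
      (((hasDerivAt_const r (ut 0)).inner ℝ (hvd r)).const_mul 2)
    refine ⟨_, h1, le_of_eq ?_⟩
    have h2 := hu.weak 0 r le_rfl hr _ _ (hu.hasWeakGradient r hr)
    rw [inner_sub_left] at h2
    rw [inner_zero_left, real_inner_comm]
    change inner ℝ (ut r) (u r) - inner ℝ (ut 0) (u r) =
      -inner ℝ (scalarMul Plane K hK (G r)) (g r) at h2
    linarith
  have h1 := le_exp_mul_of_hasDerivAt_le hD le_rfl ht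
  have hD0 : D 0 = ‖u 0‖ ^ 2 := by simp [D, G, v]
  rw [zero_mul, Real.exp_zero, one_mul, hD0] at h1
  have hw : HasWeakGradient (v t) (G t) :=
    HasWeakGradient.intervalIntegral ht hu.continuous.continuousOn hu.continuous_grad.continuousOn
      fun s hs => hu.hasWeakGradient s hs.1
  have hv : ∀ᵐ x, Real.exp Λ < 1 + ‖x‖ ^ 2 → v t x = 0 :=
    ae_zero_intervalIntegral (s := {x : Plane | Real.exp Λ < 1 + ‖x‖ ^ 2})
      (isOpen_lt continuous_const (by fun_prop)).measurableSet hu.continuous ht hsupp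
  have h2 := hw.hardy hΛ hv
  have h3 : km * ‖G t‖ ^ 2 ≤ inner ℝ (scalarMul Plane K hK (G t)) (G t) := by
    rw [inner_scalarMul, norm_sq_eq_integral, ← integral_const_mul]
    refine integral_mono ((integrable_norm_sq _).const_mul _) (integrable_mul_inner hK _ _)
      fun x => ?_
    simp only [real_inner_self_eq_norm_sq]
    gcongr; exact hK1 x
  have hΛ0 : 0 < Λ := by linarith
  -- With this `η`, twice the Hardy term is exactly `km ‖G‖²`, which the coercive term in `D`
  -- absorbs.
  have hη : 0 < km / (Real.exp 1 * Λ) := by positivity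
  have h4 := inner_le_of_support (v := v t) hη hut
  have h5 : km / (Real.exp 1 * Λ) / 2 * ∫ x, ((1 + ‖x‖ ^ 2) ^ 2)⁻¹ * v t x ^ 2 ≤
      km / 2 * ‖G t‖ ^ 2 := by
    calc _ ≤ km / (Real.exp 1 * Λ) / 2 * (Real.exp 1 * Λ * ‖G t‖ ^ 2) := by gcongr
      _ = _ := by field_simp
  have h6 : (1 + L ^ 2) ^ 2 / (2 * (km / (Real.exp 1 * Λ))) * ‖ut 0‖ ^ 2 =
      (1 + L ^ 2) ^ 2 * Real.exp 1 / km * ‖ut 0‖ ^ 2 * Λ / 2 := by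
    field_simp
  rw [h6] at h4
  simp only [D] at h1
  linarith

/-! ### The Morawetz identity by means of dilations. -/

/-- The coefficient produced by commuting multiplication by `K` with dilations. -/
noncomputable def dilationCoeff (K : Plane → ℝ) (τ : ℝ) (x : Plane) : ℝ :=
  Real.exp τ * K x - Real.exp (-τ) * K (Real.exp τ • x)

theorem hasDerivAt_dilationCoeff {K : Plane → ℝ} (hK : Differentiable ℝ K) (x : Plane) (τ : ℝ) :
    HasDerivAt (fun τ => dilationCoeff K τ x)
      (Real.exp τ * K x + Real.exp (-τ) * K (Real.exp τ • x) -
        Real.exp (-τ) * inner ℝ (Real.exp τ • x) (gradient K (Real.exp τ • x))) τ := by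
  have h1 : HasFDerivAt K (fderiv ℝ K (Real.exp τ • x)) (Real.exp τ • x) := (hK _).hasFDerivAt
  have h2 : HasDerivAt (fun τ : ℝ => Real.exp (-τ)) (-Real.exp (-τ)) τ := by
    simpa using (hasDerivAt_neg τ).exp
  have h3 := h1.comp_hasDerivAt τ ((Real.hasDerivAt_exp τ).smul_const x)
  refine (((Real.hasDerivAt_exp τ).mul_const (K x)).sub (h2.mul h3)).congr_deriv ?_
  rw [real_inner_comm, inner_gradient]
  simp only [Function.comp]
  ring

/-- The coefficient vanishes at `τ = 0`, so the mean value inequality makes it linear in `τ`. This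
dominates its quotient by `τ` uniformly in `x`. -/
theorem abs_dilationCoeff_le {K : Plane → ℝ} (hK : Differentiable ℝ K) {C D : ℝ}
    (hC : ∀ x, |K x| ≤ C) (hD : ∀ x, |inner ℝ x (gradient K x)| ≤ D) {τ : ℝ} (hτ : 0 ≤ τ)
    (hτ1 : τ ≤ 1) (x : Plane) :
    |dilationCoeff K τ x| ≤ Real.exp 1 * (2 * C + D) * τ := by
  have hC0 : 0 ≤ C := (abs_nonneg _).trans (hC 0)
  have hD0 : 0 ≤ D := (abs_nonneg _).trans (hD 0)
  have h := norm_image_sub_le_of_norm_deriv_le_segment' (a := 0) (b := 1)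
    (f := fun τ => dilationCoeff K τ x) (C := Real.exp 1 * (2 * C + D))
    (fun σ _ => (hasDerivAt_dilationCoeff hK x σ).hasDerivWithinAt) ?_ τ ⟨hτ, hτ1⟩
  · have h0 : dilationCoeff K 0 x = 0 := by simp [dilationCoeff]
    simp only [h0, sub_zero] at h
    exact h
  · intro σ hσ
    have e1 : Real.exp σ ≤ Real.exp 1 := Real.exp_le_exp.2 hσ.2.le
    have e2 : Real.exp (-σ) ≤ Real.exp 1 := Real.exp_le_exp.2 (by linarith [hσ.1])
    have t1 : |Real.exp σ * K x| ≤ Real.exp 1 * C := by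
      rw [abs_mul, abs_of_pos (Real.exp_pos _)]; gcongr; exact hC x
    have t2 : |Real.exp (-σ) * K (Real.exp σ • x)| ≤ Real.exp 1 * C := by
      rw [abs_mul, abs_of_pos (Real.exp_pos _)]; gcongr; exact hC _
    have t3 : |Real.exp (-σ) * inner ℝ (Real.exp σ • x) (gradient K (Real.exp σ • x))| ≤
        Real.exp 1 * D := by
      rw [abs_mul, abs_of_pos (Real.exp_pos _)]; gcongr; exact hD _
    rw [Real.norm_eq_abs]
    refine (abs_sub _ _).trans ?_
    have t4 := abs_add_le (Real.exp σ * K x) (Real.exp (-σ) * K (Real.exp σ • x))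
    linarith

theorem isBoundedMeas_dilationCoeff {K : Plane → ℝ} (hKc : Continuous K) (hK : IsBoundedMeas K)
    (τ : ℝ) : IsBoundedMeas (dilationCoeff K τ) := by
  obtain ⟨C, hC⟩ := hK.bdd
  refine Continuous.isBoundedMeas (C := Real.exp τ * C + Real.exp (-τ) * C) ?_ fun x => ?_
  · unfold dilationCoeff; fun_prop
  · refine (abs_sub _ _).trans ?_
    rw [abs_mul, abs_mul, abs_of_pos (Real.exp_pos _), abs_of_pos (Real.exp_pos _)]
    gcongr <;> exact hC _

/-- The adjoint of `dilation (-τ)` acts on `K q`, and dilating that product gives `K (e^τ x)` times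
the dilation of `q`. No derivative of `q` enters, so finite energy is enough. -/
theorem inner_commutator {K : Plane → ℝ} (hK : IsBoundedMeas K) {τ : ℝ}
    (hτ : IsBoundedMeas (dilationCoeff K τ)) (q : PlaneVecL2) :
    inner ℝ (scalarMul Plane K hK q) (Real.exp τ • dilation τ q - Real.exp (-τ) • dilation (-τ) q) =
      inner ℝ (scalarMul Plane _ hτ q) (dilation τ q) := by
  have h1 : inner ℝ (scalarMul Plane K hK q) (dilation (-τ) q) =
      inner ℝ (dilation τ (scalarMul Plane K hK q)) q := by
    rw [inner_dilation_left]
  rw [inner_sub_right, inner_smul_right, inner_smul_right, h1, L2.inner_def, L2.inner_def,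
    L2.inner_def, ← integral_const_mul, ← integral_const_mul, ← integral_sub
    ((L2.integrable_inner _ _).const_mul _) ((L2.integrable_inner _ _).const_mul _)]
  refine integral_congr_ae ?_
  filter_upwards [coeFn_scalarMul K hK q, coeFn_scalarMul _ hτ q, coeFn_dilation τ q,
    coeFn_dilation_of_ae_eq τ (coeFn_scalarMul K hK q)] with x h1 h2 h3 h4
  rw [h1, h2, h3, h4]
  simp only [inner_smul_left, inner_smul_right, dilationCoeff, conj_trivial]
  rw [real_inner_comm (q x)]
  ring

namespace IsExtendedSolution

variable {K : Plane → ℝ} {hK : IsBoundedMeas K} {u ut : ℝ → PlaneL2} {g : ℝ → PlaneVecL2}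

theorem inner_dilation_sub (hu : IsExtendedSolution K hK u ut g) {τ : ℝ}
    (hτ : IsBoundedMeas (dilationCoeff K τ)) {t : ℝ} (ht : 0 ≤ t) :
    inner ℝ (ut t) (dilation τ (u t) - dilation (-τ) (u t)) -
      inner ℝ (ut 0) (dilation τ (u 0) - dilation (-τ) (u 0)) =
      - ∫ s in (0:ℝ)..t, inner ℝ (scalarMul Plane _ hτ (g s)) (dilation τ (g s)) := by
  have hd : ∀ σ s, HasDerivAt (fun s => dilation σ (u s)) (dilation σ (ut s)) s := fun σ s =>
    (dilation σ).hasFDerivAt.comp_hasDerivAt s (hu.hasDerivAt s)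
  have hc : ∀ σ, Continuous (fun s => dilation σ (u s)) := fun σ =>
    (dilation σ).continuous.comp hu.continuous
  have hcont : Continuous fun s => inner ℝ (scalarMul Plane _ hτ (g s)) (dilation τ (g s)) :=
    ((scalarMul Plane _ hτ).continuous.comp hu.continuous_grad).inner
      ((dilation τ).continuous.comp hu.continuous_grad)
  rw [← intervalIntegral.integral_neg]
  refine (intervalIntegral.integral_eq_sub_of_hasDerivAt_of_le ht
    (f := fun s => inner ℝ (ut s) (dilation τ (u s) - dilation (-τ) (u s)))
    (hu.continuous_deriv.inner ((hc τ).sub (hc (-τ)))).continuousOn ?_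
    (hcont.neg.intervalIntegrable 0 t)).symm
  intro s hs
  have hw : HasWeakGradient (dilation τ (u s) - dilation (-τ) (u s))
      (Real.exp τ • dilation τ (g s) - Real.exp (-τ) • dilation (-τ) (g s)) :=
    ((hu.hasWeakGradient s hs.1.le).dilate τ).sub ((hu.hasWeakGradient s hs.1.le).dilate (-τ))
  have h1 := hu.hasDerivAt_inner hs.1 ((hd τ s).sub (hd (-τ) s)) hw
  refine h1.congr_deriv ?_
  rw [inner_commutator hK hτ, inner_sub_right, inner_dilation_right (-τ), neg_neg,
    real_inner_comm (dilation τ (ut s)), sub_self, zero_sub]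
  rfl

theorem inner_self_sub (hu : IsExtendedSolution K hK u ut g) {t : ℝ} (ht : 0 ≤ t) :
    inner ℝ (ut t) (u t) - inner ℝ (ut 0) (u 0) =
      ∫ s in (0:ℝ)..t, (inner ℝ (ut s) (ut s) - inner ℝ (scalarMul Plane K hK (g s)) (g s)) := by
  have hcont : Continuous fun s =>
      (inner ℝ (ut s) (ut s) - inner ℝ (scalarMul Plane K hK (g s)) (g s) : ℝ) :=
    (hu.continuous_deriv.inner hu.continuous_deriv).sub
      (((scalarMul Plane _ hK).continuous.comp hu.continuous_grad).inner hu.continuous_grad)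
  refine (intervalIntegral.integral_eq_sub_of_hasDerivAt_of_le ht
    (f := fun s => inner ℝ (ut s) (u s)) (hu.continuous_deriv.inner hu.continuous).continuousOn ?_
    (hcont.intervalIntegrable 0 t)).symm
  intro s hs
  exact hu.hasDerivAt_inner hs.1 (hu.hasDerivAt s) (hu.hasWeakGradient s hs.1.le)

/-- The coefficient divided by `τ` tends boundedly to `2 K - x · ∇K`, its derivative at `τ = 0`,
while `dilation τ q` tends to `q` in norm. -/
theorem tendsto_dilationCoeff_inner (hKd : ContDiff ℝ 1 K) {C D : ℝ}
    (hC : ∀ x, |K x| ≤ C) (hD : ∀ x, |inner ℝ x (gradient K x)| ≤ D)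
    (hτ : ∀ τ, IsBoundedMeas (dilationCoeff K τ)) (hK : IsBoundedMeas K)
    (hB : IsBoundedMeas (fun x => inner ℝ x (gradient K x))) (q : PlaneVecL2) :
    Tendsto (fun τ => τ⁻¹ * inner ℝ (scalarMul Plane _ (hτ τ) q) (dilation τ q)) (𝓝[>] 0)
      (𝓝 (2 * inner ℝ (scalarMul Plane K hK q) q - inner ℝ (scalarMul Plane _ hB q) q)) := by
  have hKd' := hKd.differentiable one_ne_zero
  have h1 : Tendsto (fun τ : ℝ => τ⁻¹ • scalarMul Plane _ (hτ τ) q) (𝓝[>] 0)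
      (𝓝 ((2:ℝ) • scalarMul Plane K hK q - scalarMul Plane _ hB q)) := by
    refine tendsto_Lp_of_dominated (b := fun x => Real.exp 1 * (2 * C + D) * ‖q x‖)
      (φ := fun τ x => (τ⁻¹ * dilationCoeff K τ x) • q x)
      (f' := fun x => (2 * K x - inner ℝ x (gradient K x)) • q x) ?_ ?_ ?_ ?_ ?_ ?_
    · refine Eventually.of_forall fun τ => ?_
      filter_upwards [coeFn_scalarMul _ (hτ τ) q, Lp.coeFn_smul τ⁻¹ (scalarMul Plane _ (hτ τ) q)]
        with x h1 h2
      rw [h2, Pi.smul_apply, h1, smul_smul]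
    · filter_upwards [coeFn_scalarMul K hK q, coeFn_scalarMul _ hB q,
        Lp.coeFn_sub ((2:ℝ) • scalarMul Plane K hK q) (scalarMul Plane _ hB q),
        Lp.coeFn_smul (2:ℝ) (scalarMul Plane K hK q)] with x h1 h2 h3 h4
      rw [h3, Pi.sub_apply, h4, Pi.smul_apply, h1, h2, smul_smul, sub_smul]
    · exact (Lp.memLp q).norm.const_mul _
    · have : ∀ᶠ τ : ℝ in 𝓝[>] 0, τ < 1 := mem_nhdsWithin_of_mem_nhds (Iio_mem_nhds one_pos)
      filter_upwards [self_mem_nhdsWithin, this] with τ h0 h1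
      have h0' : (0:ℝ) < τ := h0
      refine Eventually.of_forall fun x => ?_
      rw [norm_smul]
      refine mul_le_mul_of_nonneg_right ?_ (norm_nonneg _)
      rw [norm_mul, norm_inv, Real.norm_of_nonneg h0'.le, Real.norm_eq_abs,
        inv_mul_le_iff₀ h0', mul_comm]
      exact abs_dilationCoeff_le hKd' hC hD h0'.le h1.le x
    · refine Eventually.of_forall fun x => ?_
      rw [norm_smul]
      refine mul_le_mul_of_nonneg_right ?_ (norm_nonneg _)
      have hD0 : 0 ≤ D := (abs_nonneg _).trans (hD 0)
      have hC0 : 0 ≤ C := (abs_nonneg _).trans (hC 0)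
      have he : 1 ≤ Real.exp 1 := Real.one_le_exp zero_le_one
      calc ‖2 * K x - inner ℝ x (gradient K x)‖ ≤ |2 * K x| + |inner ℝ x (gradient K x)| :=
            abs_sub _ _
        _ ≤ 2 * C + D := by rw [abs_mul, abs_two]; gcongr; exacts [hC x, hD x]
        _ ≤ _ := le_mul_of_one_le_left (by positivity) he
    · refine Eventually.of_forall fun x => Tendsto.smul_const ?_ _
      have := (hasDerivAt_dilationCoeff hKd' x 0).tendsto_slope_zero_right
      simp only [zero_add, neg_zero, Real.exp_zero, one_smul, one_mul] at this
      have h0 : dilationCoeff K 0 x = 0 := by simp [dilationCoeff]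
      simp only [h0, sub_zero, smul_eq_mul] at this
      rwa [← two_mul] at this
  have h2 : Tendsto (fun τ => dilation τ q) (𝓝[>] 0) (𝓝 q) := by
    have := (continuous_dilation q).tendsto 0
    rw [dilation_zero] at this
    exact this.mono_left nhdsWithin_le_nhds
  have h3 := h1.inner (𝕜 := ℝ) h2
  rw [inner_sub_left, inner_smul_left] at h3
  refine h3.congr fun τ => ?_
  rw [inner_smul_left]; rfl

/-- The Morawetz identity. -/
theorem morawetz (hu : IsExtendedSolution K hK u ut g) (hKd : ContDiff ℝ 1 K) {D : ℝ}
    (hD : ∀ x, |inner ℝ x (gradient K x)| ≤ D)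
    (hB : IsBoundedMeas (fun x => inner ℝ x (gradient K x))) {t : ℝ} (ht : 0 ≤ t)
    {k₀ k : PlaneL2} (hk₀ : k₀ =ᵐ[volume] fun x => u 0 x + inner ℝ (g 0 x) x)
    (hk : k =ᵐ[volume] fun x => u t x + inner ℝ (g t x) x) :
    2 * (inner ℝ (ut t) k - inner ℝ (ut 0) k₀) =
      - ∫ s in (0:ℝ)..t, (2 * inner ℝ (scalarMul Plane K hK (g s)) (g s) -
        inner ℝ (scalarMul Plane _ hB (g s)) (g s)) := by
  obtain ⟨C, hC⟩ := hK.bdd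
  have hτ : ∀ τ, IsBoundedMeas (dilationCoeff K τ) := isBoundedMeas_dilationCoeff hKd.continuous hK
  have hKd' := hKd.differentiable one_ne_zero
  have h1 : Tendsto (fun τ : ℝ => inner ℝ (ut t) (τ⁻¹ • (dilation τ (u t) - dilation (-τ) (u t))) -
      inner ℝ (ut 0) (τ⁻¹ • (dilation τ (u 0) - dilation (-τ) (u 0)))) (𝓝[>] 0)
      (𝓝 (inner ℝ (ut t) ((2:ℝ) • k) - inner ℝ (ut 0) ((2:ℝ) • k₀))) :=
    (tendsto_const_nhds.inner ((hu.hasWeakGradient t ht).tendsto_dilation_symm hk)).sub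
      (tendsto_const_nhds.inner ((hu.hasWeakGradient 0 le_rfl).tendsto_dilation_symm hk₀))
  obtain ⟨M, hM⟩ : ∃ M, ∀ s ∈ Set.Icc 0 t, ‖g s‖ ≤ M :=
    isCompact_Icc.exists_bound_of_continuousOn hu.continuous_grad.continuousOn
  have hC0 : 0 ≤ C := (abs_nonneg _).trans (hC 0)
  have hD0 : 0 ≤ D := (abs_nonneg _).trans (hD 0)
  have hM0 : 0 ≤ M := (norm_nonneg _).trans (hM 0 ⟨le_rfl, ht⟩)
  have hlt1 : ∀ᶠ τ : ℝ in 𝓝[>] 0, τ < 1 := mem_nhdsWithin_of_mem_nhds (Iio_mem_nhds one_pos)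
  have h2 : Tendsto (fun τ : ℝ => ∫ s in (0:ℝ)..t,
      τ⁻¹ * inner ℝ (scalarMul Plane _ (hτ τ) (g s)) (dilation τ (g s))) (𝓝[>] 0)
      (𝓝 (∫ s in (0:ℝ)..t, (2 * inner ℝ (scalarMul Plane K hK (g s)) (g s) -
        inner ℝ (scalarMul Plane _ hB (g s)) (g s)))) := by
    refine intervalIntegral.tendsto_integral_filter_of_dominated_convergence
      (fun _ => Real.exp 1 * (2 * C + D) * M * M) ?_ ?_ ?_ ?_
    · refine Eventually.of_forall fun τ => ?_
      have hcont : Continuous fun s => τ⁻¹ *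
          (inner ℝ (scalarMul Plane _ (hτ τ) (g s)) (dilation τ (g s)) : ℝ) :=
        continuous_const.mul (((scalarMul Plane _ (hτ τ)).continuous.comp hu.continuous_grad).inner
          ((dilation τ).continuous.comp hu.continuous_grad))
      exact hcont.aestronglyMeasurable
    · filter_upwards [self_mem_nhdsWithin, hlt1] with τ h0 hτ1
      have h0' : (0:ℝ) < τ := h0
      refine Eventually.of_forall fun s hs => ?_
      rw [Set.uIoc_of_le ht] at hs
      have hgs := hM s ⟨hs.1.le, hs.2⟩
      rw [norm_mul, norm_inv, Real.norm_of_nonneg h0'.le, inv_mul_le_iff₀ h0']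
      have h3 : ‖scalarMul Plane _ (hτ τ) (g s)‖ ≤ Real.exp 1 * (2 * C + D) * τ * ‖g s‖ := by
        refine Lp.norm_le_mul_norm_of_ae_le_mul ?_
        filter_upwards [coeFn_scalarMul _ (hτ τ) (g s)] with x hx
        rw [hx, norm_smul]
        refine mul_le_mul_of_nonneg_right ?_ (norm_nonneg _)
        exact abs_dilationCoeff_le hKd' hC hD h0'.le hτ1.le x
      calc _ ≤ ‖scalarMul Plane _ (hτ τ) (g s)‖ * ‖dilation τ (g s)‖ := norm_inner_le_norm _ _
        _ ≤ (Real.exp 1 * (2 * C + D) * τ * ‖g s‖) * ‖g s‖ := by rw [norm_dilation]; gcongr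
        _ ≤ (Real.exp 1 * (2 * C + D) * τ * M) * M := by gcongr
        _ = _ := by ring
    · exact intervalIntegrable_const
    · exact Eventually.of_forall fun s _ => tendsto_dilationCoeff_inner hKd hC hD hτ hK hB (g s)
  have h3 := tendsto_nhds_unique h1 (h2.neg.congr fun τ => ?_)
  · rw [inner_smul_right, inner_smul_right] at h3
    rw [← h3]; ring
  · rw [intervalIntegral.integral_const_mul, ← mul_neg, ← hu.inner_dilation_sub (hτ τ) ht,
      inner_smul_right, inner_smul_right]
    ring

theorem weightedEnergy_one (K : Plane → ℝ) (hK : IsBoundedMeas K) (p : PlaneL2) (q : PlaneVecL2) :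
    weightedEnergy K (fun _ => 1) p q =
      (1 / 2) * (inner ℝ p p + inner ℝ (scalarMul Plane K hK q) q) := by
  have hone : IsBoundedMeas (fun _ : Plane => (1:ℝ)) :=
    continuous_const.isBoundedMeas (C := 1) (by simp)
  rw [weightedEnergy_eq hK hone, inner_scalarMul, inner_scalarMul, inner_scalarMul, L2.inner_def]
  simp

/-- The Morawetz inequality. -/
theorem morawetz_le (hu : IsExtendedSolution K hK u ut g) (hK0 : ∀ x, 0 ≤ K x)
    (hKd : ContDiff ℝ 1 K) {D : ℝ} (hD : ∀ x, |inner ℝ x (gradient K x)| ≤ D)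
    (hB : IsBoundedMeas (fun x => inner ℝ x (gradient K x))) {t : ℝ} (ht : 0 ≤ t)
    {k₀ k : PlaneL2} (hk₀ : k₀ =ᵐ[volume] fun x => u 0 x + inner ℝ (g 0 x) x)
    (hk : k =ᵐ[volume] fun x => u t x + inner ℝ (g t x) x) :
    t * weightedEnergy K (fun _ => 1) (ut t) (g t) + inner ℝ (ut t) k - 1 / 2 * inner ℝ (ut t) (u t) ≤
      inner ℝ (ut 0) k₀ - 1 / 2 * inner ℝ (ut 0) (u 0) +
        1 / 2 * ∫ s in (0:ℝ)..t, inner ℝ (scalarMul Plane _ hB (g s)) (g s) := by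
  have h1 := hu.morawetz hKd hD hB ht hk₀ hk
  have h2 := hu.inner_self_sub ht
  have c1 : Continuous fun s => (inner ℝ (ut s) (ut s) : ℝ) :=
    hu.continuous_deriv.inner hu.continuous_deriv
  have c2 : Continuous fun s => (inner ℝ (scalarMul Plane K hK (g s)) (g s) : ℝ) :=
    ((scalarMul Plane _ hK).continuous.comp hu.continuous_grad).inner hu.continuous_grad
  have c3 : Continuous fun s => (inner ℝ (scalarMul Plane _ hB (g s)) (g s) : ℝ) :=
    ((scalarMul Plane _ hB).continuous.comp hu.continuous_grad).inner hu.continuous_grad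
  have i1 := c1.intervalIntegrable (μ := volume) 0 t
  have i2 := c2.intervalIntegrable (μ := volume) 0 t
  have i3 := c3.intervalIntegrable (μ := volume) 0 t
  rw [intervalIntegral.integral_sub (i2.const_mul 2) i3, intervalIntegral.integral_const_mul] at h1
  rw [intervalIntegral.integral_sub i1 i2] at h2
  -- Monotonicity bounds `t E(t)` by the time integral of `E`; exact conservation is not required.
  have h3 : t * weightedEnergy K (fun _ => 1) (ut t) (g t) ≤
      ∫ s in (0:ℝ)..t, (1 / 2) * (inner ℝ (ut s) (ut s) +
        inner ℝ (scalarMul Plane K hK (g s)) (g s)) := by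
    have h4 : ∫ _ in (0:ℝ)..t, weightedEnergy K (fun _ => 1) (ut t) (g t) =
      t * weightedEnergy K (fun _ => 1) (ut t) (g t) := by
      rw [intervalIntegral.integral_const, smul_eq_mul, sub_zero]
    rw [← h4]
    refine intervalIntegral.integral_mono_on ht intervalIntegrable_const
      ((i1.add i2).const_mul _) fun s hs => ?_
    rw [← weightedEnergy_one K hK]
    exact hu.energy_antitone hK0 hs.1 hs.2
  rw [intervalIntegral.integral_const_mul, intervalIntegral.integral_add i1 i2] at h3
  linarith

end IsExtendedSolution

/-! ### Comparison of the Morawetz functional with the local energy. -/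

/-- Multiplication by `x` is unbounded, so square integrability of `x · ∇u` has to come from the
bounded support of the gradient. -/
theorem exists_radial_add {p : PlaneL2} {q : PlaneVecL2} {ρ : ℝ}
    (hq : ∀ᵐ x, ρ < ‖x‖ → q x = 0) :
    ∃ k : PlaneL2, k =ᵐ[volume] fun x => p x + inner ℝ (q x) x := by
  have hm : MemLp (fun x => inner ℝ (q x) x) 2 (volume : Measure Plane) := by
    refine (Lp.memLp q).of_le_mul (c := ρ)
      ((Lp.aestronglyMeasurable q).inner continuous_id.aestronglyMeasurable) ?_
    filter_upwards [hq] with x hx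
    by_cases hxρ : ρ < ‖x‖
    · rw [hx hxρ]; simp
    · calc ‖(inner ℝ (q x) x : ℝ)‖ ≤ ‖q x‖ * ‖x‖ := norm_inner_le_norm _ _
        _ ≤ ‖q x‖ * ρ := by gcongr; exact not_lt.1 hxρ
        _ = _ := mul_comm _ _
  exact ⟨((Lp.memLp p).add hm).toLp, ((Lp.memLp p).add hm).coeFn_toLp⟩

theorem localEnergy_eq (K : Plane → ℝ) (ut : ℝ → PlaneL2) (g : ℝ → PlaneVecL2) (R t : ℝ) :
    localEnergy K ut g R t = weightedEnergy K
      ((Metric.closedBall (0 : Plane) R).indicator fun _ => 1) (ut t) (g t) := by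
  rw [localEnergy, weightedEnergy, ← integral_indicator measurableSet_closedBall]
  congr 1
  refine integral_congr_ae (Eventually.of_forall fun x => ?_)
  by_cases hx : x ∈ Metric.closedBall (0 : Plane) R <;> simp [hx]

theorem isBoundedMeas_indicator_closedBall (R : ℝ) :
    IsBoundedMeas ((Metric.closedBall (0 : Plane) R).indicator fun _ => (1:ℝ)) := by
  refine ⟨aestronglyMeasurable_const.indicator measurableSet_closedBall, 1, fun x => ?_⟩
  by_cases hx : x ∈ Metric.closedBall (0 : Plane) R <;> simp [hx]

theorem localEnergy_nonneg {K : Plane → ℝ} (hK0 : ∀ x, 0 ≤ K x) (ut : ℝ → PlaneL2)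
    (g : ℝ → PlaneVecL2) (R t : ℝ) : 0 ≤ localEnergy K ut g R t := by
  rw [localEnergy]
  refine mul_nonneg (by norm_num) (integral_nonneg fun x => ?_)
  have := hK0 x
  simp only [Pi.zero_apply]; positivity

theorem gradient_eq_zero_of_const {K : Plane → ℝ} {k₀ r₀ : ℝ} (hK3 : ∀ x, r₀ < ‖x‖ → K x = k₀)
    {x : Plane} (hx : r₀ < ‖x‖) : gradient K x = 0 := by
  have h : K =ᶠ[𝓝 x] fun _ => k₀ := by
    filter_upwards [(isOpen_lt continuous_const continuous_norm).mem_nhds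
      (show x ∈ {y : Plane | r₀ < ‖y‖} from hx)] with y hy using hK3 y hy
  rw [gradient, h.fderiv_eq]; simp

/-- Lower bound of the Morawetz functional by the local energy, for functions supported in
`|x| ≤ √k₀ t + c`. -/
theorem localEnergy_le_morawetz {K : Plane → ℝ} (hK : IsBoundedMeas K) {km : ℝ} (hkm : 0 < km)
    (hK1 : ∀ x, km ≤ K x) {k₀ r₀ : ℝ} (hk₀ : 0 < k₀) (hK3 : ∀ x, r₀ < ‖x‖ → K x = k₀) {R : ℝ}
    (hR0 : 0 ≤ R) (hR : r₀ < R) {t c : ℝ} (ht : 0 ≤ t) (hc : 0 ≤ c) {p w k : PlaneL2} {q : PlaneVecL2}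
    (hp : ∀ᵐ x, √k₀ * t + c < ‖x‖ → p x = 0 ∧ q x = 0)
    (hk : k =ᵐ[volume] fun x => w x + inner ℝ (q x) x) :
    (t - (R / √km + c / √k₀)) *
        weightedEnergy K ((Metric.closedBall (0 : Plane) R).indicator fun _ => 1) p q -
      (R / √km + c / √k₀) * weightedEnergy K (fun _ => 1) p q ≤
      t * weightedEnergy K (fun _ => 1) p q + inner ℝ p k - inner ℝ p w := by
  set C := R / √km + c / √k₀ with hC
  set χ := (Metric.closedBall (0 : Plane) R).indicator fun _ => (1:ℝ) with hχ
  have hone : IsBoundedMeas (fun _ : Plane => (1:ℝ)) :=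
    continuous_const.isBoundedMeas (C := 1) (by simp)
  have hi1 := integrable_weighted hK (isBoundedMeas_indicator_closedBall R) p q
  have hi2 := integrable_weighted hK hone p q
  have hi3 := L2.integrable_inner (𝕜 := ℝ) p k
  have hi4 := L2.integrable_inner (𝕜 := ℝ) p w
  have hi5 : Integrable (fun x => t * (1 / 2) * (1 * (p x ^ 2 + K x * ‖q x‖ ^ 2)) +
      inner ℝ (p x) (k x)) := (hi2.const_mul _).add hi3
  rw [weightedEnergy, weightedEnergy, L2.inner_def, L2.inner_def, ← mul_assoc, ← mul_assoc,
    ← mul_assoc, ← integral_const_mul, ← integral_const_mul, ← integral_const_mul,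
    ← integral_sub (hi1.const_mul _) (hi2.const_mul _), ← integral_add (hi2.const_mul _) hi3,
    ← integral_sub hi5 hi4]
  refine integral_mono_ae ((hi1.const_mul _).sub (hi2.const_mul _)) (hi5.sub hi4) ?_
  filter_upwards [hp, hk] with x hpx hkx
  have hKx : 0 < K x := hkm.trans_le (hK1 x)
  have hskm : 0 < √km := Real.sqrt_pos.2 hkm
  have hsk₀ : 0 < √k₀ := Real.sqrt_pos.2 hk₀
  have hC0 : 0 ≤ C := by positivity
  simp only [RCLike.inner_apply, conj_trivial]
  rw [hkx]
  set e := p x ^ 2 + K x * ‖q x‖ ^ 2 with he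
  have he0 : 0 ≤ e := by positivity
  have hcross : √(K x) * (|p x| * ‖q x‖) ≤ 1 / 2 * e := by
    rw [he]
    nlinarith [sq_nonneg (√(K x) * ‖q x‖ - |p x|), Real.mul_self_sqrt hKx.le, sq_abs (p x),
      mul_pow (√(K x)) ‖q x‖ 2, Real.sq_sqrt hKx.le]
  have hin : -(inner ℝ (q x) x * p x) ≤ ‖x‖ * (|p x| * ‖q x‖) := by
    refine (neg_le_abs _).trans ?_
    rw [abs_mul]
    calc _ ≤ (‖q x‖ * ‖x‖) * |p x| := by gcongr; exact abs_real_inner_le_norm _ _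
      _ = _ := by ring
  have hpq : 0 ≤ |p x| * ‖q x‖ := by positivity
  -- Three regions. For `|x| ≤ R`, the bound `K ≥ km` makes the cross term cost `R / √km` times the
  -- density. For larger `|x|` in the support, `K = k₀` and it costs `t + c / √k₀`. Beyond the
  -- support everything vanishes.
  suffices hmain : ‖x‖ * (|p x| * ‖q x‖) ≤ t * (1 / 2) * e - (t - C) * (1 / 2) * (χ x * e) +
      C * (1 / 2) * e by
    linarith
  by_cases hxR : ‖x‖ ≤ R
  · have h1 : χ x = 1 := by
      rw [hχ, Set.indicator_of_mem]; simpa using hxR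
    have h2 : |p x| * ‖q x‖ ≤ 1 / 2 * e / √km := by
      rw [le_div_iff₀ hskm, mul_comm]
      refine le_trans ?_ hcross
      gcongr; exact hK1 x
    have h3 : ‖x‖ * (|p x| * ‖q x‖) ≤ R / √km * (1 / 2 * e) := by
      calc _ ≤ R * (1 / 2 * e / √km) := by gcongr
        _ = _ := by ring
    have h4 : R / √km ≤ C := by rw [hC]; have : 0 ≤ c / √k₀ := by positivity
                                linarith
    have h5 : R / √km * (1 / 2 * e) ≤ C * (1 / 2 * e) := by gcongr
    have h6 : 0 ≤ C * (1 / 2 * e) := by positivity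
    rw [h1]; linarith
  · have h1 : χ x = 0 := by
      rw [hχ, Set.indicator_of_notMem]; simpa using hxR
    rw [h1]
    by_cases hxρ : √k₀ * t + c < ‖x‖
    · obtain ⟨hp0, hq0⟩ := hpx hxρ
      simp only [hp0, abs_zero, zero_mul, mul_zero, sub_zero]
      positivity
    · have hKk : K x = k₀ := hK3 x (hR.trans (not_le.1 hxR))
      rw [hKk] at hcross
      have h2 : ‖x‖ * (|p x| * ‖q x‖) ≤ (t + c / √k₀) * (1 / 2 * e) := by
        calc _ ≤ (√k₀ * t + c) * (|p x| * ‖q x‖) := by gcongr; exact not_lt.1 hxρ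
          _ = (t + c / √k₀) * (√k₀ * (|p x| * ‖q x‖)) := by field_simp
          _ ≤ _ := by gcongr
      have h4 : c / √k₀ ≤ C := by rw [hC]; have : 0 ≤ R / √km := by positivity
                                  linarith
      have h5 : c / √k₀ * (1 / 2 * e) ≤ C * (1 / 2 * e) := by gcongr
      linarith

/-- The integrand vanishes where `K` is constant, so only the ball contributes, and there `K |q|² ≤
p² + K |q|²`. -/
theorem inner_radial_le {K : Plane → ℝ} (hK : IsBoundedMeas K) {k₀ r₀ γ : ℝ}
    (hγ : 0 ≤ γ) (hK3 : ∀ x, r₀ < ‖x‖ → K x = k₀) (hK4 : ∀ x, inner ℝ x (gradient K x) ≤ γ * K x)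
    {R : ℝ} (hR : r₀ < R) (hB : IsBoundedMeas (fun x => inner ℝ x (gradient K x))) (p : PlaneL2)
    (q : PlaneVecL2) :
    1 / 2 * inner ℝ (scalarMul Plane _ hB q) q ≤
      γ * weightedEnergy K ((Metric.closedBall (0 : Plane) R).indicator fun _ => 1) p q := by
  rw [inner_scalarMul, weightedEnergy, ← mul_assoc, mul_comm γ, mul_assoc, ← integral_const_mul γ]
  refine mul_le_mul_of_nonneg_left ?_ (by norm_num)
  refine integral_mono (integrable_mul_inner hB q q)
    ((integrable_weighted hK (isBoundedMeas_indicator_closedBall R) p q).const_mul γ) fun x => ?_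
  simp only [real_inner_self_eq_norm_sq]
  by_cases hx : ‖x‖ ≤ R
  · rw [Set.indicator_of_mem (by simpa using hx), one_mul]
    calc _ ≤ γ * K x * ‖q x‖ ^ 2 := by gcongr; exact hK4 x
      _ ≤ γ * (p x ^ 2 + K x * ‖q x‖ ^ 2) := by
        rw [mul_assoc]; gcongr; linarith [sq_nonneg (p x)]
  · rw [gradient_eq_zero_of_const hK3 (hR.trans (not_le.1 hx)),
      Set.indicator_of_notMem (by simpa using hx)]
    simp

/-! ### The Gronwall argument and the decay rate. -/

/-- A Gronwall type argument: if `Y` has derivative at most `γ E` and `(t - C) E ≤ M √(log t) + Y`, then `E` is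
`O(t ^ (γ - 1) √(log t))`. -/
theorem isBigO_of_integral_inequality {E Y Y' : ℝ → ℝ} {γ C M t₀ : ℝ} (hγ : 0 ≤ γ) (hγ1 : γ < 1)
    (hE : ∀ t, 0 ≤ E t) (hY : ∀ t, HasDerivAt Y (Y' t) t)
    (hY' : ∀ t, t₀ ≤ t → Y' t ≤ γ * E t) (hM : 0 ≤ M)
    (hle : ∀ t, t₀ ≤ t → (t - C) * E t ≤ M * √(Real.log t) + Y t) :
    E =O[atTop] fun t : ℝ => t ^ (γ - 1) * √(Real.log t) := by
  -- Beyond `C + 1` one has `t - C ≥ 1`, and beyond `3 > e` the logarithm is at least `1`.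
  set t₁ := max t₀ (max (C + 1) 3) with ht₁
  have h1 : t₀ ≤ t₁ := le_max_left _ _
  have h2 : C + 1 ≤ t₁ := (le_max_left _ _).trans (le_max_right _ _)
  have h3 : 3 ≤ t₁ := (le_max_right _ _).trans (le_max_right _ _)
  refine IsBigO.of_bound (2 * (|Y t₁| + M)) ?_
  filter_upwards [eventually_ge_atTop t₁, eventually_ge_atTop (2 * C)] with T hT hTC
  have hT0 : 0 < T := by linarith
  have hlog1 : 1 ≤ Real.log T := by
    rw [Real.le_log_iff_exp_le hT0]
    have := Real.exp_one_lt_d9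
    linarith
  set B := M * √(Real.log T) with hB
  have hsl : 1 ≤ √(Real.log T) := Real.one_le_sqrt.2 hlog1
  have hTC1 : 1 ≤ T - C := by linarith
  -- The slowly growing term is frozen at its value `B` at the final time `T`, which dominates
  -- earlier values. Then `(t - C) Y' ≤ γ (Y + B)`, so `(t - C)^(-γ)` is an integrating factor.
  have hanti : AntitoneOn (fun t => (Y t + B) * (t - C) ^ (-γ)) (Set.Icc t₁ T) := by
    have hder : ∀ t ∈ Set.Icc t₁ T, HasDerivAt (fun t => (Y t + B) * (t - C) ^ (-γ))
        (Y' t * (t - C) ^ (-γ) + (Y t + B) * (1 * (-γ) * (t - C) ^ (-γ - 1))) t := by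
      intro t ht
      have hpos : 0 < t - C := by linarith [ht.1]
      exact ((hY t).add_const B).mul
        (((hasDerivAt_id t).sub_const C).rpow_const (Or.inl hpos.ne'))
    refine antitoneOn_of_deriv_nonpos (convex_Icc _ _)
      (fun t ht => (hder t ht).continuousAt.continuousWithinAt)
      (fun t ht => (hder t (interior_subset ht)).differentiableAt.differentiableWithinAt) ?_
    intro t ht
    have ht' := interior_subset ht
    rw [(hder t ht').deriv]
    have hpos : 0 < t - C := by linarith [ht'.1]
    have ht0 : t₀ ≤ t := h1.trans ht'.1
    have e1 : (t - C) ^ (-γ) = (t - C) ^ (-γ - 1) * (t - C) := by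
      rw [← Real.rpow_add_one hpos.ne']; congr 1; ring
    have e2 : (t - C) * Y' t ≤ γ * (Y t + B) := by
      have hmono : M * √(Real.log t) ≤ B := by
        rw [hB]
        gcongr
        · linarith [ht'.1]
        · exact ht'.2
      calc (t - C) * Y' t ≤ (t - C) * (γ * E t) := by gcongr; exact hY' t ht0
        _ = γ * ((t - C) * E t) := by ring
        _ ≤ γ * (Y t + B) := by
          gcongr
          linarith [hle t ht0]
    have e3 : 0 ≤ (t - C) ^ (-γ - 1) := Real.rpow_nonneg hpos.le _
    rw [e1]
    have := mul_le_mul_of_nonneg_left e2 e3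
    linarith
  have h4 := hanti (Set.left_mem_Icc.2 hT) (Set.right_mem_Icc.2 hT) hT
  simp only at h4
  have h5 : (T - C) ^ (-γ) * ((T - C) * E T) ≤ (|Y t₁| + M) * √(Real.log T) := by
    have h6 : (T - C) * E T ≤ Y T + B := by linarith [hle T (h1.trans hT)]
    have h7 : (t₁ - C) ^ (-γ) ≤ 1 :=
      Real.rpow_le_one_of_one_le_of_nonpos (by linarith) (by linarith)
    have h8 : 0 ≤ (t₁ - C) ^ (-γ) := Real.rpow_nonneg (by linarith) _
    calc _ ≤ (T - C) ^ (-γ) * (Y T + B) := by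
          have : 0 ≤ (T - C) ^ (-γ) := Real.rpow_nonneg (by linarith) _
          gcongr
      _ ≤ (Y t₁ + B) * (t₁ - C) ^ (-γ) := by linarith
      _ ≤ (|Y t₁| + B) * (t₁ - C) ^ (-γ) := by gcongr; exact le_abs_self _
      _ ≤ (|Y t₁| + B) * 1 := by gcongr
      _ ≤ _ := by
        rw [mul_one, add_mul]
        gcongr
        exact le_mul_of_one_le_right (abs_nonneg _) hsl
  have hTCpos : 0 < T - C := by linarith
  have h9 : (T - C) ^ (-γ) * (T - C) = (T - C) ^ (1 - γ) := by
    rw [← Real.rpow_add_one hTCpos.ne']; congr 1; ring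
  rw [← mul_assoc, h9] at h5
  have h10 : T ^ (1 - γ) ≤ 2 * (T - C) ^ (1 - γ) := by
    calc T ^ (1 - γ) ≤ (2 * (T - C)) ^ (1 - γ) := by
          apply Real.rpow_le_rpow hT0.le <;> linarith
      _ = 2 ^ (1 - γ) * (T - C) ^ (1 - γ) := Real.mul_rpow (by norm_num) hTCpos.le
      _ ≤ 2 ^ (1:ℝ) * (T - C) ^ (1 - γ) := by
          gcongr
          · norm_num
          · linarith
      _ = _ := by rw [Real.rpow_one]
  have h11 : T ^ (γ - 1) * T ^ (1 - γ) = 1 := by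
    rw [← Real.rpow_add hT0]; simp
  have h12 : 0 ≤ T ^ (γ - 1) := Real.rpow_nonneg hT0.le _
  rw [Real.norm_of_nonneg (hE T), Real.norm_of_nonneg (by positivity)]
  calc E T = T ^ (γ - 1) * (T ^ (1 - γ) * E T) := by rw [← mul_assoc, h11, one_mul]
    _ ≤ T ^ (γ - 1) * (2 * (T - C) ^ (1 - γ) * E T) := by
        have := hE T
        gcongr
    _ = T ^ (γ - 1) * (2 * ((T - C) ^ (1 - γ) * E T)) := by ring
    _ ≤ T ^ (γ - 1) * (2 * ((|Y t₁| + M) * √(Real.log T))) := by gcongr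
    _ = _ := by ring

/-- The `L²` norm of a solution with compactly supported data grows at most like `√(log t)`. -/
theorem IsExtendedSolution.exists_norm_le_sqrt_log {K : Plane → ℝ} {hK : IsBoundedMeas K}
    {u ut : ℝ → PlaneL2} {g : ℝ → PlaneVecL2} (hu : IsExtendedSolution K hK u ut g)
    {km : ℝ} (hkm : 0 < km) (hK1 : ∀ x, km ≤ K x) {k₀ r₀ L : ℝ} (hr₀ : 0 < r₀)
    (hK3 : ∀ x, r₀ < ‖x‖ → K x = k₀) (hu0 : ∀ᵐ x, L < ‖x‖ → u 0 x = 0)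
    (hut : ∀ᵐ x, L < ‖x‖ → ut 0 x = 0) (hg : ∀ᵐ x, L < ‖x‖ → g 0 x = 0) :
    ∃ A : ℝ, 0 ≤ A ∧ ∀ t, 3 ≤ t → ‖u t‖ ≤ A * √(Real.log t) := by
  have hK0 : ∀ x, 0 < K x := fun x => hkm.trans_le (hK1 x)
  set c := max L r₀ + 4 with hc
  have hc0 : 0 ≤ c := by have := le_max_right L r₀; linarith
  -- Chosen so that `√k₀ s + c ≤ a t - t` for `s ≤ t` and `t ≥ 1`. With `Λ = 2 + 2 log (a t)` one
  -- has `exp Λ = e² (a t)²`, which exceeds `1 + |x|²` on the support; the summand `2` secures `Λ ≥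
  -- 2`.
  set a := 1 + √k₀ + c with ha
  have hs0 : 0 ≤ √k₀ := Real.sqrt_nonneg _
  have ha1 : 1 ≤ a := by linarith
  set Q := (1 + L ^ 2) ^ 2 * Real.exp 1 / km * ‖ut 0‖ ^ 2 with hQ
  have hQ0 : 0 ≤ Q := by positivity
  have hla : 0 ≤ Real.log a := Real.log_nonneg ha1
  refine ⟨√(‖u 0‖ ^ 2 + Q * (4 + 2 * Real.log a)), Real.sqrt_nonneg _, fun t ht => ?_⟩
  have ht0 : 0 < t := by linarith
  have hlog : 1 ≤ Real.log t := by
    rw [Real.le_log_iff_exp_le ht0]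
    have := Real.exp_one_lt_d9
    linarith
  have hbd := hu.norm_sq_le hkm hK1 hut (t := t) (Λ := 2 + 2 * Real.log (a * t)) ht0.le
    (by have : 0 ≤ Real.log (a * t) := Real.log_nonneg (by nlinarith)
        linarith) (by
      intro s hs
      filter_upwards [hu.support hK0 hr₀ hK3 hu0 hut hg hs.1] with x hx hxt
      refine hx ?_
      by_contra! hle
      have h1 : Real.exp (2 + 2 * Real.log (a * t)) = Real.exp 2 * (a * t) ^ 2 := by
        rw [Real.exp_add, mul_comm 2 (Real.log _), Real.exp_mul, Real.exp_log (by positivity)]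
        norm_num
      have h2 : (1:ℝ) ≤ Real.exp 2 := Real.one_le_exp (by norm_num)
      have h3 : (a * t) ^ 2 ≤ Real.exp 2 * (a * t) ^ 2 :=
        le_mul_of_one_le_left (sq_nonneg _) h2
      have h4 : ‖x‖ ≤ a * t - t := by
        have e1 : √k₀ * s ≤ √k₀ * t := by gcongr; exact hs.2
        have e2 : c ≤ c * t := le_mul_of_one_le_right hc0 (by linarith)
        rw [ha]; linarith
      nlinarith [norm_nonneg x])
  rw [← Real.sqrt_mul (by positivity)]
  refine Real.le_sqrt_of_sq_le (hbd.trans ?_)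
  rw [Real.log_mul (by positivity) ht0.ne', add_mul, mul_assoc Q]
  refine add_le_add (le_mul_of_one_le_right (sq_nonneg _) hlog)
    (mul_le_mul_of_nonneg_left ?_ hQ0)
  nlinarith

/-- Local energy decay for solutions with compactly supported data. -/
theorem IsExtendedSolution.localEnergy_isBigO {K : Plane → ℝ} {hK : IsBoundedMeas K}
    {u ut : ℝ → PlaneL2} {g : ℝ → PlaneVecL2} (hu : IsExtendedSolution K hK u ut g)
    (hKd : ContDiff ℝ 1 K) {D : ℝ} (hD : ∀ x, ‖gradient K x‖ ≤ D)
    {km : ℝ} (hkm : 0 < km) (hK1 : ∀ x, km ≤ K x) {k₀ r₀ L : ℝ} (hr₀ : 0 < r₀)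
    (hK3 : ∀ x, r₀ < ‖x‖ → K x = k₀) (hk₀ : 0 < k₀) {γ : ℝ} (hγ : 0 ≤ γ) (hγ1 : γ < 1)
    (hK4 : ∀ x, inner ℝ x (gradient K x) ≤ γ * K x)
    (hu0 : ∀ᵐ x, L < ‖x‖ → u 0 x = 0) (hut : ∀ᵐ x, L < ‖x‖ → ut 0 x = 0)
    (hg : ∀ᵐ x, L < ‖x‖ → g 0 x = 0) {R : ℝ} (hR : r₀ < R) :
    (fun t => localEnergy K ut g R t) =O[atTop] fun t : ℝ => t ^ (γ - 1) * √(Real.log t) := by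
  have hK0 : ∀ x, 0 < K x := fun x => hkm.trans_le (hK1 x)
  have hK0' : ∀ x, 0 ≤ K x := fun x => (hK0 x).le
  have hD' : ∀ x, |inner ℝ x (gradient K x)| ≤ r₀ * D := by
    intro x
    have hD0 : 0 ≤ D := (norm_nonneg _).trans (hD x)
    by_cases hx : r₀ < ‖x‖
    · rw [gradient_eq_zero_of_const hK3 hx, inner_zero_right, abs_zero]; positivity
    · refine (abs_real_inner_le_norm _ _).trans ?_
      exact mul_le_mul (not_lt.1 hx) (hD x) (norm_nonneg _) hr₀.le
  have hB : IsBoundedMeas (fun x => inner ℝ x (gradient K x)) :=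
    (continuous_id.inner (continuous_gradient hKd)).isBoundedMeas hD'
  obtain ⟨A, hA0, hA⟩ := hu.exists_norm_le_sqrt_log hkm hK1 hr₀ hK3 hu0 hut hg
  set c := max L r₀ + 4 with hc
  have hc0 : 0 ≤ c := by have := le_max_right L r₀; linarith
  set C := R / √km + c / √k₀ with hC
  have hC0 : 0 ≤ C := by have : 0 ≤ R := by linarith
                         positivity
  set E₀ := weightedEnergy K (fun _ => 1) (ut 0) (g 0) with hE₀
  have hnut : ∀ t, 0 ≤ t → ‖ut t‖ ≤ √(2 * E₀) := by
    intro t ht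
    have h := hu.energy_antitone hK0' le_rfl ht
    rw [IsExtendedSolution.weightedEnergy_one K hK (ut t), real_inner_self_eq_norm_sq] at h
    refine Real.le_sqrt_of_sq_le ?_
    have h2 : 0 ≤ inner ℝ (scalarMul Plane K hK (g t)) (g t) := by
      rw [inner_scalarMul]
      refine integral_nonneg fun x => ?_
      simp only [real_inner_self_eq_norm_sq, Pi.zero_apply]
      exact mul_nonneg (hK0' x) (sq_nonneg _)
    linarith
  obtain ⟨w₀, hw₀⟩ := exists_radial_add (p := u 0) hg
  set Z := inner ℝ (ut 0) w₀ - 1 / 2 * inner ℝ (ut 0) (u 0) + C * E₀ with hZ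
  have hcont : Continuous fun s => (inner ℝ (scalarMul Plane _ hB (g s)) (g s) : ℝ) :=
    ((scalarMul Plane _ hB).continuous.comp hu.continuous_grad).inner hu.continuous_grad
  -- `Y` is the time integral itself rather than `γ ∫ E_R`: only the upper bound on its derivative
  -- is used, and `x · ∇K` may be negative.
  refine isBigO_of_integral_inequality (γ := γ) (C := C) (M := |Z| + 1 / 2 * (√(2 * E₀) * A))
    (t₀ := 3) (Y := fun t => 1 / 2 * ∫ s in (0:ℝ)..t, inner ℝ (scalarMul Plane _ hB (g s)) (g s))
    (Y' := fun t => 1 / 2 * inner ℝ (scalarMul Plane _ hB (g t)) (g t)) hγ hγ1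
    (fun t => localEnergy_nonneg hK0' ut g R t) ?_ ?_ (by positivity) ?_
  · intro t
    exact (hcont.integral_hasStrictDerivAt 0 t).hasDerivAt.const_mul _
  · intro t _
    rw [localEnergy_eq]
    exact inner_radial_le hK hγ hK3 hK4 hR hB (ut t) (g t)
  · intro t ht
    have ht0 : 0 ≤ t := by linarith
    have hfs := hu.finite_speed hK0 hr₀ hK3 hut hg ht0
    obtain ⟨w, hw⟩ := exists_radial_add (p := u t) (q := g t) (ρ := √k₀ * t + c)
      (hfs.mono fun x hx hxt => (hx hxt).2)
    have h1 := localEnergy_le_morawetz hK hkm hK1 hk₀ hK3 (by linarith) hR ht0 hc0 hfs hw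
    have h2 := hu.morawetz_le hK0' hKd hD' hB ht0 hw₀ hw
    have h3 := hu.energy_antitone hK0' le_rfl ht0
    have h4 : C * weightedEnergy K (fun _ => 1) (ut t) (g t) ≤ C * E₀ := by gcongr
    have hlog : 1 ≤ √(Real.log t) := by
      rw [Real.one_le_sqrt, Real.le_log_iff_exp_le (by linarith)]
      have := Real.exp_one_lt_d9
      linarith
    have h5 : -inner ℝ (ut t) (u t) ≤ √(2 * E₀) * (A * √(Real.log t)) := by
      refine (neg_le_abs _).trans ((abs_real_inner_le_norm _ _).trans ?_)
      exact mul_le_mul (hnut t ht0) (hA t ht) (norm_nonneg _) (Real.sqrt_nonneg _)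
    have h6 : Z ≤ |Z| * √(Real.log t) :=
      (le_abs_self Z).trans (le_mul_of_one_le_right (abs_nonneg _) hlog)
    rw [localEnergy_eq]
    linarith

theorem theorem4p1
    (K : Plane → ℝ) (hK : IsBC1 K)
    (km : ℝ) (hkm : 0 < km) (hK1 : ∀ x, km ≤ K x)
    (k₀ r₀ : ℝ) (hr₀ : 0 < r₀) (hK3 : ∀ x, r₀ < ‖x‖ → K x = k₀)
    (γ₀ : ℝ) (hγ₀ : 0 ≤ γ₀) (hγ₁ : γ₀ < 1)
    (hK4 : ∀ x, inner ℝ x (gradient K x) ≤ γ₀ * K x)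
    (L : ℝ) (hL : 0 < L) (u₀ u₁ : Plane → ℝ)
    (hu₀ : ContDiff ℝ ∞ u₀) (hu₁ : ContDiff ℝ ∞ u₁)
    (hsupp₀ : tsupport u₀ ⊆ Metric.closedBall 0 L)
    (hsupp₁ : tsupport u₁ ⊆ Metric.closedBall 0 L)
    (R : ℝ) (hR : r₀ < R)
    (u ut : ℝ → PlaneL2) (gradu : ℝ → PlaneVecL2)
    (hu : IsEnergySolution K u₀ u₁ u ut gradu) :
    (fun t : ℝ => localEnergy K ut gradu R t) =O[atTop]
      (fun t : ℝ => t ^ (γ₀ - 1) * √(Real.log t)) := by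
  obtain ⟨CK, hCK⟩ := hK.bounded
  obtain ⟨D, hD⟩ := hK.bounded_deriv
  have hKb : IsBoundedMeas K := hK.contDiff.continuous.isBoundedMeas hCK
  have hk₀ : 0 < k₀ := by
    obtain ⟨x, hx⟩ := NormedSpace.exists_lt_norm ℝ Plane r₀
    exact hkm.trans_le (hK3 x hx ▸ hK1 x)
  obtain ⟨v, vt, w, hv, heq⟩ := hu.exists_extended hKb
  have hzero : ∀ {φ : Plane → ℝ} {f : PlaneL2}, f =ᵐ[volume] φ →
      tsupport φ ⊆ Metric.closedBall 0 L → ∀ᵐ x, L < ‖x‖ → f x = 0 := by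
    intro φ f hf hs
    filter_upwards [hf] with x hx hxL
    rw [hx]
    refine image_eq_zero_of_notMem_tsupport fun h => ?_
    have := hs h
    rw [mem_closedBall_zero_iff] at this
    exact absurd this (not_le.2 hxL)
  have h0 := heq 0 le_rfl
  have hv0 : ∀ᵐ x, L < ‖x‖ → v 0 x = 0 := by
    rw [h0.1]; exact hzero hu.initial_value hsupp₀
  have hvt0 : ∀ᵐ x, L < ‖x‖ → vt 0 x = 0 := by
    rw [h0.2.1]; exact hzero hu.initial_velocity hsupp₁
  -- The initial gradient vanishes outside the ball because the initial value does so on that open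
  -- set; it need not be identified with the classical gradient of `u₀`.
  have hw0 : ∀ᵐ x, L < ‖x‖ → w 0 x = 0 :=
    (hv.hasWeakGradient 0 le_rfl).ae_eq_zero (isOpen_lt continuous_const continuous_norm) hv0
  refine (hv.localEnergy_isBigO hK.contDiff hD hkm hK1 hr₀ hK3 hk₀ hγ₀ hγ₁ hK4 hv0 hvt0 hw0
    hR).congr' ?_ EventuallyEq.rfl
  filter_upwards [eventually_ge_atTop 0] with t ht
  obtain ⟨-, h2, h3⟩ := heq t ht
  simp only [localEnergy, h2, h3]
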